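/- Let $n\ge 0$, $a_1<\dots<a_n$ real, $\nu_k,\bar\nu_k\in\mathbb C$ ($\bar\nu_k$ is an independent parameter, not the complex conjugate) and $\gamma_k=(\nu_k+\bar\nu_k)/2$. Let $F$ be holomorphic and non-vanishing on an open set $U\subset\mathbb C$ that contains a strip $\{|\Im z|<\eta\}$, $\eta>0$, with $F(z)-1=O(|z|^{-(1+\kappa)/2})$ as $z\to\infty$ in $U$ for some $\kappa>0$. For $\xi\in\mathbb R\setminus\{a_1,\dots,a_n\}$ put $$\sigma(\xi)=F(\xi)\prod_{k=1}^n\Big(\frac{\xi-a_k+i}{\xi-a_k}\Big)^{\nu_k}\Big(\frac{\xi-a_k-i}{\xi-a_k}\Big)^{\bar\nu_k}$$ with principal powers. Let $x>0$, and let $K$ be the truncated Wiener–Hopf operator $(Kg)(t)=\int_0^x K(t-t')g(t')\,dt'$ on $L^2([0,x])$ with kernel $K(t)=\frac1{2\pi}\int_{\mathbb R}(\sigma(\xi)-1)e^{-it\xi}\,d\xi$ (the inverse Fourier transform on $L^1(\mathbb R)+L^2(\mathbb R)$), and let $\det_2(I+K)=\det\big((I+K)e^{-K}\big)$ be its 2-regularized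 Fredholm determinant. Put $$g(z)=\int_{\mathbb R}\frac{ds}{2\pi i}\,\frac{\sigma(s)-1}{z-s},\qquad B(z)=\begin{pmatrix}-1&e^{ixz}\\-e^{-ixz}&1\end{pmatrix},\qquad G(t)=\begin{pmatrix}2-\sigma(t)&(\sigma(t)-1)e^{ixt}\\(1-\sigma(t))e^{-ixt}&\sigma(t)\end{pmatrix}.$$ Consider the Riemann–Hilbert problem for a $2\times2$ matrix function $\chi$ on $\mathbb C\setminus\mathbb R$: 1. $\chi$ is analytic on $\mathbb C\setminus\mathbb R$; 2. for every $k$ there is $M_k\in GL_2(\mathbb C)$ such that $\chi(z)=M_k\{I_2+g(z)B(a_k)+R_k(z)\}$ as $z\to a_k$, where all entries of $R_k(z)$ are $O\big(|z-a_k|(|g(z)|+1)\big)$; 3. $\chi(z)\to I_2$ as $z\to\infty$ in $\mathbb C\setminus\mathbb R$; 4. for every $t\in\mathbb R\setminus\{a_1,\dots,a_n\}$ the limits $\chi_\pm(t)$ of $\chi(z)$ as $z\to t$ in the open upper ($+$), respectively lower ($-$), half-plane exist, and $\chi_+(t)G(t)=\chi_-(t)$. Suppose that $\Re\gamma_k<1/2$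 for all $k$ and $\det_2(I+K)\ne0$. Then this Riemann–Hilbert problem has a solution, and the solution is unique on $\mathbb C\setminus\mathbb R$. Moreover every solution satisfies $\det\chi(z)=1$ for all $z\in\mathbb C\setminus\mathbb R$. -/

import Mathlib

open Filter Topology MeasureTheory
open scoped FourierTransform

noncomputable section

namespace WienerHopfRHP

/-! ### The symbol -/

/-- The pure Fisher–Hartwig symbol
`((ξ + i) / (ξ + i0⁺)) ^ ν * ((ξ - i) / (ξ - i0⁺)) ^ νbar` with principal powers, for real `ξ ≠ 0`.
There both quotients have real part `1`, so the powers are continuous and the limits `i0⁺` may be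
taken inside.  (The value at `ξ = 0` is irrelevant.) -/
def pureSymbol (ν νbar : ℂ) (ξ : ℝ) : ℂ :=
  (((ξ : ℂ) + Complex.I) / (ξ : ℂ)) ^ ν * (((ξ : ℂ) - Complex.I) / (ξ : ℂ)) ^ νbar

/-- `σ(ξ) = F(ξ) ∏ₖ σ_{νₖ, νbarₖ}(ξ - aₖ)`. -/
def symbol {n : ℕ} (a : Fin n → ℝ) (ν νbar : Fin n → ℂ) (F : ℂ → ℂ) (ξ : ℝ) : ℂ :=
  F (ξ : ℂ) * ∏ k, pureSymbol (ν k) (νbar k) (ξ - a k)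

/-! ### The truncated Wiener–Hopf operator and its 2-regularized determinant -/

/-- The inverse Fourier transform `𝓕⁻¹[h](t) = (1 / 2π) ∫ h(ξ) e^{-itξ} dξ` on `L¹(ℝ) + L²(ℝ)`:
the absolutely convergent integral for the part of `h` of modulus larger than `1` (this part is
integrable for `h ∈ L¹ + L²`), plus the Plancherel transform of the part of modulus at most `1`
(this part is square integrable for `h ∈ L¹ + L²`).  Mathlib's `𝓕` has the phase `e^{-2πivw}`,
whence its argument `t / 2π`. -/
def invFourier (h : ℝ → ℂ) (t : ℝ) : ℂ :=
  open Classical in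
  (1 / (2 * (Real.pi : ℂ))) *
    ((∫ ξ : ℝ, Set.indicator {ξ : ℝ | 1 < ‖h ξ‖} h ξ * Complex.exp (-(Complex.I * t * ξ))) +
      (if hs : MemLp (Set.indicator {ξ : ℝ | ‖h ξ‖ ≤ 1} h) 2 (volume : Measure ℝ) then
        ((𝓕 (hs.toLp _) : Lp ℂ 2 (volume : Measure ℝ)) : ℝ → ℂ) (t / (2 * Real.pi))
      else 0))

/-- The bounded operator on `L²(μ)` with kernel `k`, that is `(A g)(t) = ∫ k(t, s) g(s) dμ(s)`.
Such an operator is unique, and it exists for every kernel `k ∈ L²(μ × μ)`. -/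
def integralOperator {α : Type*} [MeasurableSpace α] (μ : Measure α) (k : α → α → ℂ) :
    Lp ℂ 2 μ →L[ℂ] Lp ℂ 2 μ :=
  open Classical in
  if h : ∃ A : Lp ℂ 2 μ →L[ℂ] Lp ℂ 2 μ,
      ∀ g : Lp ℂ 2 μ, (A g : α → ℂ) =ᵐ[μ] fun t => ∫ s, k t s * g s ∂μ
  then h.choose else 0

/-- The truncated Wiener–Hopf operator `(K g)(t) = ∫₀ˣ K(t - t') g(t') dt'` on `L²([0, x])`, whose
kernel is the function `K = 𝓕⁻¹[σ - 1]`. -/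
def wienerHopf (σ : ℝ → ℂ) (x : ℝ) :
    Lp ℂ 2 (volume.restrict (Set.Icc (0 : ℝ) x)) →L[ℂ] Lp ℂ 2 (volume.restrict (Set.Icc (0 : ℝ) x)) :=
  integralOperator (volume.restrict (Set.Icc (0 : ℝ) x))
    fun t t' => invFourier (fun ξ => σ ξ - 1) (t - t')

/-- The compression `P_E A|_E` of a bounded operator to a finite-dimensional subspace `E`. -/
def compression {H : Type*} [NormedAddCommGroup H] [InnerProductSpace ℂ H] (A : H →L[ℂ] H)
    (E : {E : Submodule ℂ H // FiniteDimensional ℂ E}) : E.1 →ₗ[ℂ] E.1 :=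
  haveI := E.2
  ((E.1.orthogonalProjectionOnto ∘L A ∘L E.1.subtypeL : E.1 →L[ℂ] E.1) : E.1 →ₗ[ℂ] E.1)

/-- The Fredholm determinant of `A = I + T` with `T` of trace class: the limit of the determinants
of the compressions of `A` along the finite-dimensional subspaces, directed by inclusion. -/
def fredholmDet {H : Type*} [NormedAddCommGroup H] [InnerProductSpace ℂ H] (A : H →L[ℂ] H) : ℂ :=
  limUnder atTop fun E : {E : Submodule ℂ H // FiniteDimensional ℂ E} =>
    LinearMap.det (compression A E)

/-- The 2-regularized determinant `det₂(I + K) = det((I + K) e^{-K})` of a Hilbert–Schmidt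
operator `K`. -/
def det₂ {H : Type*} [NormedAddCommGroup H] [InnerProductSpace ℂ H] [CompleteSpace H]
    (K : H →L[ℂ] H) : ℂ :=
  fredholmDet ((1 + K) * NormedSpace.exp (-K))

/-! ### The Riemann–Hilbert problem -/

/-- `g(z) = ∫ (σ(s) - 1) / (z - s) ds / (2πi)`. -/
def cauchyTransform (σ : ℝ → ℂ) (z : ℂ) : ℂ :=
  ∫ s : ℝ, (1 / (2 * (Real.pi : ℂ) * Complex.I)) * ((σ s - 1) / (z - (s : ℂ)))

/-- The rank one matrix `B(z)`. -/
def rankOneMatrix (x : ℝ) (z : ℂ) : Matrix (Fin 2) (Fin 2) ℂ :=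
  !![-1, Complex.exp (Complex.I * x * z); -Complex.exp (-(Complex.I * x * z)), 1]

/-- The jump matrix `G(t)`, for `t ∈ ℝ`. -/
def jumpMatrix (σ : ℝ → ℂ) (x t : ℝ) : Matrix (Fin 2) (Fin 2) ℂ :=
  !![2 - σ t, (σ t - 1) * Complex.exp (Complex.I * x * t);
     (1 - σ t) * Complex.exp (-(Complex.I * x * t)), σ t]

/-- `χ` solves the Riemann–Hilbert problem on `ℂ ∖ ℝ`; its values on `ℝ` are irrelevant.
The `+` side of `ℝ` is the upper half-plane, and the boundary values `χ₊(t)`, `χ₋(t)` are limits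
within the whole open half-planes. -/
structure IsRHPSolution {n : ℕ} (a : Fin n → ℝ) (σ : ℝ → ℂ) (x : ℝ)
    (χ : ℂ → Matrix (Fin 2) (Fin 2) ℂ) : Prop where
  analytic : ∀ i j, DifferentiableOn ℂ (fun z => χ z i j) {z : ℂ | z.im ≠ 0}
  singular : ∀ k, ∃ (M : GL (Fin 2) ℂ) (R : ℂ → Matrix (Fin 2) (Fin 2) ℂ),
    (∀ᶠ z in 𝓝[{z : ℂ | z.im ≠ 0}] (a k : ℂ),
      χ z = (M : Matrix (Fin 2) (Fin 2) ℂ) *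
        (1 + cauchyTransform σ z • rankOneMatrix x (a k) + R z)) ∧
    ∀ i j, (fun z => R z i j) =O[𝓝[{z : ℂ | z.im ≠ 0}] (a k : ℂ)]
      fun z => ‖z - (a k : ℂ)‖ * (‖cauchyTransform σ z‖ + 1)
  infinity : Tendsto χ (Bornology.cobounded ℂ ⊓ 𝓟 {z : ℂ | z.im ≠ 0}) (𝓝 1)
  jump : ∀ t : ℝ, (∀ k, t ≠ a k) → ∃ χp χm : Matrix (Fin 2) (Fin 2) ℂ,
    Tendsto χ (𝓝[{z : ℂ | 0 < z.im}] (t : ℂ)) (𝓝 χp) ∧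
    Tendsto χ (𝓝[{z : ℂ | z.im < 0}] (t : ℂ)) (𝓝 χm) ∧
    χp * jumpMatrix σ x t = χm

end WienerHopfRHP

end

/-!
The solution is built from the equation `(I + K) φ = K(· - ρ)` on `[0, x]`, for `ρ = x` and `ρ = 0`.

Only three properties of `σ - 1` matter: it is locally integrable, and square integrable and slowly
varying at infinity (`vanishingDensity_symbol`), it is Lipschitz near every point other than the
`aₖ` (`lipschitzNear_symbol`), and its singularities at the `aₖ` are weaker than simple poles, since
`Re γₖ < 1/2` (`mildSingularity_symbol`). They imply that the Cauchy integral tends to `0`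
at infinity uniformly up to the real line (`VanishingDensity.tendsto_cauchyIntegral`), satisfies
Plemelj's formula (`exists_tendsto_cauchyIntegral`) and is `o(1 / |z - aₖ|)` at `aₖ`
(`MildSingularity.tendsto_mul_cauchyIntegral`).

*Existence.* The operator `K` is compact, a norm limit of operators with polynomial kernels
(`IsConvolution.isCompactOperator`). If `I + K` had a kernel vector, then every compression of
`(I + K) e^{-K}` to a subspace containing it would be singular and the determinant would vanish; so
`I + K` is onto, by the Fredholm alternative (`surjective_one_add_of_det₂_ne_zero`). With `φ` the
solution of the equation, `f(z) = e^{iρz} - ∫₀ˣ e^{iτz} φ(τ) dτ` is entire and bounded on horizontal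
strips, and Parseval's identity (`VanishingDensity.integral_invFourier_mul`) turns the equation into
`f(z) = e^{iρz} + (1 / 2πi) ∫ (σ(s) - 1) f(s) (1 - e^{ix(z - s)}) / (z - s) ds`
(`exists_entire_solution`). Write `B = u vᵀ` with `u(z) = (e^{ixz}, 1)` and `v(z) = (-e^{-ixz}, 1)`,
so that `v · u = 0` and `B² = 0`, and let `f` now be the vector of the two solutions. The equation
says that `χ(z) = 1 + (1 / 2πi) ∫ (σ(s) - 1) f(s) v(s)ᵀ / (z - s) ds` satisfies `χ u = f`. On the
other hand `χ = N + g f vᵀ` with an entire matrix `N`, made of Cauchy integrals of difference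
quotients; hence `N u = f` and `χ = N (1 + g B)`. Since `det (1 + g B) = 1`, the entire function
`det N = det χ` tends to `1` at infinity off the real line, so it is `1` by Liouville's theorem
(`exists_entire_factor`). The conditions on `χ` are read off from `χ = N (1 + g B)`, because the
jump matrix is `1 + (σ - 1) B` and `g` jumps by `σ - 1` (`isRHPSolution_of_entire_factor`).

*Uniqueness.* For another solution `χ'` the quotient `χ' χ⁻¹` has no jump and satisfies
`(z - aₖ) χ' χ⁻¹ → 0` at `aₖ`. By Painlevé's and Liouville's theorems (`eq_limit_of_off_real`) it is
`1` (`eqOn_of_entire_factor`). In particular every solution has determinant `1`.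
-/

namespace WienerHopfRHP

/-! ### Holomorphic functions off the real line -/

/-- Painlevé's theorem for the real line: a continuous function on an open set that is holomorphic
off the real line is holomorphic. Rectangles crossing the line are cut along it. -/
lemma differentiableOn_of_continuousOn_of_off_real {f : ℂ → ℂ} {U : Set ℂ} (hU : IsOpen U)
    (hc : ContinuousOn f U) (hd : DifferentiableOn ℂ f (U ∩ {z : ℂ | z.im ≠ 0})) :
    DifferentiableOn ℂ f U := by
  refine (Complex.isConservativeOn_and_continuousOn_iff_isDifferentiableOn hU).1 ⟨?_, hc⟩
  intro z w hzw
  rw [← add_eq_zero_iff_eq_neg, Complex.wedgeIntegral_add_wedgeIntegral_eq]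
  -- The boundary integral vanishes for a rectangle whose interior avoids the real line.
  have key : ∀ p q : ℝ, Set.uIcc p q ⊆ Set.uIcc z.im w.im →
      (∀ y ∈ Set.Ioo (min p q) (max p q), y ≠ 0) →
      (∫ x : ℝ in z.re..w.re, f (x + p * Complex.I)) -
      (∫ x : ℝ in z.re..w.re, f (x + q * Complex.I)) +
      Complex.I • (∫ y : ℝ in p..q, f (w.re + y * Complex.I)) -
      Complex.I • (∫ y : ℝ in p..q, f (z.re + y * Complex.I)) = 0 := by
    intro p q hpq h0
    have hsub : (Set.uIcc z.re w.re ×ℂ Set.uIcc p q) ⊆ U := fun y hy =>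
      hzw ⟨hy.1, hpq hy.2⟩
    have := Complex.integral_boundary_rect_eq_zero_of_continuousOn_of_differentiableOn f
      ⟨z.re, p⟩ ⟨w.re, q⟩ (hc.mono hsub) (hd.mono fun y hy =>
        ⟨hsub ⟨Set.Ioo_subset_Icc_self hy.1, Set.Ioo_subset_Icc_self hy.2⟩, h0 _ hy.2⟩)
    simpa using this
  by_cases h0 : (0 : ℝ) ∈ Set.uIcc z.im w.im
  · have hv : ∀ b ∈ Set.uIcc z.re w.re, ∀ p q : ℝ, p ∈ Set.uIcc z.im w.im →
        q ∈ Set.uIcc z.im w.im →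
        IntervalIntegrable (fun y : ℝ => f (b + y * Complex.I)) volume p q := by
      intro b hb p q hp hq
      apply ContinuousOn.intervalIntegrable
      refine hc.comp (by fun_prop) fun y hy => hzw ?_
      refine ⟨by simpa using hb, ?_⟩
      simpa using Set.uIcc_subset_uIcc hp hq hy
    have h1 := key z.im 0 (Set.uIcc_subset_uIcc_left h0) (by
      rintro y ⟨hy1, hy2⟩ rfl
      rcases le_total z.im 0 with h | h <;> simp [h] at hy1 hy2)
    have h2 := key 0 w.im (Set.uIcc_subset_uIcc_right h0) (by
      rintro y ⟨hy1, hy2⟩ rfl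
      rcases le_total w.im 0 with h | h <;> simp [h] at hy1 hy2)
    have e1 := intervalIntegral.integral_add_adjacent_intervals
      (hv w.re Set.right_mem_uIcc z.im 0 Set.left_mem_uIcc h0)
      (hv w.re Set.right_mem_uIcc 0 w.im h0 Set.right_mem_uIcc)
    have e2 := intervalIntegral.integral_add_adjacent_intervals
      (hv z.re Set.left_mem_uIcc z.im 0 Set.left_mem_uIcc h0)
      (hv z.re Set.left_mem_uIcc 0 w.im h0 Set.right_mem_uIcc)
    rw [← e1, ← e2]
    simp only [smul_eq_mul] at h1 h2 ⊢
    linear_combination h1 + h2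
  · refine key z.im w.im subset_rfl ?_
    rintro y hy rfl
    exact h0 (Set.Ioo_subset_Icc_self hy)

lemma dense_im_ne_zero : Dense {z : ℂ | z.im ≠ 0} := by
  intro z
  rw [Metric.mem_closure_iff]
  intro ε hε
  by_cases hz : z.im = 0
  · refine ⟨z + (ε / 2 : ℝ) * Complex.I, by simp [hz, hε.ne'], ?_⟩
    rw [dist_eq_norm]
    simp [abs_of_pos hε]
    linarith
  · exact ⟨z, hz, by simpa using hε⟩

/-- Liouville's theorem, where the limit at infinity is only known off the real line. -/
lemma eq_of_tendsto_off_real {f : ℂ → ℂ} (hf : Differentiable ℂ f) {c : ℂ}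
    (h : Tendsto f (Bornology.cobounded ℂ ⊓ 𝓟 {z : ℂ | z.im ≠ 0}) (𝓝 c)) (z : ℂ) : f z = c := by
  refine hf.apply_eq_of_tendsto_cocompact z ?_
  rw [← Metric.cobounded_eq_cocompact, Metric.tendsto_nhds]
  intro ε hε
  have h1 := Metric.tendsto_nhds.1 h (ε / 2) (by positivity)
  rw [eventually_inf_principal] at h1
  rw [← comap_norm_atTop] at h1 ⊢
  rw [eventually_comap] at h1 ⊢
  obtain ⟨R, hR⟩ := eventually_atTop.1 h1
  filter_upwards [eventually_gt_atTop R] with r hr w hw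
  have hcl : IsClosed {y : ℂ | dist (f y) c ≤ ε / 2} :=
    isClosed_le (hf.continuous.dist continuous_const) continuous_const
  have hop : IsOpen {y : ℂ | R < ‖y‖} := isOpen_lt continuous_const continuous_norm
  have hsub : {y : ℂ | R < ‖y‖} ⊆ {y : ℂ | dist (f y) c ≤ ε / 2} := by
    refine (dense_im_ne_zero.open_subset_closure_inter hop).trans (closure_minimal ?_ hcl)
    rintro y ⟨hy1, hy2⟩
    exact (hR _ (le_of_lt hy1) y rfl hy2).le
  have : dist (f w) c ≤ ε / 2 := hsub (show R < ‖w‖ by rw [hw]; exact hr)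
  linarith

/-- An entire function vanishing on a finite set is divisible by the corresponding polynomial. -/
lemma exists_entire_eq_mul_prod {A : Finset ℂ} {E : ℂ → ℂ} (hE : Differentiable ℂ E)
    (hA : ∀ a ∈ A, E a = 0) :
    ∃ Q : ℂ → ℂ, Differentiable ℂ Q ∧ ∀ z, E z = Q z * ∏ a ∈ A, (z - a) := by
  classical
  induction A using Finset.induction_on generalizing E with
  | empty => exact ⟨E, hE, by simp⟩
  | insert a A ha ih =>
    have hds : Differentiable ℂ (dslope E a) := by
      have := (Complex.differentiableOn_dslope (f := E) (s := Set.univ) (c := a)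
        Filter.univ_mem).2 hE.differentiableOn
      exact differentiableOn_univ.1 this
    have hmul : ∀ z, E z = (z - a) * dslope E a z := fun z => by
      have := sub_smul_dslope E a z
      rw [hA a (Finset.mem_insert_self _ _), sub_zero, smul_eq_mul] at this
      exact this.symm
    obtain ⟨Q, hQ, hQE⟩ := ih hds (fun b hb => by
      have h1 := hmul b
      rw [hA b (Finset.mem_insert_of_mem hb)] at h1
      have h2 : b - a ≠ 0 := sub_ne_zero.2 (fun h => ha (h ▸ hb))
      exact (mul_eq_zero.1 h1.symm).resolve_left h2)
    refine ⟨Q, hQ, fun z => ?_⟩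
    rw [hmul z, hQE z, Finset.prod_insert ha]
    ring

/-- A function that is holomorphic off the real line, extends continuously to the line outside a
finite set, is `o(1 / (z - a))` at the points of that set and has a limit at infinity is constant
off the line. -/
lemma eq_limit_of_off_real {A : Finset ℝ} {f : ℂ → ℂ} {c : ℂ}
    (hd : DifferentiableOn ℂ f {z : ℂ | z.im ≠ 0})
    (hlim : ∀ t : ℝ, t ∉ A → ∃ l, Tendsto f (𝓝[{z : ℂ | z.im ≠ 0}] (t : ℂ)) (𝓝 l))
    (hA : ∀ a ∈ A, Tendsto (fun z => (z - (a : ℂ)) * f z) (𝓝[{z : ℂ | z.im ≠ 0}] (a : ℂ)) (𝓝 0))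
    (hinf : Tendsto f (Bornology.cobounded ℂ ⊓ 𝓟 {z : ℂ | z.im ≠ 0}) (𝓝 c)) :
    ∀ z : ℂ, z.im ≠ 0 → f z = c := by
  classical
  set S : Set ℂ := {z : ℂ | z.im ≠ 0} with hS
  set P : ℂ → ℂ := fun z => ∏ a ∈ A.image (fun a : ℝ => (a : ℂ)), (z - a) with hP
  have hPd : Differentiable ℂ P := by
    rw [hP]; fun_prop
  have hP0 : ∀ z ∈ S, P z ≠ 0 := by
    intro z hz
    rw [hP]
    refine Finset.prod_ne_zero_iff.2 fun a ha => ?_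
    obtain ⟨a, -, rfl⟩ := Finset.mem_image.1 ha
    intro h
    rw [sub_eq_zero] at h
    exact hz (by rw [h]; simp)
  have hfP : DifferentiableOn ℂ (fun z => f z * P z) S := hd.mul hPd.differentiableOn
  have hfac : ∀ a ∈ A, ∃ q : ℂ → ℂ, Continuous q ∧ ∀ z, P z = (z - a) * q z := by
    intro a ha
    refine ⟨fun z => ∏ b ∈ (A.image (fun a : ℝ => (a : ℂ))).erase (a : ℂ), (z - b), by fun_prop,
      fun z => ?_⟩
    exact (Finset.mul_prod_erase _ (fun b => z - b) (Finset.mem_image_of_mem _ ha)).symm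
  have hzero : ∀ a ∈ A, Tendsto (fun z => f z * P z) (𝓝[S] (a : ℂ)) (𝓝 0) := by
    intro a ha
    obtain ⟨q, hq, hPq⟩ := hfac a ha
    have h1 := (hA a ha).mul (hq.tendsto (a : ℂ) |>.mono_left (nhdsWithin_le_nhds (s := S)))
    rw [zero_mul] at h1
    refine h1.congr fun z => ?_
    rw [hPq z]; ring
  have hext : ∀ z : ℂ, ∃ y, Tendsto (fun z => f z * P z) (𝓝[S] z) (𝓝 y) := by
    intro z
    by_cases hz : z ∈ S
    · exact ⟨_, (hfP.continuousOn z hz)⟩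
    · have hzr : z = ((z.re : ℝ) : ℂ) := by
        apply Complex.ext
        · simp
        · simpa [hS] using hz
      by_cases hzA : z.re ∈ A
      · rw [hzr]
        exact ⟨0, hzero _ hzA⟩
      · obtain ⟨l, hl⟩ := hlim z.re hzA
        rw [← hzr] at hl
        exact ⟨l * P z, hl.mul (hPd.continuous.tendsto z |>.mono_left nhdsWithin_le_nhds)⟩
  set E : ℂ → ℂ := extendFrom S (fun z => f z * P z) with hE
  have hEc : Continuous E := continuous_extendFrom dense_im_ne_zero hext
  have hES : ∀ z ∈ S, E z = f z * P z := fun z hz =>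
    extendFrom_eq (subset_closure hz) (hfP.continuousOn z hz)
  have hEd : Differentiable ℂ E := by
    have := differentiableOn_of_continuousOn_of_off_real (f := E) isOpen_univ hEc.continuousOn
      ((hfP.congr hES).mono Set.inter_subset_right)
    exact differentiableOn_univ.1 this
  obtain ⟨Q, hQ, hQE⟩ := exists_entire_eq_mul_prod (A := A.image (fun a : ℝ => (a : ℂ))) hEd (by
    intro b hb
    obtain ⟨a, ha, rfl⟩ := Finset.mem_image.1 hb
    exact extendFrom_eq (dense_im_ne_zero _) (hzero a ha))
  have hQf : ∀ z ∈ S, Q z = f z := fun z hz =>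
    mul_right_cancel₀ (hP0 z hz) ((hQE z).symm.trans (hES z hz))
  have hQc := eq_of_tendsto_off_real hQ (c := c) (hinf.congr' (by
    filter_upwards [mem_inf_of_right (mem_principal_self S)] with z hz using (hQf z hz).symm))
  intro z hz
  rw [← hQf z hz, hQc z]

/-- Holomorphic dependence of an integral on a parameter under a local domination; the derivative
is dominated through the Cauchy estimate. -/
lemma differentiableAt_integral_of_dominated {α : Type*} [MeasurableSpace α] {μ : Measure α}
    {F : ℂ → α → ℂ} {z : ℂ} {r : ℝ} (hr : 0 < r) {b : α → ℝ}
    (hmeas : ∀ w ∈ Metric.ball z r, AEStronglyMeasurable (F w) μ)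
    (hdiff : ∀ s, DifferentiableOn ℂ (fun w => F w s) (Metric.ball z r))
    (hb : Integrable b μ) (hbound : ∀ s, ∀ w ∈ Metric.ball z r, ‖F w s‖ ≤ b s) :
    DifferentiableAt ℂ (fun w => ∫ s, F w s ∂μ) z := by
  have hz : z ∈ Metric.ball z r := Metric.mem_ball_self hr
  have hdz : ∀ s, ∀ w ∈ Metric.ball z (r / 2),
      HasDerivAt (fun w => F w s) (deriv (fun w => F w s) w) w := fun s w hw =>
    ((hdiff s).differentiableAt (Metric.isOpen_ball.mem_nhds
      (Metric.ball_subset_ball (by linarith) hw))).hasDerivAt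
  refine (hasDerivAt_integral_of_dominated_loc_of_deriv_le (μ := μ) (F := F) (x₀ := z)
    (s := Metric.ball z (r / 2)) (bound := fun s => b s / (r / 4))
    (F' := fun w s => deriv (fun w => F w s) w) (Metric.ball_mem_nhds z (by linarith)) ?_ ?_ ?_ ?_
    (hb.div_const _) (Eventually.of_forall hdz)).2.differentiableAt
  · filter_upwards [Metric.ball_mem_nhds z hr] with w hw using hmeas w hw
  · exact hb.mono' (hmeas z hz) (Eventually.of_forall fun s => hbound s z hz)
  · -- The derivative is a limit of difference quotients, hence measurable.
    have hseq : Tendsto (fun n : ℕ => z + (((r / 2) / (n + 1 : ℝ) : ℝ) : ℂ)) atTop (𝓝[≠] z) := by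
      refine tendsto_nhdsWithin_iff.2 ⟨?_, Eventually.of_forall fun n => ?_⟩
      · have h1 : Tendsto (fun n : ℕ => (r / 2) / (n + 1 : ℝ)) atTop (𝓝 0) :=
          tendsto_const_nhds.div_atTop
            (tendsto_atTop_add_const_right _ _ tendsto_natCast_atTop_atTop)
        have h2 := (Complex.continuous_ofReal.tendsto 0).comp h1
        simpa using h2.const_add z
      · have : ((r / 2) / (n + 1 : ℝ) : ℝ) ≠ 0 := by positivity
        simpa only [Set.mem_compl_iff, Set.mem_singleton_iff, add_eq_left, Complex.ofReal_eq_zero]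
          using this
    refine aestronglyMeasurable_of_tendsto_ae atTop
      (f := fun (n : ℕ) s => slope (fun w => F w s) z (z + (((r / 2) / (n + 1 : ℝ) : ℝ) : ℂ))) ?_ ?_
    · intro n
      simp only [slope_def_field, div_eq_mul_inv]
      refine ((hmeas _ ?_).sub (hmeas z hz)).mul_const _
      rw [Metric.mem_ball, dist_eq_norm]
      have h1 : (0 : ℝ) < (r / 2) / (n + 1 : ℝ) := by positivity
      have h2 : (r / 2) / (n + 1 : ℝ) ≤ r / 2 :=
        div_le_self (by linarith) (by linarith [n.cast_nonneg (α := ℝ)])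
      simp only [div_eq_mul_inv] at h1 h2
      rw [add_sub_cancel_left, Complex.norm_real, Real.norm_of_nonneg h1.le]
      linarith
    · exact Eventually.of_forall fun s =>
        ((hasDerivAt_iff_tendsto_slope.1 (hdz s z (Metric.mem_ball_self (by linarith)))).comp hseq)
  · refine Eventually.of_forall fun s w hw => ?_
    refine Complex.norm_deriv_le_of_forall_mem_sphere_norm_le (by linarith) ?_ ?_
    · refine ((hdiff s).mono ?_).diffContOnCl_ball (U := Metric.ball z r) ?_
      · exact subset_rfl
      · intro y hy
        rw [Metric.mem_closedBall] at hy
        rw [Metric.mem_ball] at hw ⊢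
        linarith [dist_triangle y w z]
    · intro y hy
      refine hbound s y ?_
      rw [mem_sphere_iff_norm, ← dist_eq_norm] at hy
      rw [Metric.mem_ball] at hw ⊢
      linarith [dist_triangle y w z]

/-! ### Cauchy integrals over the real line -/

/-- The Cauchy integral `∫ h(s) / (z - s) ds` without the factor `1 / (2πi)`. -/
noncomputable def cauchyIntegral (h : ℝ → ℂ) (z : ℂ) : ℂ := ∫ s : ℝ, h s / (z - (s : ℂ))

/-- Densities whose Cauchy integral converges absolutely off the real line. -/
structure CauchyAdmissible (h : ℝ → ℂ) : Prop where
  measurable : Measurable h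
  integrable : Integrable fun s => ‖h s‖ / (1 + |s|)

lemma one_add_abs_le_mul_norm {δ : ℝ} (hδ : 0 < δ) {z : ℂ} {s : ℝ} (h : δ ≤ ‖z - s‖) :
    1 + |s| ≤ ((1 + ‖z‖) / δ + 1) * ‖z - s‖ := by
  have h1 : |s| ≤ ‖z‖ + ‖z - s‖ := by
    have := norm_sub_le z (z - s)
    simpa [Complex.norm_real] using this
  have h2 : 1 + ‖z‖ ≤ (1 + ‖z‖) / δ * ‖z - s‖ := by
    rw [div_mul_eq_mul_div, le_div_iff₀ hδ]
    gcongr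
  linarith

lemma abs_im_le_norm_sub_ofReal (z : ℂ) (s : ℝ) : |z.im| ≤ ‖z - s‖ := by
  simpa using Complex.abs_im_le_norm (z - s)

lemma abs_re_sub_le_norm_sub_ofReal (z : ℂ) (s : ℝ) : |s - z.re| ≤ ‖z - s‖ := by
  rw [abs_sub_comm]
  simpa using Complex.abs_re_le_norm (z - s)

namespace CauchyAdmissible

variable {h : ℝ → ℂ}

lemma indicator (hh : CauchyAdmissible h) {T : Set ℝ} (hT : MeasurableSet T) :
    CauchyAdmissible (T.indicator h) := by
  refine ⟨hh.measurable.indicator hT, hh.integrable.mono' ?_ (Eventually.of_forall fun s => ?_)⟩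
  · exact ((hh.measurable.indicator hT).norm.div (by fun_prop)).aestronglyMeasurable
  · have h0 : 0 ≤ 1 + |s| := by positivity
    rw [Real.norm_of_nonneg (by positivity)]
    gcongr
    exact norm_indicator_le_norm_self h s

lemma mul_bounded (hh : CauchyAdmissible h) {f : ℝ → ℂ} (hf : Measurable f) {C : ℝ}
    (hC : ∀ s, ‖f s‖ ≤ C) : CauchyAdmissible fun s => h s * f s := by
  refine ⟨hh.measurable.mul hf, (hh.integrable.mul_const C).mono' ?_
    (Eventually.of_forall fun s => ?_)⟩
  · exact ((hh.measurable.mul hf).norm.div (by fun_prop)).aestronglyMeasurable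
  · have h0 : 0 ≤ 1 + |s| := by positivity
    rw [Real.norm_of_nonneg (by positivity), norm_mul, div_mul_eq_mul_div]
    gcongr
    exact hC s

lemma measurable_div (hh : CauchyAdmissible h) (z : ℂ) : Measurable fun s : ℝ => h s / (z - s) :=
  hh.measurable.div (by fun_prop)

lemma norm_div_le {z : ℂ} {δ : ℝ} (hδ : 0 < δ) {s : ℝ} (hs : h s ≠ 0 → δ ≤ ‖z - s‖) :
    ‖h s / (z - s)‖ ≤ ((1 + ‖z‖) / δ + 1) * (‖h s‖ / (1 + |s|)) := by
  by_cases h0 : h s = 0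
  · simp [h0]
  have h1 := hs h0
  have h2 := one_add_abs_le_mul_norm hδ h1
  have h3 : 0 < 1 + |s| := by positivity
  rw [norm_div, mul_div_assoc', div_le_div_iff₀ (hδ.trans_le h1) h3]
  calc ‖h s‖ * (1 + |s|) ≤ ‖h s‖ * (((1 + ‖z‖) / δ + 1) * ‖z - s‖) := by gcongr
    _ = _ := by ring

lemma integrable_div (hh : CauchyAdmissible h) {z : ℂ} {δ : ℝ} (hδ : 0 < δ)
    (hs : ∀ s, h s ≠ 0 → δ ≤ ‖z - s‖) : Integrable fun s : ℝ => h s / (z - s) :=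
  (hh.integrable.const_mul _).mono' (hh.measurable_div z).aestronglyMeasurable
    (Eventually.of_forall fun s => norm_div_le hδ (hs s))

lemma integrable_div_of_im_ne_zero (hh : CauchyAdmissible h) {z : ℂ} (hz : z.im ≠ 0) :
    Integrable fun s : ℝ => h s / (z - s) :=
  hh.integrable_div (abs_pos.2 hz) fun s _ => abs_im_le_norm_sub_ofReal z s

lemma differentiableAt_cauchyIntegral (hh : CauchyAdmissible h) {z : ℂ} {δ : ℝ} (hδ : 0 < δ)
    (hs : ∀ s, h s ≠ 0 → δ ≤ ‖z - s‖) : DifferentiableAt ℂ (cauchyIntegral h) z := by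
  have hfar : ∀ w ∈ Metric.ball z (δ / 2), ∀ s, h s ≠ 0 → δ / 2 ≤ ‖w - s‖ := by
    intro w hw s h0
    have h1 := hs s h0
    have h2 := norm_sub_le_norm_sub_add_norm_sub z w s
    rw [Metric.mem_ball, dist_comm, dist_eq_norm] at hw
    linarith
  refine differentiableAt_integral_of_dominated (r := δ / 2) (by linarith)
    (b := fun s => ((1 + (‖z‖ + δ / 2)) / (δ / 2) + 1) * (‖h s‖ / (1 + |s|))) ?_ ?_
    (hh.integrable.const_mul _) ?_
  · exact fun w _ => (hh.measurable_div w).aestronglyMeasurable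
  · intro s w hw
    by_cases h0 : h s = 0
    · simpa [h0] using differentiableWithinAt_const (0 : ℂ)
    · have h1 : w - s ≠ 0 :=
        norm_pos_iff.1 ((by linarith : (0:ℝ) < δ / 2).trans_le (hfar w hw s h0))
      fun_prop (disch := exact h1)
  · intro s w hw
    refine (norm_div_le (by linarith) (hfar w hw s)).trans ?_
    have h1 : ‖w‖ ≤ ‖z‖ + δ / 2 := by
      rw [Metric.mem_ball, dist_eq_norm] at hw
      have := norm_le_norm_add_norm_sub' w z
      linarith
    gcongr

lemma differentiableOn_cauchyIntegral (hh : CauchyAdmissible h) :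
    DifferentiableOn ℂ (cauchyIntegral h) {z : ℂ | z.im ≠ 0} := fun z hz =>
  (hh.differentiableAt_cauchyIntegral (abs_pos.2 hz)
    fun s _ => abs_im_le_norm_sub_ofReal z s).differentiableWithinAt

/-- Splitting a Cauchy integral into the parts over an interval and over its complement. -/
lemma cauchyIntegral_eq_add (hh : CauchyAdmissible h) {z : ℂ} (hz : z.im ≠ 0) {p q : ℝ}
    (hpq : p ≤ q) :
    cauchyIntegral h z = cauchyIntegral ((Set.Ioc p q)ᶜ.indicator h) z
      + ∫ s in p..q, h s / (z - s) := by
  rw [intervalIntegral.integral_of_le hpq, cauchyIntegral, cauchyIntegral,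
    ← integral_add_compl measurableSet_Ioc (hh.integrable_div_of_im_ne_zero hz), add_comm,
    ← integral_indicator measurableSet_Ioc.compl]
  congr 1
  refine integral_congr_ae (Eventually.of_forall fun s => ?_)
  by_cases hs : s ∈ (Set.Ioc p q)ᶜ
  · simp only [Set.indicator_of_mem hs]
  · simp only [Set.indicator_of_notMem hs, zero_div]

end CauchyAdmissible

lemma integral_one_div_sub {z : ℂ} (hz : z.im ≠ 0) (p q : ℝ) :
    ∫ s : ℝ in p..q, 1 / (z - s) = Complex.log (p - z) - Complex.log (q - z) := by
  have hne : ∀ s : ℝ, (s : ℂ) - z ≠ 0 := fun s h => hz (by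
    have := congrArg Complex.im h
    simpa using this)
  have hd : ∀ s ∈ Set.uIcc p q, HasDerivAt (fun s : ℝ => -Complex.log (s - z))
      (1 / (z - s)) s := by
    intro s _
    have h1 : HasDerivAt (fun s : ℝ => (s : ℂ) - z) 1 s :=
      (Complex.ofRealCLM.hasDerivAt (x := s)).sub_const z
    have h2 := (h1.clog_real (Or.inr (by simpa using hz))).neg
    have h3 : -(1 / ((s : ℂ) - z)) = 1 / (z - s) := by
      rw [← neg_sub z, one_div, one_div, inv_neg, neg_neg]
    rw [← h3]
    exact h2
  rw [intervalIntegral.integral_eq_sub_of_hasDerivAt hd]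
  · ring
  · refine ContinuousOn.intervalIntegrable ?_
    refine continuousOn_const.div (by fun_prop) fun s _ => ?_
    rw [← neg_sub]
    exact neg_ne_zero.2 (hne s)

/-- Over an interval centred at the real part of `z` the real part of the kernel cancels. -/
lemma norm_integral_one_div_sub_le {z : ℂ} (hz : z.im ≠ 0) (ρ : ℝ) :
    ‖∫ s : ℝ in (z.re - ρ)..(z.re + ρ), 1 / (z - s)‖ ≤ 2 * Real.pi := by
  rw [integral_one_div_sub hz]
  set u : ℂ := ((z.re - ρ : ℝ) : ℂ) - z with hu
  set v : ℂ := ((z.re + ρ : ℝ) : ℂ) - z with hv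
  have huv : ‖u‖ = ‖v‖ := by
    rw [Complex.norm_def, Complex.norm_def, Complex.normSq_apply, Complex.normSq_apply]
    congr 1
    simp [hu, hv]
  have h1 : Complex.log u - Complex.log v = ((u.arg - v.arg : ℝ) : ℂ) * Complex.I := by
    rw [Complex.log, Complex.log, huv]
    push_cast
    ring
  rw [h1, norm_mul, Complex.norm_I, mul_one, Complex.norm_real, Real.norm_eq_abs]
  have h2 := Complex.abs_arg_le_pi u
  have h3 := Complex.abs_arg_le_pi v
  have := abs_sub u.arg v.arg
  linarith

/-- The part of a Cauchy integral over an interval centred at the real part `c` of `z` is bounded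
through the Lipschitz constant of the density at `c`, uniformly in the distance to the line. -/
lemma norm_integral_near_le {h : ℝ → ℂ} (hh : CauchyAdmissible h) {z : ℂ} (hz : z.im ≠ 0)
    {ρ L : ℝ} (hρ : 0 ≤ ρ)
    (hL : ∀ s ∈ Set.Icc (z.re - ρ) (z.re + ρ), ‖h s - h z.re‖ ≤ L * |s - z.re|) :
    ‖∫ s in (z.re - ρ)..(z.re + ρ), h s / (z - s)‖ ≤ 2 * ρ * L + 2 * Real.pi * ‖h z.re‖ := by
  have hle : z.re - ρ ≤ z.re + ρ := by linarith
  have hne : ∀ s : ℝ, 0 < ‖z - s‖ := fun s =>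
    (abs_pos.2 hz).trans_le (abs_im_le_norm_sub_ofReal z s)
  have hi1 : IntervalIntegrable (fun s : ℝ => h s / (z - s)) volume (z.re - ρ) (z.re + ρ) :=
    (hh.integrable_div_of_im_ne_zero hz).intervalIntegrable
  have hi2 : IntervalIntegrable (fun s : ℝ => h z.re * (1 / (z - s))) volume
      (z.re - ρ) (z.re + ρ) := by
    refine ContinuousOn.intervalIntegrable ?_
    refine continuousOn_const.mul (continuousOn_const.div (by fun_prop) fun s _ => ?_)
    exact norm_pos_iff.1 (hne s)
  have hsplit : ∫ s in (z.re - ρ)..(z.re + ρ), h s / (z - s)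
      = (∫ s in (z.re - ρ)..(z.re + ρ), (h s / (z - s) - h z.re * (1 / (z - s))))
        + h z.re * ∫ s : ℝ in (z.re - ρ)..(z.re + ρ), 1 / (z - s) := by
    rw [intervalIntegral.integral_sub hi1 hi2, intervalIntegral.integral_const_mul]
    ring
  rw [hsplit]
  refine (norm_add_le _ _).trans (add_le_add ?_ ?_)
  · have := intervalIntegral.norm_integral_le_of_norm_le_const (a := z.re - ρ) (b := z.re + ρ)
      (f := fun s : ℝ => h s / (z - s) - h z.re * (1 / (z - s))) (C := L) (fun s hs => by
        rw [Set.uIoc_of_le hle] at hs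
        rw [mul_one_div, ← sub_div, norm_div, div_le_iff₀ (hne s)]
        have h1 := hL s (Set.Ioc_subset_Icc_self hs)
        have h2 := abs_re_sub_le_norm_sub_ofReal z s
        rcases le_or_gt 0 L with h0 | h0
        · exact h1.trans (by gcongr)
        · have h3 := norm_nonneg (h s - h z.re)
          have h4 : |s - z.re| = 0 := by
            by_contra h5
            have h6 : 0 < |s - z.re| := lt_of_le_of_ne (abs_nonneg _) (Ne.symm h5)
            nlinarith
          have h7 : s = z.re := by linarith [abs_eq_zero.1 h4]
          have h8 : 0 ≤ L * |(z.re + ρ) - z.re| :=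
            (norm_nonneg _).trans (hL _ ⟨by linarith, le_rfl⟩)
          have h9 : ρ = 0 := by
            by_contra h10
            have : 0 < |(z.re + ρ) - z.re| := by simpa using h10
            nlinarith
          rw [h9] at hs
          have := hs.1
          rw [h7] at this
          linarith)
    rw [show |z.re + ρ - (z.re - ρ)| = 2 * ρ by
      rw [show z.re + ρ - (z.re - ρ) = 2 * ρ by ring, abs_of_nonneg (by linarith)]] at this
    linarith
  · rw [norm_mul, mul_comm]
    gcongr
    exact norm_integral_one_div_sub_le hz ρ

/-- Plemelj's formula: the boundary values of the Cauchy integral from both sides exist where the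
density is Lipschitz, and differ by `2πi` times the density. -/
lemma exists_tendsto_cauchyIntegral {h : ℝ → ℂ} (hh : CauchyAdmissible h) {t r L : ℝ} (hr : 0 < r)
    (hL : ∀ s ∈ Set.Icc (t - r) (t + r), ∀ s' ∈ Set.Icc (t - r) (t + r),
      ‖h s - h s'‖ ≤ L * |s - s'|) :
    ∃ l : ℂ, Tendsto (cauchyIntegral h) (𝓝[{z : ℂ | 0 < z.im}] (t : ℂ))
        (𝓝 (l - Real.pi * Complex.I * h t)) ∧
      Tendsto (cauchyIntegral h) (𝓝[{z : ℂ | z.im < 0}] (t : ℂ))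
        (𝓝 (l + Real.pi * Complex.I * h t)) := by
  have hL0 : 0 ≤ L := by
    have := (norm_nonneg _).trans (hL (t + r) ⟨by linarith, le_rfl⟩ t ⟨by linarith, by linarith⟩)
    rw [add_sub_cancel_left, abs_of_pos hr] at this
    nlinarith
  have hle : t - r ≤ t + r := by linarith
  set far : ℂ → ℂ := cauchyIntegral ((Set.Ioc (t - r) (t + r))ᶜ.indicator h) with hfar
  set reg : ℂ → ℂ := fun z => ∫ s in (t - r)..(t + r), (h s - h z.re) / (z - s) with hreg
  have hcont : ContinuousAt h t := by
    refine continuousAt_of_locally_lipschitz hr L fun s hs => ?_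
    rw [dist_eq_norm, Real.dist_eq]
    rw [Real.dist_eq, abs_lt] at hs
    exact hL s ⟨by linarith, by linarith⟩ t ⟨by linarith, by linarith⟩
  have hfart : Tendsto far (𝓝 (t : ℂ)) (𝓝 (far t)) := by
    refine DifferentiableAt.continuousAt
      ((hh.indicator measurableSet_Ioc.compl).differentiableAt_cauchyIntegral hr ?_)
    intro s hs
    have h1 : s ∉ Set.Ioc (t - r) (t + r) := by
      by_contra h2
      exact hs (Set.indicator_of_notMem (by simpa using h2) _)
    rw [← Complex.ofReal_sub, Complex.norm_real, Real.norm_eq_abs]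
    by_contra h3
    rw [not_le, abs_lt] at h3
    exact h1 ⟨by linarith, by linarith⟩
  have hre : Tendsto (fun z : ℂ => h z.re) (𝓝 (t : ℂ)) (𝓝 (h t)) := by
    have h1 : Tendsto Complex.re (𝓝 (t : ℂ)) (𝓝 t) := by
      simpa using Complex.continuous_re.tendsto (t : ℂ)
    exact hcont.tendsto.comp h1
  -- Near `t` the difference quotients are bounded by the Lipschitz constant.
  have hregt : Tendsto reg (𝓝 (t : ℂ)) (𝓝 (reg t)) := by
    refine intervalIntegral.tendsto_integral_filter_of_dominated_convergence (fun _ => L) ?_ ?_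
      intervalIntegrable_const ?_
    · refine Eventually.of_forall fun z => Measurable.aestronglyMeasurable ?_
      exact (hh.measurable.sub_const _).div (by fun_prop)
    · filter_upwards [Metric.ball_mem_nhds (t : ℂ) hr] with z hz
      refine Eventually.of_forall fun s hs => ?_
      rw [Set.uIoc_of_le hle] at hs
      have hz1 : |z.re - t| < r := by
        rw [Metric.mem_ball, dist_eq_norm] at hz
        exact (by simpa using Complex.abs_re_le_norm (z - t) : |z.re - t| ≤ ‖z - t‖).trans_lt hz
      rw [abs_lt] at hz1
      have h1 := hL s (Set.Ioc_subset_Icc_self hs) z.re ⟨by linarith, by linarith⟩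
      have h2 := abs_re_sub_le_norm_sub_ofReal z s
      rw [norm_div]
      refine div_le_of_le_mul₀ (norm_nonneg _) hL0 (h1.trans ?_)
      gcongr
    · have hae : ∀ᵐ s : ℝ, s ≠ t := by simp [ae_iff]
      filter_upwards [hae] with s hs _
      have h1 : (t : ℂ) - s ≠ 0 := sub_ne_zero.2 (by exact_mod_cast hs.symm)
      have h2 : Tendsto (fun z : ℂ => z - (s : ℂ)) (𝓝 (t : ℂ)) (𝓝 ((t : ℂ) - s)) :=
        (continuous_id.sub continuous_const).tendsto _
      have h3 := Tendsto.div (hre.const_sub (h s)) h2 h1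
      simp only [Complex.ofReal_re]
      exact h3
  have hsplit : ∀ z : ℂ, z.im ≠ 0 → cauchyIntegral h z = far z + (reg z + h z.re *
      (Complex.log ((t - r : ℝ) - z) - Complex.log ((t + r : ℝ) - z))) := by
    intro z hz
    have hne : ∀ s : ℝ, 0 < ‖z - s‖ := fun s =>
      (abs_pos.2 hz).trans_le (abs_im_le_norm_sub_ofReal z s)
    rw [hh.cauchyIntegral_eq_add hz hle, ← integral_one_div_sub hz,
      ← intervalIntegral.integral_const_mul]
    congr 1
    have hi1 : IntervalIntegrable (fun s : ℝ => h s / (z - s)) volume (t - r) (t + r) :=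
      (hh.integrable_div_of_im_ne_zero hz).intervalIntegrable
    have hi2 : IntervalIntegrable (fun s : ℝ => h z.re * (1 / (z - s))) volume
        (t - r) (t + r) := by
      refine ContinuousOn.intervalIntegrable ?_
      refine continuousOn_const.mul (continuousOn_const.div (by fun_prop) fun s _ => ?_)
      exact norm_pos_iff.1 (hne s)
    have : reg z = ∫ s in (t - r)..(t + r), (h s / (z - s) - h z.re * (1 / (z - s))) := by
      simp only [hreg]
      congr 1 with s
      ring
    rw [this, intervalIntegral.integral_sub hi1 hi2]
    ring
  have hlogp : Tendsto (fun z : ℂ => Complex.log ((t + r : ℝ) - z)) (𝓝 (t : ℂ))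
      (𝓝 (Real.log r)) := by
    have h1 : Tendsto (fun z : ℂ => ((t + r : ℝ) : ℂ) - z) (𝓝 (t : ℂ)) (𝓝 (r : ℂ)) := by
      have := (continuous_const.sub continuous_id).tendsto (t : ℂ)
        (f := fun z : ℂ => ((t + r : ℝ) : ℂ) - z)
      simpa using this
    have h2 := h1.clog (Or.inl (by simpa using hr))
    rwa [← Complex.ofReal_log hr.le] at h2
  have hm1 : Tendsto (fun z : ℂ => ((t - r : ℝ) : ℂ) - z) (𝓝 (t : ℂ)) (𝓝 (-r : ℂ)) := by
    have := (continuous_const.sub continuous_id).tendsto (t : ℂ)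
      (f := fun z : ℂ => ((t - r : ℝ) : ℂ) - z)
    simpa using this
  have hup : Tendsto (fun z : ℂ => Complex.log ((t - r : ℝ) - z)) (𝓝[{z : ℂ | 0 < z.im}] (t : ℂ))
      (𝓝 (Real.log r - Real.pi * Complex.I)) := by
    have h1 := Complex.tendsto_log_nhdsWithin_im_neg_of_re_neg_of_im_zero (z := (-r : ℂ))
      (by simpa using hr) (by simp)
    rw [norm_neg, Complex.norm_real, Real.norm_of_nonneg hr.le] at h1
    refine h1.comp (tendsto_nhdsWithin_iff.2 ⟨hm1.mono_left nhdsWithin_le_nhds, ?_⟩)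
    filter_upwards [self_mem_nhdsWithin] with z hz
    simpa using hz
  have hdown : Tendsto (fun z : ℂ => Complex.log ((t - r : ℝ) - z)) (𝓝[{z : ℂ | z.im < 0}] (t : ℂ))
      (𝓝 (Real.log r + Real.pi * Complex.I)) := by
    have h1 := Complex.tendsto_log_nhdsWithin_im_nonneg_of_re_neg_of_im_zero (z := (-r : ℂ))
      (by simpa using hr) (by simp)
    rw [norm_neg, Complex.norm_real, Real.norm_of_nonneg hr.le] at h1
    refine h1.comp (tendsto_nhdsWithin_iff.2 ⟨hm1.mono_left nhdsWithin_le_nhds, ?_⟩)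
    filter_upwards [self_mem_nhdsWithin] with z hz
    have : z.im < 0 := hz
    simpa using this.le
  refine ⟨far t + reg t, ?_, ?_⟩
  · have h1 := (hfart.mono_left nhdsWithin_le_nhds).add ((hregt.mono_left nhdsWithin_le_nhds).add
      ((hre.mono_left nhdsWithin_le_nhds).mul (hup.sub (hlogp.mono_left nhdsWithin_le_nhds))))
    have h2 : far t + (reg t + h t * (Real.log r - Real.pi * Complex.I - Real.log r))
        = far t + reg t - Real.pi * Complex.I * h t := by ring
    rw [h2] at h1
    refine h1.congr' ?_
    filter_upwards [self_mem_nhdsWithin] with z hz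
    exact (hsplit z (ne_of_gt hz)).symm
  · have h1 := (hfart.mono_left nhdsWithin_le_nhds).add ((hregt.mono_left nhdsWithin_le_nhds).add
      ((hre.mono_left nhdsWithin_le_nhds).mul (hdown.sub (hlogp.mono_left nhdsWithin_le_nhds))))
    have h2 : far t + (reg t + h t * (Real.log r + Real.pi * Complex.I - Real.log r))
        = far t + reg t + Real.pi * Complex.I * h t := by ring
    rw [h2] at h1
    refine h1.congr' ?_
    filter_upwards [self_mem_nhdsWithin] with z hz
    exact (hsplit z (ne_of_lt hz)).symm

/-- Densities that are locally integrable, square integrable near infinity, and that tend to `0` at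
infinity together with their local Lipschitz constants. Their Cauchy integrals tend to `0` at
infinity, uniformly up to the real line. -/
structure VanishingDensity (h : ℝ → ℂ) : Prop where
  measurable : Measurable h
  integrableOn : ∀ R : ℝ, IntegrableOn h (Set.Icc (-R) R)
  sq_integrableOn : ∃ R : ℝ, IntegrableOn (fun s => ‖h s‖ ^ 2) {s : ℝ | R < |s|}
  small : ∀ ε > 0, ∃ R : ℝ, ∀ c : ℝ, R < |c| →
    ‖h c‖ ≤ ε ∧ ∀ s ∈ Set.Icc (c - 1) (c + 1), ‖h s - h c‖ ≤ ε * |s - c|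

namespace VanishingDensity

variable {h : ℝ → ℂ}

lemma measurableSet_lt_abs (R : ℝ) : MeasurableSet {s : ℝ | R < |s|} :=
  measurableSet_lt measurable_const (by fun_prop)

lemma cauchyAdmissible (hh : VanishingDensity h) : CauchyAdmissible h := by
  refine ⟨hh.measurable, ?_⟩
  obtain ⟨R, hR⟩ := hh.sq_integrableOn
  have hm : AEStronglyMeasurable (fun s => ‖h s‖ / (1 + |s|)) volume :=
    (hh.measurable.norm.div (by fun_prop)).aestronglyMeasurable
  have h1 : IntegrableOn (fun s => ‖h s‖ / (1 + |s|)) (Set.Icc (-R) R) := by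
    refine (hh.integrableOn R).norm.mono' hm.restrict (Eventually.of_forall fun s => ?_)
    rw [Real.norm_of_nonneg (by positivity)]
    exact div_le_self (norm_nonneg _) (by linarith [abs_nonneg s])
  have h2 : IntegrableOn (fun s => ‖h s‖ / (1 + |s|)) {s : ℝ | R < |s|} := by
    refine (hR.add (integrable_inv_one_add_sq.integrableOn)).mono' hm.restrict
      (Eventually.of_forall fun s => ?_)
    rw [Real.norm_of_nonneg (by positivity)]
    have e1 : (1 + |s|)⁻¹ ^ 2 ≤ (1 + s ^ 2)⁻¹ := by
      rw [inv_pow]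
      gcongr
      nlinarith [abs_nonneg s, sq_abs s]
    have e2 := two_mul_le_add_sq (‖h s‖) ((1 + |s|)⁻¹)
    have e3 : 0 ≤ ‖h s‖ * (1 + |s|)⁻¹ := by positivity
    rw [div_eq_mul_inv]
    simp only [Pi.add_apply]
    nlinarith
  refine (h1.union h2).mono_set (fun s _ => ?_) |>.integrable_of_forall_notMem_eq_zero
    (s := Set.univ) (by simp)
  by_cases hs : R < |s|
  · exact Or.inr hs
  · exact Or.inl (abs_le.1 (not_lt.1 hs))

/-- Multiplication by a bounded Lipschitz function. -/
lemma mul (hh : VanishingDensity h) {f : ℝ → ℂ} {C : ℝ} (hC : ∀ s, ‖f s‖ ≤ C)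
    (hL : ∀ s t, ‖f s - f t‖ ≤ C * |s - t|) : VanishingDensity fun s => h s * f s := by
  have hC0 : 0 ≤ C := (norm_nonneg _).trans (hC 0)
  have hf : Measurable f := by
    have : LipschitzWith C.toNNReal f := LipschitzWith.of_dist_le_mul fun s t => by
      rw [dist_eq_norm, Real.dist_eq, Real.coe_toNNReal C hC0]
      exact hL s t
    exact this.continuous.measurable
  refine ⟨hh.measurable.mul hf, fun R => ?_, ?_, fun ε hε => ?_⟩
  · exact (hh.integrableOn R).mul_bdd (c := C) hf.aestronglyMeasurable (Eventually.of_forall hC)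
  · obtain ⟨R, hR⟩ := hh.sq_integrableOn
    refine ⟨R, (hR.mul_const (C ^ 2)).mono' ?_ (Eventually.of_forall fun s => ?_)⟩
    · exact ((hh.measurable.mul hf).norm.pow_const 2).aestronglyMeasurable
    · rw [Real.norm_of_nonneg (by positivity), norm_mul, mul_pow]
      gcongr
      exact hC s
  · obtain ⟨R, hR⟩ := hh.small (ε / (2 * C + 1)) (by positivity)
    refine ⟨R + 1, fun c hc => ?_⟩
    have hcR := hR c (by linarith)
    have hle : ε / (2 * C + 1) * (2 * C) ≤ ε := by
      rw [div_mul_eq_mul_div, div_le_iff₀ (by positivity)]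
      nlinarith
    have hpos : 0 ≤ ε / (2 * C + 1) := by positivity
    constructor
    · rw [norm_mul]
      calc ‖h c‖ * ‖f c‖ ≤ ε / (2 * C + 1) * C := by
            gcongr
            exacts [hcR.1, hC c]
        _ ≤ ε / (2 * C + 1) * (2 * C) := by gcongr; linarith
        _ ≤ ε := hle
    · intro s hs
      have e1 : h s * f s - h c * f c = (h s - h c) * f s + h c * (f s - f c) := by ring
      rw [e1]
      refine (norm_add_le _ _).trans ?_
      rw [norm_mul, norm_mul]
      calc ‖h s - h c‖ * ‖f s‖ + ‖h c‖ * ‖f s - f c‖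
          ≤ (ε / (2 * C + 1) * |s - c|) * C + ε / (2 * C + 1) * (C * |s - c|) := by
            gcongr
            exacts [hcR.2 s hs, hC s, hcR.1, hL s c]
        _ = ε / (2 * C + 1) * (2 * C) * |s - c| := by ring
        _ ≤ ε * |s - c| := by gcongr

lemma exists_sq_tail_le (hh : VanishingDensity h) {ε : ℝ} (hε : 0 < ε) :
    ∃ S : ℝ, IntegrableOn (fun s => ‖h s‖ ^ 2) {s : ℝ | S < |s|} ∧
      ∫ s in {s : ℝ | S < |s|}, ‖h s‖ ^ 2 ≤ ε := by
  obtain ⟨R, hR⟩ := hh.sq_integrableOn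
  have hlim := tendsto_setIntegral_of_antitone (μ := volume) (f := fun s => ‖h s‖ ^ 2)
    (s := fun n : ℕ => {s : ℝ | R + n < |s|}) (fun n => measurableSet_lt_abs _)
    (fun m n hmn s hs => by
      have h1 : R + n < |s| := hs
      have h2 : (m : ℝ) ≤ n := by exact_mod_cast hmn
      exact (by linarith : R + m < |s|)) ⟨0, by simpa using hR⟩
  have hempty : ⋂ n : ℕ, {s : ℝ | R + n < |s|} = ∅ := by
    ext s
    simp only [Set.mem_iInter, Set.mem_ofPred_eq, Set.mem_empty_iff_false, iff_false, not_forall,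
      not_lt]
    obtain ⟨n, hn⟩ := exists_nat_ge (|s| - R)
    exact ⟨n, by linarith⟩
  rw [hempty, setIntegral_empty] at hlim
  obtain ⟨n, hn⟩ := ((tendsto_order.1 hlim).2 ε hε).exists
  refine ⟨R + n, hR.mono_set fun s hs => ?_, hn.le⟩
  have h1 : R + n < |s| := hs
  exact (by linarith [n.cast_nonneg (α := ℝ)] : R < |s|)

/-- The part of the Cauchy integral at distance at least `1` from the real part of `z`, by splitting
the density at `|s| = S` and the inequality `2ab ≤ a² / δ + δ b²`. -/
lemma norm_far_le (hh : VanishingDensity h) {S δ : ℝ} (hδ : 0 < δ)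
    (hS : IntegrableOn (fun s => ‖h s‖ ^ 2) {s : ℝ | S < |s|})
    {z : ℂ} (hz : S < ‖z‖) :
    ‖cauchyIntegral ((Set.Ioc (z.re - 1) (z.re + 1))ᶜ.indicator h) z‖ ≤
      (∫ s in Set.Icc (-S) S, ‖h s‖) / (‖z‖ - S) + (∫ s in {s : ℝ | S < |s|}, ‖h s‖ ^ 2) / (2 * δ)
        + δ * Real.pi := by
  have hzS : 0 < ‖z‖ - S := by linarith
  have i1 : Integrable (fun s => (Set.Icc (-S) S).indicator (fun s => ‖h s‖) s / (‖z‖ - S)) :=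
    (IntegrableOn.integrable_indicator (hh.integrableOn S).norm measurableSet_Icc).div_const _
  have i2 : Integrable (fun s => ({s : ℝ | S < |s|}).indicator (fun s => ‖h s‖ ^ 2) s / (2 * δ)) :=
    (hS.integrable_indicator (measurableSet_lt_abs S)).div_const _
  have i3 : Integrable (fun s : ℝ => δ * (1 + (s - z.re) ^ 2)⁻¹) :=
    (integrable_inv_one_add_sq.comp_sub_right z.re).const_mul δ
  have i12 : Integrable (fun s => (Set.Icc (-S) S).indicator (fun s => ‖h s‖) s / (‖z‖ - S)
      + ({s : ℝ | S < |s|}).indicator (fun s => ‖h s‖ ^ 2) s / (2 * δ)) := i1.add i2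
  have hval : ∫ s, ((Set.Icc (-S) S).indicator (fun s => ‖h s‖) s / (‖z‖ - S)
      + ({s : ℝ | S < |s|}).indicator (fun s => ‖h s‖ ^ 2) s / (2 * δ)
      + δ * (1 + (s - z.re) ^ 2)⁻¹) = (∫ s in Set.Icc (-S) S, ‖h s‖) / (‖z‖ - S)
      + (∫ s in {s : ℝ | S < |s|}, ‖h s‖ ^ 2) / (2 * δ) + δ * Real.pi := by
    rw [integral_add i12 i3, integral_add i1 i2, integral_div, integral_div,
      integral_const_mul, integral_indicator measurableSet_Icc,
      integral_indicator (measurableSet_lt_abs S),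
      integral_sub_right_eq_self (fun s : ℝ => (1 + s ^ 2)⁻¹) z.re, integral_univ_inv_one_add_sq]
  rw [← hval]
  refine norm_integral_le_of_norm_le (i12.add i3) (Eventually.of_forall fun s => ?_)
  have n1 : 0 ≤ (Set.Icc (-S) S).indicator (fun s => ‖h s‖) s / (‖z‖ - S) :=
    div_nonneg (Set.indicator_nonneg (fun _ _ => norm_nonneg _) _) hzS.le
  have n2 : 0 ≤ ({s : ℝ | S < |s|}).indicator (fun s => ‖h s‖ ^ 2) s / (2 * δ) :=
    div_nonneg (Set.indicator_nonneg (fun _ _ => by positivity) _) (by positivity)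
  have n3 : 0 ≤ δ * (1 + (s - z.re) ^ 2)⁻¹ := by positivity
  by_cases hs : s ∈ Set.Ioc (z.re - 1) (z.re + 1)
  · rw [Set.indicator_of_notMem (by simpa using hs)]
    simp only [zero_div, norm_zero]
    positivity
  rw [Set.indicator_of_mem (by simpa using hs), norm_div]
  by_cases hsS : S < |s|
  · have hs1 : 1 ≤ |s - z.re| := by
      by_contra h1
      rw [not_le, abs_lt] at h1
      exact hs ⟨by linarith, by linarith⟩
    have hs2 := abs_re_sub_le_norm_sub_ofReal z s
    have hs0 : 0 < |s - z.re| := by linarith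
    have e1 : ‖h s‖ / ‖z - s‖ ≤ ‖h s‖ * |s - z.re|⁻¹ := by
      rw [div_eq_mul_inv]
      gcongr
    have e2 : ‖h s‖ * |s - z.re|⁻¹ ≤ ‖h s‖ ^ 2 / (2 * δ) + δ / 2 * (|s - z.re|⁻¹) ^ 2 := by
      have := sq_nonneg (‖h s‖ - δ * |s - z.re|⁻¹)
      rw [div_add' _ _ _ (by positivity), le_div_iff₀ (by positivity)]
      nlinarith
    have e3 : (|s - z.re|⁻¹) ^ 2 ≤ 2 * (1 + (s - z.re) ^ 2)⁻¹ := by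
      rw [inv_pow, sq_abs, ← div_eq_mul_inv, ← one_div,
        div_le_div_iff₀ (by nlinarith [sq_abs (s - z.re)]) (by positivity)]
      nlinarith [sq_abs (s - z.re)]
    have e4 : ({s : ℝ | S < |s|}).indicator (fun s => ‖h s‖ ^ 2) s = ‖h s‖ ^ 2 :=
      Set.indicator_of_mem (s := {s : ℝ | S < |s|}) hsS _
    rw [e4] at n2 ⊢
    nlinarith
  · have hs' : s ∈ Set.Icc (-S) S := abs_le.1 (not_lt.1 hsS)
    rw [Set.indicator_of_mem hs'] at n1 ⊢
    have e1 : ‖z‖ - S ≤ ‖z - s‖ := by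
      have h1 := norm_sub_norm_le z s
      rw [Complex.norm_real, Real.norm_eq_abs] at h1
      linarith
    have e2 : ‖h s‖ / ‖z - s‖ ≤ ‖h s‖ / (‖z‖ - S) := by gcongr
    linarith

/-- The smallness of the tail in `L²` controls the part of the integral far from `re z`; the local
Lipschitz constants control the near part when `re z` is large, and otherwise `im z` is large. -/
lemma tendsto_cauchyIntegral (hh : VanishingDensity h) :
    Tendsto (cauchyIntegral h) (Bornology.cobounded ℂ ⊓ 𝓟 {z : ℂ | z.im ≠ 0}) (𝓝 0) := by
  have hadm := hh.cauchyAdmissible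
  rw [Metric.tendsto_nhds]
  intro ε hε
  set δ : ℝ := ε / 40 with hδ
  have hδ0 : 0 < δ := by positivity
  obtain ⟨S, hS1, hS2⟩ := hh.exists_sq_tail_le (ε := δ ^ 2) (by positivity)
  obtain ⟨R, hR⟩ := hh.small δ hδ0
  set m₁ : ℝ := ∫ s in Set.Icc (-S) S, ‖h s‖ with hm₁
  set m₂ : ℝ := ∫ s in Set.Icc (-(R + 1)) (R + 1), ‖h s‖ with hm₂
  have hlim : ∀ m T : ℝ, ∀ᶠ z in Bornology.cobounded ℂ, T < ‖z‖ ∧ m / (‖z‖ - T) < δ := by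
    intro m T
    have h1 : Tendsto (fun z : ℂ => ‖z‖ - T) (Bornology.cobounded ℂ) atTop :=
      tendsto_atTop_add_const_right _ _ tendsto_norm_cobounded_atTop
    have h2 := (tendsto_const_nhds (x := m)).div_atTop h1
    filter_upwards [tendsto_norm_cobounded_atTop.eventually_gt_atTop T,
      (tendsto_order.1 h2).2 δ hδ0] with z e1 e2 using ⟨e1, e2⟩
  rw [eventually_inf_principal]
  filter_upwards [hlim m₁ S, hlim m₂ R] with z h1 h2 hz
  rw [dist_zero_right, hadm.cauchyIntegral_eq_add hz (by linarith : z.re - 1 ≤ z.re + 1)]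
  have hpi := Real.pi_lt_four
  have hfar := hh.norm_far_le hδ0 hS1 h1.1
  have hfar2 : (∫ s in {s : ℝ | S < |s|}, ‖h s‖ ^ 2) / (2 * δ) ≤ δ := by
    rw [div_le_iff₀ (by positivity)]
    nlinarith
  have hnear : ‖∫ s in (z.re - 1)..(z.re + 1), h s / (z - s)‖ ≤ 10 * δ + δ := by
    by_cases hc : R < |z.re|
    · have e1 := norm_integral_near_le hadm hz zero_le_one (hR _ hc).2
      have e2 := (hR _ hc).1
      have e3 : 2 * Real.pi * ‖h z.re‖ ≤ 8 * δ := by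
        have := Real.pi_pos
        nlinarith [norm_nonneg (h z.re)]
      linarith
    · -- Here the imaginary part of `z` is large.
      have hzR : 0 < ‖z‖ - R := by linarith [h2.1]
      have him : ∀ s : ℝ, ‖z‖ - R ≤ ‖z - s‖ := fun s => by
        have e1 := abs_im_le_norm_sub_ofReal z s
        have e2 := Complex.norm_le_abs_re_add_abs_im z
        linarith
      rw [intervalIntegral.integral_of_le (by linarith)]
      have e1 : ‖∫ s in Set.Ioc (z.re - 1) (z.re + 1), h s / (z - s)‖ ≤
          ∫ s in Set.Ioc (z.re - 1) (z.re + 1), ‖h s‖ / (‖z‖ - R) := by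
        refine norm_integral_le_of_norm_le ?_ (Eventually.of_forall fun s => ?_)
        · refine (IntegrableOn.mono_set (hh.integrableOn (|z.re| + 1)).norm ?_).div_const _
          intro s hs
          exact ⟨by linarith [hs.1, neg_abs_le z.re], by linarith [hs.2, le_abs_self z.re]⟩
        · rw [norm_div]
          gcongr
          exact him s
      rw [integral_div] at e1
      have e2 : ∫ s in Set.Ioc (z.re - 1) (z.re + 1), ‖h s‖ ≤ m₂ := by
        refine setIntegral_mono_set (hh.integrableOn _).norm
          (Eventually.of_forall fun _ => norm_nonneg _) (Eventually.of_forall fun s hs => ?_)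
        have e3 := abs_le.1 (not_lt.1 hc)
        exact ⟨by linarith [hs.1], by linarith [hs.2]⟩
      have e4 : (∫ s in Set.Ioc (z.re - 1) (z.re + 1), ‖h s‖) / (‖z‖ - R) ≤ m₂ / (‖z‖ - R) := by
        gcongr
      linarith [h2.2]
  refine (norm_add_le _ _).trans_lt ?_
  have e5 : δ * Real.pi ≤ 4 * δ := by nlinarith
  linarith [h1.2]

end VanishingDensity

/-- At `a` the density is `o(1 / |s - a|)`, and its Lipschitz constants on intervals
`|s - c| ≤ |c - a| / 2` are `o(1 / |c - a|²)`, as for a power `|s - a| ^ (-α)` with `α < 1`. -/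
def MildSingularity (h : ℝ → ℂ) (a : ℝ) : Prop :=
  ∀ ε > 0, ∀ᶠ c in 𝓝[≠] a, |c - a| * ‖h c‖ ≤ ε ∧
    ∀ s ∈ Set.Icc (c - |c - a| / 2) (c + |c - a| / 2), |c - a| ^ 2 * ‖h s - h c‖ ≤ ε * |s - c|

/-- Where `|z - a| ≤ 4 |z - s|`, the minimum is `|z - a| / |z - s|`, so that this integral bounds
`|z - a|` times the far part of the Cauchy integral. -/
lemma tendsto_integral_min_mul_norm {h : ℝ → ℂ} (hh : CauchyAdmissible h) (a : ℝ) :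
    Tendsto (fun z : ℂ => ∫ s : ℝ, min 4 (‖z - a‖ / ‖z - s‖) * ‖h s‖) (𝓝 (a : ℂ)) (𝓝 0) := by
  have h0 : (0 : ℝ) = ∫ _ : ℝ, (0 : ℝ) := by simp
  rw [h0]
  refine tendsto_integral_filter_of_dominated_convergence
    (fun s => 4 * (2 + |a|) * (‖h s‖ / (1 + |s|))) ?_ ?_ (hh.integrable.const_mul _) ?_
  · refine Eventually.of_forall fun z => Measurable.aestronglyMeasurable ?_
    exact (Measurable.min measurable_const (by fun_prop)).mul hh.measurable.norm
  · filter_upwards [Metric.ball_mem_nhds (a : ℂ) (by norm_num : (0 : ℝ) < 1 / 2)] with z hz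
    refine Eventually.of_forall fun s => ?_
    rw [Metric.mem_ball, dist_eq_norm] at hz
    have hmin : 0 ≤ min 4 (‖z - a‖ / ‖z - s‖) := le_min (by norm_num) (by positivity)
    rw [norm_mul, Real.norm_of_nonneg hmin, norm_norm, mul_div_assoc', mul_div_right_comm]
    gcongr
    have hs1 : (0 : ℝ) < 1 + |s| := by positivity
    have hsa : |s| ≤ |a| + |s - a| := by
      have := abs_add_le a (s - a)
      simpa using this
    rcases le_or_gt |s - a| 1 with h1 | h1
    · refine (min_le_left _ _).trans ?_
      rw [le_div_iff₀ hs1]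
      linarith
    · refine (min_le_right _ _).trans ?_
      have h2 : |s - a| ≤ ‖z - s‖ + ‖z - a‖ := by
        have := norm_sub_le_norm_sub_add_norm_sub (s : ℂ) z a
        rw [← Complex.ofReal_sub, Complex.norm_real, Real.norm_eq_abs,
          norm_sub_rev (s : ℂ) z] at this
        exact this
      have h3 : |s - a| / 2 ≤ ‖z - s‖ := by linarith
      rw [div_le_div_iff₀ (by linarith) hs1]
      have h4 : 1 + |s| ≤ (2 + |a|) * |s - a| := by nlinarith [abs_nonneg a]
      have h5 : 0 ≤ 2 + |a| := by positivity
      calc ‖z - a‖ * (1 + |s|) ≤ 1 / 2 * ((2 + |a|) * |s - a|) := by gcongr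
        _ = (2 + |a|) * (|s - a| / 2) := by ring
        _ ≤ (2 + |a|) * ‖z - s‖ := by gcongr
        _ ≤ 4 * (2 + |a|) * ‖z - s‖ := by
          have : 0 ≤ (2 + |a|) * ‖z - s‖ := by positivity
          linarith
  · have hae : ∀ᵐ s : ℝ, s ≠ a := by simp [ae_iff]
    filter_upwards [hae] with s hs
    have h1 : ‖(a : ℂ) - s‖ ≠ 0 := norm_ne_zero_iff.2 (sub_ne_zero.2 (by exact_mod_cast hs.symm))
    have h2 : Tendsto (fun z : ℂ => ‖z - s‖) (𝓝 (a : ℂ)) (𝓝 ‖(a : ℂ) - s‖) :=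
      Continuous.tendsto (by fun_prop) _
    have h3 : Tendsto (fun z : ℂ => ‖z - a‖) (𝓝 (a : ℂ)) (𝓝 0) := by
      have := Continuous.tendsto (by fun_prop : Continuous fun z : ℂ => ‖z - a‖) (a : ℂ)
      simpa using this
    have h4 := ((tendsto_const_nhds (x := (4 : ℝ))).min (h3.div h2 h1)).mul_const ‖h s‖
    simpa using h4

/-- At a mild singularity `a` the Cauchy integral is `o(1 / |z - a|)`, uniformly up to the line. -/
lemma MildSingularity.tendsto_mul_cauchyIntegral {h : ℝ → ℂ} {a : ℝ} (hs : MildSingularity h a)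
    (hh : CauchyAdmissible h) :
    Tendsto (fun z => (z - a) * cauchyIntegral h z) (𝓝[{z : ℂ | z.im ≠ 0}] (a : ℂ)) (𝓝 0) := by
  rw [Metric.tendsto_nhds]
  intro ε hε
  have hev := hs (ε / 40) (by positivity)
  rw [eventually_nhdsWithin_iff] at hev
  have hre : Tendsto Complex.re (𝓝 (a : ℂ)) (𝓝 a) := by
    simpa using Complex.continuous_re.tendsto (a : ℂ)
  have hD := (tendsto_order.1 (tendsto_integral_min_mul_norm hh a)).2 (ε / 2) (by positivity)
  rw [eventually_nhdsWithin_iff]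
  filter_upwards [hre.eventually hev, hD] with z hz1 hz2 hzim
  have hzim' : z.im ≠ 0 := hzim
  rw [dist_zero_right]
  have hne : ∀ s : ℝ, 0 < ‖z - s‖ := fun s =>
    (abs_pos.2 hzim').trans_le (abs_im_le_norm_sub_ofReal z s)
  have hDi : Integrable fun s : ℝ => min 4 (‖z - a‖ / ‖z - s‖) * ‖h s‖ := by
    refine ((hh.integrable_div_of_im_ne_zero hzim').norm.const_mul ‖z - a‖).mono' ?_
      (Eventually.of_forall fun s => ?_)
    · exact ((Measurable.min measurable_const (by fun_prop)).mul
        hh.measurable.norm).aestronglyMeasurable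
    · have hmin : 0 ≤ min 4 (‖z - a‖ / ‖z - s‖) := le_min (by norm_num) (by positivity)
      rw [norm_mul, Real.norm_of_nonneg hmin, norm_norm, norm_div]
      calc min 4 (‖z - a‖ / ‖z - s‖) * ‖h s‖ ≤ ‖z - a‖ / ‖z - s‖ * ‖h s‖ := by
            gcongr; exact min_le_right _ _
        _ = _ := by ring
  have hfar : ∀ k : ℝ → ℂ, (∀ s, ‖k s‖ ≤ ‖h s‖) → (∀ s, k s ≠ 0 → ‖z - a‖ ≤ 4 * ‖z - s‖) →
      ‖(z - a) * cauchyIntegral k z‖ < ε / 2 := by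
    intro k hk1 hk2
    refine lt_of_le_of_lt ?_ hz2
    rw [cauchyIntegral, ← integral_const_mul]
    refine norm_integral_le_of_norm_le hDi (Eventually.of_forall fun s => ?_)
    by_cases h0 : k s = 0
    · rw [h0]
      simp only [zero_div, mul_zero, norm_zero]
      positivity
    · rw [norm_mul, norm_div, min_eq_right (by rw [div_le_iff₀ (hne s)]; exact hk2 s h0)]
      calc ‖z - a‖ * (‖k s‖ / ‖z - s‖) ≤ ‖z - a‖ * (‖h s‖ / ‖z - s‖) := by
            gcongr; exact hk1 s
        _ = _ := by ring
  have hza : ‖z - a‖ ≤ |z.re - a| + |z.im| := by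
    simpa using Complex.norm_le_abs_re_add_abs_im (z - a)
  rcases le_or_gt |z.re - a| |z.im| with hc | hc
  · refine (hfar h (fun _ => le_rfl) fun s _ => ?_).trans (by linarith)
    have := abs_im_le_norm_sub_ofReal z s
    linarith [abs_nonneg z.im]
  · have hca : 0 < |z.re - a| := (abs_nonneg _).trans_lt hc
    obtain ⟨e1, e2⟩ := hz1 (by
      intro h1
      have h1' : z.re = a := h1
      rw [h1'] at hca
      simp at hca)
    set d := |z.re - a| with hd
    rw [hh.cauchyIntegral_eq_add hzim' (by linarith : z.re - d / 2 ≤ z.re + d / 2), mul_add]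
    have hA := hfar ((Set.Ioc (z.re - d / 2) (z.re + d / 2))ᶜ.indicator h)
      (fun s => norm_indicator_le_norm_self h s) (fun s hs0 => by
        have h1 : s ∉ Set.Ioc (z.re - d / 2) (z.re + d / 2) := by
          by_contra h2
          exact hs0 (Set.indicator_of_notMem (by simpa using h2) _)
        have h3 : d / 2 ≤ |s - z.re| := by
          by_contra h4
          rw [not_le, abs_lt] at h4
          exact h1 ⟨by linarith, by linarith⟩
        have := abs_re_sub_le_norm_sub_ofReal z s
        linarith)
    have hB := norm_integral_near_le hh hzim' (ρ := d / 2) (L := ε / 40 / d ^ 2) (by linarith)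
      (fun s hs => by
        rw [div_mul_eq_mul_div, le_div_iff₀ (by positivity), mul_comm]
        exact e2 s hs)
    have hB' : ‖(z - a) * ∫ s in (z.re - d / 2)..(z.re + d / 2), h s / (z - s)‖ ≤ ε / 2 := by
      rw [norm_mul]
      calc ‖z - a‖ * ‖∫ s in (z.re - d / 2)..(z.re + d / 2), h s / (z - s)‖
          ≤ (2 * d) * (2 * (d / 2) * (ε / 40 / d ^ 2) + 2 * Real.pi * ‖h z.re‖) := by
            gcongr
            linarith
        _ = 2 * (ε / 40) + 4 * Real.pi * (d * ‖h z.re‖) := by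
            field_simp
            ring
        _ ≤ 2 * (ε / 40) + 4 * 4 * (ε / 40) := by
            have := Real.pi_lt_four
            gcongr
        _ ≤ ε / 2 := by linarith
    exact (norm_add_le _ _).trans_lt (by linarith)

/-! ### Local behaviour of the symbol -/

/-- `f` is Lipschitz on some interval around `t`. -/
def LipschitzNear (f : ℝ → ℂ) (t : ℝ) : Prop :=
  ∃ r > 0, ∃ L : ℝ, ∀ s ∈ Set.Icc (t - r) (t + r), ∀ s' ∈ Set.Icc (t - r) (t + r),
    ‖f s - f s'‖ ≤ L * |s - s'|

lemma _root_.ContDiffAt.lipschitzNear {f : ℝ → ℂ} {t : ℝ} (hf : ContDiffAt ℝ 1 f t) :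
    LipschitzNear f t := by
  obtain ⟨K, S, hS, hK⟩ := hf.exists_lipschitzOnWith
  obtain ⟨r, hr, hrS⟩ := Metric.nhds_basis_closedBall.mem_iff.1 hS
  rw [Real.closedBall_eq_Icc] at hrS
  refine ⟨r, hr, K, fun s hs s' hs' => ?_⟩
  have := hK.dist_le_mul s (hrS hs) s' (hrS hs')
  rwa [dist_eq_norm, Real.dist_eq] at this

lemma _root_.AnalyticAt.lipschitzNear_ofReal {f : ℂ → ℂ} {t : ℝ} (hf : AnalyticAt ℂ f (t : ℂ)) :
    LipschitzNear (fun s : ℝ => f s) t := by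
  have h1 : ContDiffAt ℝ 1 f (t : ℂ) := (hf.contDiffAt (n := 1)).restrict_scalars ℝ
  exact (h1.comp t Complex.ofRealCLM.contDiff.contDiffAt).lipschitzNear

lemma LipschitzNear.eventually_norm_le {f : ℝ → ℂ} {t : ℝ} (hf : LipschitzNear f t) :
    ∃ C : ℝ, 0 ≤ C ∧ ∀ᶠ s in 𝓝 t, ‖f s‖ ≤ C := by
  obtain ⟨r, hr, L, hL⟩ := hf
  refine ⟨‖f t‖ + |L| * r, by positivity, ?_⟩
  filter_upwards [Metric.closedBall_mem_nhds t hr] with s hs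
  rw [Real.closedBall_eq_Icc] at hs
  have h1 := hL s hs t ⟨by linarith, by linarith⟩
  have h2 := norm_le_norm_add_norm_sub' (f s) (f t)
  have h3 : |s - t| ≤ r := abs_le.2 ⟨by linarith [hs.1], by linarith [hs.2]⟩
  have h4 : L * |s - t| ≤ |L| * r := by
    calc L * |s - t| ≤ |L| * |s - t| := by gcongr; exact le_abs_self L
      _ ≤ |L| * r := by gcongr
  linarith

lemma LipschitzNear.integrableAtFilter {f : ℝ → ℂ} {t : ℝ} (hf : LipschitzNear f t)
    (hm : Measurable f) : IntegrableAtFilter f (𝓝 t) := by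
  obtain ⟨C, -, hC⟩ := hf.eventually_norm_le
  obtain ⟨r, hr, hrS⟩ := Metric.nhds_basis_closedBall.mem_iff.1 hC
  refine ⟨Metric.closedBall t r, Metric.closedBall_mem_nhds t hr, ?_⟩
  refine Measure.integrableOn_of_bounded (M := C) ?_ hm.aestronglyMeasurable ?_
  · exact (isCompact_closedBall t r).measure_lt_top.ne
  · exact (ae_restrict_iff' Metric.isClosed_closedBall.measurableSet).2
      (Eventually.of_forall fun s hs => hrS hs)

lemma MildSingularity.comp_sub {p : ℝ → ℂ} (hp : MildSingularity p 0) (a : ℝ) :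
    MildSingularity (fun s => p (s - a)) a := by
  intro ε hε
  have h1 : Tendsto (fun s : ℝ => s - a) (𝓝[≠] a) (𝓝[≠] 0) := by
    refine tendsto_nhdsWithin_iff.2 ⟨?_, ?_⟩
    · have := Continuous.tendsto (by fun_prop : Continuous fun s : ℝ => s - a) a
      rw [sub_self] at this
      exact this.mono_left nhdsWithin_le_nhds
    · filter_upwards [self_mem_nhdsWithin] with s hs
      exact sub_ne_zero.2 hs
  filter_upwards [h1.eventually (hp ε hε)] with c hc
  rw [sub_zero] at hc
  refine ⟨hc.1, fun s hs => ?_⟩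
  have := hc.2 (s - a) ⟨by linarith [hs.1], by linarith [hs.2]⟩
  rwa [sub_sub_sub_cancel_right] at this

/-- The other factors of the symbol do not spoil a mild singularity. -/
lemma MildSingularity.mul_lipschitzNear {p w : ℝ → ℂ} {a : ℝ} (hp : MildSingularity p a)
    (hw : LipschitzNear w a) : MildSingularity (fun s => p s * w s) a := by
  intro ε hε
  obtain ⟨C, hC0, hC⟩ := hw.eventually_norm_le
  obtain ⟨r, hr, L, hL⟩ := hw
  obtain ⟨r', hr', hrC⟩ := Metric.nhds_basis_ball.mem_iff.1 hC
  set m : ℝ := min (min r r') 1 with hm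
  have hm0 : 0 < m := by positivity
  filter_upwards [hp (ε / (C + |L| + 1)) (by positivity),
    mem_nhdsWithin_of_mem_nhds (Metric.ball_mem_nhds a (by positivity : 0 < m / 2))] with c hc hcm
  rw [Metric.mem_ball, Real.dist_eq] at hcm
  have hmem : ∀ s ∈ Set.Icc (c - |c - a| / 2) (c + |c - a| / 2), |s - a| < m := by
    intro s hs
    have h1 : |s - c| ≤ |c - a| / 2 := abs_le.2 ⟨by linarith [hs.1], by linarith [hs.2]⟩
    linarith [abs_sub_le s c a]
  have hmr : m ≤ r := (min_le_left _ _).trans (min_le_left _ _)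
  have hmr' : m ≤ r' := (min_le_left _ _).trans (min_le_right _ _)
  have hm1 : m ≤ 1 := min_le_right _ _
  have hwC : ∀ s, |s - a| < m → ‖w s‖ ≤ C := fun s hs =>
    hrC (by rw [Metric.mem_ball, Real.dist_eq]; linarith)
  have hIcc : ∀ s, |s - a| < m → s ∈ Set.Icc (a - r) (a + r) := fun s hs => by
    rw [abs_lt] at hs
    exact ⟨by linarith, by linarith⟩
  have hcm' : |c - a| < m := by linarith
  have hpos : 0 ≤ ε / (C + |L| + 1) := by positivity
  have hfin : ε / (C + |L| + 1) * (C + |L|) ≤ ε := by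
    rw [div_mul_eq_mul_div, div_le_iff₀ (by positivity)]
    nlinarith
  refine ⟨?_, fun s hs => ?_⟩
  · rw [norm_mul, ← mul_assoc]
    calc |c - a| * ‖p c‖ * ‖w c‖ ≤ ε / (C + |L| + 1) * C := by
          gcongr
          exacts [hc.1, hwC c hcm']
      _ ≤ ε / (C + |L| + 1) * (C + |L|) := by gcongr; linarith [abs_nonneg L]
      _ ≤ ε := hfin
  · have e1 : p s * w s - p c * w c = (p s - p c) * w s + p c * (w s - w c) := by ring
    have e2 : ‖w s - w c‖ ≤ |L| * |s - c| :=
      (hL s (hIcc s (hmem s hs)) c (hIcc c hcm')).trans (by gcongr; exact le_abs_self L)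
    have e3 : |c - a| ≤ 1 := by linarith
    rw [e1]
    calc |c - a| ^ 2 * ‖(p s - p c) * w s + p c * (w s - w c)‖
        ≤ |c - a| ^ 2 * (‖p s - p c‖ * ‖w s‖ + ‖p c‖ * ‖w s - w c‖) := by
          gcongr
          refine (norm_add_le _ _).trans ?_
          rw [norm_mul, norm_mul]
      _ = (|c - a| ^ 2 * ‖p s - p c‖) * ‖w s‖ + |c - a| * (|c - a| * ‖p c‖) * ‖w s - w c‖ := by ring
      _ ≤ (ε / (C + |L| + 1) * |s - c|) * C + 1 * (ε / (C + |L| + 1)) * (|L| * |s - c|) := by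
          gcongr ?_ * ?_ + ?_ * ?_ * ?_
          exacts [hc.2 s hs, hwC s (hmem s hs), hc.1]
      _ = ε / (C + |L| + 1) * (C + |L|) * |s - c| := by ring
      _ ≤ ε * |s - c| := by gcongr

lemma MildSingularity.sub_one {p : ℝ → ℂ} {a : ℝ} (hp : MildSingularity p a) :
    MildSingularity (fun s => p s - 1) a := by
  intro ε hε
  filter_upwards [hp (ε / 2) (by positivity), mem_nhdsWithin_of_mem_nhds
    (Metric.ball_mem_nhds a (by positivity : 0 < ε / 2))] with c hc hcm
  rw [Metric.mem_ball, Real.dist_eq] at hcm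
  refine ⟨?_, fun s hs => ?_⟩
  · calc |c - a| * ‖p c - 1‖ ≤ |c - a| * (‖p c‖ + 1) := by
          gcongr
          simpa using norm_sub_le (p c) 1
      _ ≤ ε := by linarith [hc.1]
  · rw [sub_sub_sub_cancel_right]
    exact (hc.2 s hs).trans (by gcongr; linarith)

/-! ### The pure Fisher–Hartwig symbol -/

/-- The analytic continuation of the pure symbol. -/
noncomputable def pureSymbolExt (ν νbar z : ℂ) : ℂ :=
  ((z + Complex.I) / z) ^ ν * ((z - Complex.I) / z) ^ νbar

lemma pureSymbol_eq_ext (ν νbar : ℂ) (ξ : ℝ) : pureSymbol ν νbar ξ = pureSymbolExt ν νbar ξ := rfl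

lemma ofReal_add_I_div_mem_slitPlane {u : ℝ} (hu : u ≠ 0) :
    ((u : ℂ) + Complex.I) / u ∈ Complex.slitPlane := by
  refine Or.inl ?_
  rw [Complex.div_ofReal_re]
  simp [hu]

lemma ofReal_sub_I_div_mem_slitPlane {u : ℝ} (hu : u ≠ 0) :
    ((u : ℂ) - Complex.I) / u ∈ Complex.slitPlane := by
  refine Or.inl ?_
  rw [Complex.div_ofReal_re]
  simp [hu]

lemma analyticAt_pureSymbolExt (ν νbar : ℂ) {u : ℝ} (hu : u ≠ 0) :
    AnalyticAt ℂ (pureSymbolExt ν νbar) u := by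
  have hu' : (u : ℂ) ≠ 0 := by exact_mod_cast hu
  refine AnalyticAt.mul (AnalyticAt.cpow ?_ analyticAt_const (ofReal_add_I_div_mem_slitPlane hu))
    (AnalyticAt.cpow ?_ analyticAt_const (ofReal_sub_I_div_mem_slitPlane hu))
  · exact (analyticAt_id.add analyticAt_const).div analyticAt_id hu'
  · exact (analyticAt_id.sub analyticAt_const).div analyticAt_id hu'

lemma measurable_pureSymbol (ν νbar : ℂ) : Measurable (pureSymbol ν νbar) := by
  unfold pureSymbol
  refine Measurable.mul (Measurable.pow_const ?_ _) (Measurable.pow_const ?_ _) <;> fun_prop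

lemma abs_le_norm_ofReal_add_I (u : ℝ) : |u| ≤ ‖(u : ℂ) + Complex.I‖ := by
  simpa using Complex.abs_re_le_norm ((u : ℂ) + Complex.I)

lemma one_le_norm_ofReal_add_I (u : ℝ) : 1 ≤ ‖(u : ℂ) + Complex.I‖ := by
  simpa using Complex.abs_im_le_norm ((u : ℂ) + Complex.I)

lemma one_le_norm_ofReal_sub_I (u : ℝ) : 1 ≤ ‖(u : ℂ) - Complex.I‖ := by
  simpa using Complex.abs_im_le_norm ((u : ℂ) - Complex.I)

/-- The logarithmic derivative of the pure symbol. -/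
lemma hasDerivAt_pureSymbol (ν νbar : ℂ) {u : ℝ} (hu : u ≠ 0) :
    HasDerivAt (pureSymbol ν νbar) (pureSymbol ν νbar u *
      (νbar * Complex.I / (u * (u - Complex.I)) - ν * Complex.I / (u * (u + Complex.I)))) u := by
  have hu' : (u : ℂ) ≠ 0 := by exact_mod_cast hu
  have hp : (u : ℂ) + Complex.I ≠ 0 :=
    norm_pos_iff.1 (one_pos.trans_le (one_le_norm_ofReal_add_I u))
  have hm : (u : ℂ) - Complex.I ≠ 0 :=
    norm_pos_iff.1 (one_pos.trans_le (one_le_norm_ofReal_sub_I u))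
  have d1 := (((hasDerivAt_id (u : ℂ)).add_const Complex.I).div (hasDerivAt_id _) hu').cpow_const
    (c := ν) (ofReal_add_I_div_mem_slitPlane hu)
  have d2 := (((hasDerivAt_id (u : ℂ)).sub_const Complex.I).div (hasDerivAt_id _) hu').cpow_const
    (c := νbar) (ofReal_sub_I_div_mem_slitPlane hu)
  have d := (d1.mul d2).comp_ofReal
  refine d.congr_deriv ?_
  simp only [pureSymbol, id, Pi.div_apply]
  rw [Complex.cpow_sub _ _ (div_ne_zero hp hu'), Complex.cpow_sub _ _ (div_ne_zero hm hu'),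
    Complex.cpow_one, Complex.cpow_one]
  field_simp
  ring

lemma norm_deriv_pureSymbol_le (ν νbar : ℂ) {u : ℝ} (hu : u ≠ 0) :
    ‖deriv (pureSymbol ν νbar) u‖ ≤ (‖ν‖ + ‖νbar‖) * ‖pureSymbol ν νbar u‖ / |u| := by
  have hu0 : 0 < |u| := abs_pos.2 hu
  rw [(hasDerivAt_pureSymbol ν νbar hu).deriv, norm_mul]
  have e1 : ‖ν * Complex.I / (u * (u + Complex.I))‖ ≤ ‖ν‖ / |u| := by
    rw [norm_div, norm_mul, norm_mul, Complex.norm_I, mul_one, Complex.norm_real, Real.norm_eq_abs]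
    gcongr
    exact le_mul_of_one_le_right hu0.le (one_le_norm_ofReal_add_I u)
  have e2 : ‖νbar * Complex.I / (u * (u - Complex.I))‖ ≤ ‖νbar‖ / |u| := by
    rw [norm_div, norm_mul, norm_mul, Complex.norm_I, mul_one, Complex.norm_real, Real.norm_eq_abs]
    gcongr
    exact le_mul_of_one_le_right hu0.le (one_le_norm_ofReal_sub_I u)
  calc ‖pureSymbol ν νbar u‖ * ‖νbar * Complex.I / (u * (u - Complex.I)) -
        ν * Complex.I / (u * (u + Complex.I))‖
      ≤ ‖pureSymbol ν νbar u‖ * (‖νbar‖ / |u| + ‖ν‖ / |u|) := by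
        gcongr
        exact (norm_sub_le _ _).trans (add_le_add e2 e1)
    _ = _ := by ring

/-- Near its singularity the pure symbol is bounded by a power with exponent larger than `-1`. -/
lemma exists_norm_pureSymbol_le {ν νbar : ℂ} (hγ : ((ν + νbar) / 2).re < 1 / 2) :
    ∃ α C : ℝ, 0 ≤ α ∧ α < 1 ∧ 0 ≤ C ∧
      ∀ u : ℝ, u ≠ 0 → |u| ≤ 1 → ‖pureSymbol ν νbar u‖ ≤ C * |u| ^ (-α) := by
  set q : ℝ := ν.re + νbar.re with hq
  have hq1 : q < 1 := by
    have : ((ν + νbar) / 2).re = (ν.re + νbar.re) / 2 := by simp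
    rw [this] at hγ
    linarith
  set E : ℝ := Real.exp (Real.pi * |ν.im|) * Real.exp (Real.pi * |νbar.im|) with hE
  refine ⟨max q 0, 2 ^ (max q 0) * E, le_max_right _ _, max_lt hq1 one_pos, by positivity,
    fun u hu hu1 => ?_⟩
  have hu0 : 0 < |u| := abs_pos.2 hu
  have hu' : (u : ℂ) ≠ 0 := by exact_mod_cast hu
  have hexp : ∀ w z : ℂ, ‖z ^ w‖ ≤ ‖z‖ ^ w.re * Real.exp (Real.pi * |w.im|) := by
    intro w z
    refine (Complex.norm_cpow_le z w).trans ?_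
    rw [div_eq_mul_inv, ← Real.exp_neg]
    gcongr
    calc -(z.arg * w.im) ≤ |z.arg * w.im| := neg_le_abs _
      _ = |z.arg| * |w.im| := abs_mul _ _
      _ ≤ Real.pi * |w.im| := by gcongr; exact Complex.abs_arg_le_pi z
  have hnorm : ‖((u : ℂ) - Complex.I) / u‖ = ‖((u : ℂ) + Complex.I) / u‖ := by
    rw [norm_div, norm_div]
    congr 1
    rw [Complex.norm_def, Complex.norm_def]
    simp [Complex.normSq_apply]
  set m : ℝ := ‖((u : ℂ) + Complex.I) / u‖ with hm
  have hm_eq : m = ‖(u : ℂ) + Complex.I‖ / |u| := by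
    rw [hm, norm_div, Complex.norm_real, Real.norm_eq_abs]
  have hm1 : 1 ≤ m := by
    rw [hm_eq, one_le_div hu0]
    exact abs_le_norm_ofReal_add_I u
  have hm2 : m ≤ 2 * |u|⁻¹ := by
    rw [hm_eq, div_eq_mul_inv]
    gcongr
    have h1 := norm_add_le (u : ℂ) Complex.I
    rw [Complex.norm_I, Complex.norm_real, Real.norm_eq_abs] at h1
    linarith
  have hmpos : 0 < m := by linarith
  calc ‖pureSymbol ν νbar u‖ ≤ (m ^ ν.re * Real.exp (Real.pi * |ν.im|)) *
        (m ^ νbar.re * Real.exp (Real.pi * |νbar.im|)) := by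
        rw [pureSymbol, norm_mul]
        gcongr
        · exact hexp _ _
        · have := hexp νbar (((u : ℂ) - Complex.I) / u)
          rwa [hnorm] at this
    _ = m ^ q * E := by rw [hq, Real.rpow_add hmpos]; ring
    _ ≤ m ^ (max q 0) * E := by
        gcongr
        exact le_max_left _ _
    _ ≤ (2 * |u|⁻¹) ^ (max q 0) * E := by
        gcongr
    _ = 2 ^ (max q 0) * E * |u| ^ (-max q 0) := by
        rw [Real.mul_rpow (by norm_num) (by positivity), Real.inv_rpow hu0.le,
          ← Real.rpow_neg hu0.le]
        ring

/-- The derivative of the pure symbol is `O(|u| ^ (-α - 1))` with `α < 1`. -/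
lemma mildSingularity_pureSymbol {ν νbar : ℂ} (hγ : ((ν + νbar) / 2).re < 1 / 2) :
    MildSingularity (pureSymbol ν νbar) 0 := by
  obtain ⟨α, C, hα0, hα1, hC0, hC⟩ := exists_norm_pureSymbol_le hγ
  set D : ℝ := (‖ν‖ + ‖νbar‖) * C * 2 ^ (α + 1) + C with hD
  have hD0 : 0 ≤ D := by positivity
  have hlim : Tendsto (fun c : ℝ => D * |c| ^ (1 - α)) (𝓝[≠] 0) (𝓝 0) := by
    have h1 : Continuous fun c : ℝ => D * |c| ^ (1 - α) :=
      continuous_const.mul (continuous_abs.rpow_const fun _ => Or.inr (by linarith))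
    have h2 := h1.tendsto 0
    simp only [abs_zero, Real.zero_rpow (by linarith : 1 - α ≠ 0), mul_zero] at h2
    exact h2.mono_left nhdsWithin_le_nhds
  intro ε hε
  filter_upwards [(tendsto_order.1 hlim).2 ε hε, self_mem_nhdsWithin,
    mem_nhdsWithin_of_mem_nhds (Metric.ball_mem_nhds (0 : ℝ) (by norm_num : (0 : ℝ) < 1 / 2))]
    with c hcε hc0 hc1
  have hc0' : c ≠ 0 := hc0
  rw [mem_ball_zero_iff, Real.norm_eq_abs] at hc1
  have hcpos : 0 < |c| := abs_pos.2 hc0'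
  rw [sub_zero]
  have hpow1 : |c| * |c| ^ (-α) = |c| ^ (1 - α) := by
    rw [sub_eq_add_neg, Real.rpow_add hcpos, Real.rpow_one]
  refine ⟨?_, fun s hs => ?_⟩
  · calc |c| * ‖pureSymbol ν νbar c‖ ≤ |c| * (C * |c| ^ (-α)) := by
          gcongr
          exact hC c hc0' (by linarith)
      _ = C * |c| ^ (1 - α) := by rw [← hpow1]; ring
      _ ≤ D * |c| ^ (1 - α) := by
          gcongr
          rw [hD]
          have : 0 ≤ (‖ν‖ + ‖νbar‖) * C * 2 ^ (α + 1) := by positivity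
          linarith
      _ ≤ ε := hcε.le
  · have hx : ∀ x ∈ Set.Icc (c - |c| / 2) (c + |c| / 2), |c| / 2 ≤ |x| ∧ |x| ≤ 1 := by
      intro x hx
      have h1 : |x - c| ≤ |c| / 2 := abs_le.2 ⟨by linarith [hx.1], by linarith [hx.2]⟩
      have h2 := abs_sub_abs_le_abs_sub c x
      rw [abs_sub_comm] at h2
      have h3 := abs_sub_abs_le_abs_sub x c
      exact ⟨by linarith, by linarith⟩
    have hx0 : ∀ x ∈ Set.Icc (c - |c| / 2) (c + |c| / 2), x ≠ 0 := fun x h => by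
      have := (hx x h).1
      exact abs_pos.1 (by linarith)
    have hder : ∀ x ∈ Set.Icc (c - |c| / 2) (c + |c| / 2), ‖deriv (pureSymbol ν νbar) x‖ ≤
        (‖ν‖ + ‖νbar‖) * C * (|c| / 2) ^ (-(α + 1)) := by
      intro x h
      have hxp : 0 < |x| := abs_pos.2 (hx0 x h)
      refine (norm_deriv_pureSymbol_le ν νbar (hx0 x h)).trans ?_
      calc (‖ν‖ + ‖νbar‖) * ‖pureSymbol ν νbar x‖ / |x|
          ≤ (‖ν‖ + ‖νbar‖) * (C * |x| ^ (-α)) / |x| := by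
            gcongr
            exact hC x (hx0 x h) (hx x h).2
        _ = (‖ν‖ + ‖νbar‖) * C * |x| ^ (-(α + 1)) := by
            rw [neg_add, Real.rpow_add hxp, Real.rpow_neg_one]
            ring
        _ ≤ (‖ν‖ + ‖νbar‖) * C * (|c| / 2) ^ (-(α + 1)) := by
            gcongr ?_ * ?_
            exact Real.rpow_le_rpow_of_nonpos (by linarith) (hx x h).1 (by linarith)
    have hmv := (convex_Icc (c - |c| / 2) (c + |c| / 2)).norm_image_sub_le_of_norm_deriv_le
      (f := pureSymbol ν νbar)
      (fun x h => (hasDerivAt_pureSymbol ν νbar (hx0 x h)).differentiableAt) hder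
      (⟨by linarith, by linarith⟩ : c ∈ Set.Icc (c - |c| / 2) (c + |c| / 2)) hs
    rw [Real.norm_eq_abs] at hmv
    have hpow2 : |c| ^ 2 * (|c| / 2) ^ (-(α + 1)) = 2 ^ (α + 1) * |c| ^ (1 - α) := by
      rw [Real.div_rpow hcpos.le (by norm_num), Real.rpow_neg (by norm_num : (0:ℝ) ≤ 2),
        div_inv_eq_mul, ← Real.rpow_natCast, ← mul_assoc, ← Real.rpow_add hcpos]
      push_cast
      rw [mul_comm]
      ring_nf
    calc |c| ^ 2 * ‖pureSymbol ν νbar s - pureSymbol ν νbar c‖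
        ≤ |c| ^ 2 * ((‖ν‖ + ‖νbar‖) * C * (|c| / 2) ^ (-(α + 1)) * |s - c|) := by gcongr
      _ = (‖ν‖ + ‖νbar‖) * C * (|c| ^ 2 * (|c| / 2) ^ (-(α + 1))) * |s - c| := by ring
      _ = (‖ν‖ + ‖νbar‖) * C * 2 ^ (α + 1) * |c| ^ (1 - α) * |s - c| := by rw [hpow2]; ring
      _ ≤ D * |c| ^ (1 - α) * |s - c| := by
          gcongr
          linarith
      _ ≤ ε * |s - c| := by gcongr

lemma integrableAtFilter_pureSymbol_mul {ν νbar : ℂ} (hγ : ((ν + νbar) / 2).re < 1 / 2) {a : ℝ}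
    {w : ℝ → ℂ} (hw : LipschitzNear w a) (hwm : Measurable w) :
    IntegrableAtFilter (fun s => pureSymbol ν νbar (s - a) * w s) (𝓝 a) := by
  obtain ⟨α, C, hα0, hα1, hC0, hC⟩ := exists_norm_pureSymbol_le hγ
  obtain ⟨D, hD0, hD⟩ := hw.eventually_norm_le
  obtain ⟨r, hr, hrS⟩ := Metric.nhds_basis_ball.mem_iff.1 hD
  have h1 : IntegrableOn (pureSymbol ν νbar) (Metric.ball 0 1) := by
    refine integrableOn_ball_of_norm_le_rpow (C := C) (α := α) (by simp) (by simpa using hα1) ?_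
      (measurable_pureSymbol ν νbar).aestronglyMeasurable
    rw [ae_restrict_iff' Metric.isOpen_ball.measurableSet]
    have hae : ∀ᵐ s : ℝ, s ≠ 0 := by simp [ae_iff]
    filter_upwards [hae] with s hs hs1
    rw [mem_ball_zero_iff, Real.norm_eq_abs] at hs1
    exact hC s hs hs1.le
  have h2 : IntegrableOn (fun s => pureSymbol ν νbar (s - a)) (Metric.ball a 1) := by
    rw [← integrable_indicator_iff Metric.isOpen_ball.measurableSet] at h1 ⊢
    have := h1.comp_sub_right a
    refine this.congr (Eventually.of_forall fun s => ?_)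
    simp only [Set.indicator, Metric.mem_ball, dist_eq_norm, sub_zero]
  refine ⟨Metric.ball a (min r 1), Metric.ball_mem_nhds a (by positivity), ?_⟩
  refine (h2.mono_set (Metric.ball_subset_ball (min_le_right _ _))).mul_bdd (c := D)
    hwm.aestronglyMeasurable ?_
  exact (ae_restrict_iff' Metric.isOpen_ball.measurableSet).2 (Eventually.of_forall fun s hs =>
    hrS (Metric.ball_subset_ball (min_le_left _ _) hs))

/-! ### The symbol at infinity -/

/-- `f = 1 + O(|s| ^ (-β))` at infinity, with derivative tending to `0`. -/
structure NearOne (β : ℝ) (f : ℝ → ℂ) : Prop where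
  isBigO : (fun s => f s - 1) =O[Bornology.cobounded ℝ] fun s => |s| ^ (-β)
  differentiableAt : ∀ᶠ s in Bornology.cobounded ℝ, DifferentiableAt ℝ f s
  tendsto_deriv : Tendsto (deriv f) (Bornology.cobounded ℝ) (𝓝 0)

lemma tendsto_abs_cobounded : Tendsto (fun s : ℝ => |s|) (Bornology.cobounded ℝ) atTop :=
  tendsto_norm_cobounded_atTop

lemma tendsto_rpow_neg_cobounded {β : ℝ} (hβ : 0 < β) :
    Tendsto (fun s : ℝ => |s| ^ (-β)) (Bornology.cobounded ℝ) (𝓝 0) :=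
  (tendsto_rpow_neg_atTop hβ).comp tendsto_abs_cobounded

namespace NearOne

variable {β : ℝ} {f g : ℝ → ℂ}

lemma tendsto (hβ : 0 < β) (hf : NearOne β f) : Tendsto f (Bornology.cobounded ℝ) (𝓝 1) := by
  have := hf.isBigO.trans_tendsto (tendsto_rpow_neg_cobounded hβ)
  simpa using this.add_const 1

lemma one : NearOne β fun _ => 1 where
  isBigO := by simp [Asymptotics.isBigO_zero]
  differentiableAt := Eventually.of_forall fun _ => differentiableAt_const _
  tendsto_deriv := by simp

lemma mul (hβ : 0 < β) (hf : NearOne β f) (hg : NearOne β g) :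
    NearOne β fun s => f s * g s where
  isBigO := by
    have h1 : (fun s => (f s - 1) * g s) =O[Bornology.cobounded ℝ] fun s => |s| ^ (-β) * (1 : ℝ) :=
      hf.isBigO.mul ((hg.tendsto hβ).isBigO_one ℝ)
    have h2 := (h1.congr_right fun s => mul_one _).add hg.isBigO
    refine h2.congr_left fun s => ?_
    ring
  differentiableAt := by
    filter_upwards [hf.differentiableAt, hg.differentiableAt] with s h1 h2 using h1.mul h2
  tendsto_deriv := by
    have h1 := (hf.tendsto_deriv.mul (hg.tendsto hβ)).add ((hf.tendsto hβ).mul hg.tendsto_deriv)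
    rw [zero_mul, mul_zero, add_zero] at h1
    refine h1.congr' ?_
    filter_upwards [hf.differentiableAt, hg.differentiableAt] with s h1 h2
    exact (deriv_fun_mul h1 h2).symm

lemma prod (hβ : 0 < β) {ι : Type*} (S : Finset ι) {f : ι → ℝ → ℂ} (hf : ∀ i, NearOne β (f i)) :
    NearOne β fun s => ∏ i ∈ S, f i s := by
  classical
  induction S using Finset.induction_on with
  | empty => simpa using one
  | insert i S hi ih =>
    simp only [Finset.prod_insert hi]
    exact (hf i).mul hβ ih

end NearOne

/-- With `w = 1 / (s - a)` the pure symbol is `(1 + iw) ^ ν (1 - iw) ^ νbar`, which is smooth at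
`w = 0` with value `1`. -/
lemma nearOne_pureSymbol (ν νbar : ℂ) (a : ℝ) {β : ℝ} (hβ0 : 0 < β) (hβ1 : β ≤ 1) :
    NearOne β fun s => pureSymbol ν νbar (s - a) := by
  have hsub : Tendsto (fun s : ℝ => s - a) (Bornology.cobounded ℝ) (Bornology.cobounded ℝ) := by
    rw [← tendsto_norm_atTop_iff_cobounded]
    refine tendsto_atTop_mono (fun s => ?_)
      (tendsto_atTop_add_const_right _ (-|a|) tendsto_abs_cobounded)
    have := abs_sub_abs_le_abs_sub s a
    rw [Real.norm_eq_abs]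
    linarith
  have hne : ∀ᶠ u : ℝ in Bornology.cobounded ℝ, u ≠ 0 := by
    filter_upwards [tendsto_abs_cobounded.eventually_gt_atTop 0] with u hu using abs_pos.1 hu
  have hbig : (fun s => pureSymbol ν νbar (s - a) - 1) =O[Bornology.cobounded ℝ]
      fun s => |s| ^ (-β) := by
    set q : ℂ → ℂ := fun w => (1 + Complex.I * w) ^ ν * (1 - Complex.I * w) ^ νbar with hq
    have hq0 : q 0 = 1 := by simp [hq]
    have hd : DifferentiableAt ℂ q 0 := by
      refine DifferentiableAt.mul ?_ ?_
      · exact DifferentiableAt.cpow_const (by fun_prop) (by simp)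
      · exact DifferentiableAt.cpow_const (by fun_prop) (by simp)
    have hO : (fun w => q w - 1) =O[𝓝 0] fun w : ℂ => w := by
      have := hd.hasDerivAt.isBigO_sub
      simpa [hq0] using this
    have hinv : Tendsto (fun s : ℝ => (((s - a : ℝ) : ℂ))⁻¹) (Bornology.cobounded ℝ) (𝓝 0) :=
      tendsto_inv₀_cobounded.comp (RCLike.tendsto_ofReal_cobounded_cobounded ℂ |>.comp hsub)
    have h1 := hO.comp_tendsto hinv
    have h2 : (fun s : ℝ => (((s - a : ℝ) : ℂ))⁻¹) =O[Bornology.cobounded ℝ]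
        fun s => |s| ^ (-β) := by
      refine Asymptotics.IsBigO.of_bound 2 ?_
      filter_upwards [tendsto_abs_cobounded.eventually_gt_atTop (2 * |a| + 1)] with s hs
      have hs1 : 1 ≤ |s| := by linarith [abs_nonneg a]
      have hs2 : |s| / 2 ≤ |s - a| := by
        have := abs_sub_abs_le_abs_sub s a
        linarith
      rw [norm_inv, Complex.norm_real, Real.norm_eq_abs, Real.norm_of_nonneg (by positivity)]
      calc |s - a|⁻¹ ≤ (|s| / 2)⁻¹ := by gcongr
        _ = 2 * |s| ^ (-1 : ℝ) := by rw [Real.rpow_neg_one, inv_div]; ring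
        _ ≤ 2 * |s| ^ (-β) := by
          gcongr
    refine (h1.trans h2).congr' ?_ EventuallyEq.rfl
    filter_upwards [hsub.eventually hne] with s hs
    have hs' : ((s - a : ℝ) : ℂ) ≠ 0 := by exact_mod_cast hs
    simp only [Function.comp_apply, hq, pureSymbol]
    rw [add_div, sub_div, div_self hs', div_eq_mul_inv]
  have hlim : Tendsto (fun s => pureSymbol ν νbar (s - a)) (Bornology.cobounded ℝ) (𝓝 1) := by
    have := hbig.trans_tendsto (tendsto_rpow_neg_cobounded hβ0)
    simpa using this.add_const 1
  refine ⟨hbig, ?_, ?_⟩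
  · filter_upwards [hsub.eventually hne] with s hs
    exact ((hasDerivAt_pureSymbol ν νbar hs).comp_sub_const s a).differentiableAt
  · have h1 : Tendsto (fun s => (‖ν‖ + ‖νbar‖) * ‖pureSymbol ν νbar (s - a)‖ / |s - a|)
        (Bornology.cobounded ℝ) (𝓝 0) :=
      (hlim.norm.const_mul _).div_atTop (tendsto_abs_cobounded.comp hsub)
    refine squeeze_zero_norm' ?_ h1
    filter_upwards [hsub.eventually hne] with s hs
    rw [deriv_comp_sub_const (f := pureSymbol ν νbar)]
    exact norm_deriv_pureSymbol_le ν νbar hs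

/-- The derivative of `F` along the line tends to `0` by Cauchy's estimate in the strip. -/
lemma nearOne_ofReal {F : ℂ → ℂ} {U : Set ℂ} {η κ β : ℝ} (hU : IsOpen U) (hη : 0 < η)
    (hstrip : ∀ z : ℂ, |z.im| < η → z ∈ U) (hF : DifferentiableOn ℂ F U) (hβ0 : 0 < β)
    (hβ : β ≤ (1 + κ) / 2)
    (hFinf : (fun z => F z - 1) =O[Bornology.cobounded ℂ ⊓ 𝓟 U]
      fun z => ‖z‖ ^ (-((1 + κ) / 2))) :
    NearOne β fun s : ℝ => F s := by
  have hmem : ∀ s : ℝ, (s : ℂ) ∈ U := fun s => hstrip _ (by simpa using hη)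
  have hdz : ∀ z ∈ U, DifferentiableAt ℂ F z := fun z hz => hF.differentiableAt (hU.mem_nhds hz)
  have htend : Tendsto (fun s : ℝ => (s : ℂ)) (Bornology.cobounded ℝ)
      (Bornology.cobounded ℂ ⊓ 𝓟 U) :=
    tendsto_inf.2 ⟨RCLike.tendsto_ofReal_cobounded_cobounded ℂ,
      tendsto_principal.2 (Eventually.of_forall hmem)⟩
  refine ⟨?_, Eventually.of_forall fun s =>
    (hdz s (hmem s)).hasDerivAt.comp_ofReal.differentiableAt, ?_⟩
  · refine (hFinf.comp_tendsto htend).trans (Asymptotics.IsBigO.of_bound 1 ?_)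
    filter_upwards [tendsto_abs_cobounded.eventually_ge_atTop 1] with s hs
    simp only [Function.comp_apply, Complex.norm_real, Real.norm_eq_abs]
    rw [abs_of_nonneg (Real.rpow_nonneg (abs_nonneg s) _),
      abs_of_nonneg (Real.rpow_nonneg (abs_nonneg s) _), one_mul]
    exact Real.rpow_le_rpow_of_exponent_le hs (by linarith)
  · have hlimF : Tendsto (fun z => F z - 1) (Bornology.cobounded ℂ ⊓ 𝓟 U) (𝓝 0) := by
      refine hFinf.trans_tendsto (((tendsto_rpow_neg_atTop (by linarith)).comp
        tendsto_norm_cobounded_atTop).mono_left inf_le_left)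
    have hder : deriv (fun s : ℝ => F s) = fun s : ℝ => deriv F s := by
      ext s
      exact (hdz s (hmem s)).hasDerivAt.comp_ofReal.deriv
    rw [hder, Metric.tendsto_nhds]
    intro ε hε
    have h1 := Metric.tendsto_nhds.1 hlimF (ε * (η / 2) / 2) (by positivity)
    rw [eventually_inf_principal, ← comap_norm_atTop, eventually_comap] at h1
    obtain ⟨R, hR⟩ := eventually_atTop.1 h1
    filter_upwards [tendsto_abs_cobounded.eventually_gt_atTop (R + η / 2)] with s hs
    have hball : Metric.closedBall (s : ℂ) (η / 2) ⊆ U := by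
      intro z hz
      refine hstrip z ?_
      rw [Metric.mem_closedBall, dist_eq_norm] at hz
      have := Complex.abs_im_le_norm (z - s)
      simp only [Complex.sub_im, Complex.ofReal_im, sub_zero] at this
      linarith
    have h2 := Complex.norm_deriv_le_of_forall_mem_sphere_norm_le (f := fun z => F z - 1)
      (c := (s : ℂ)) (R := η / 2) (C := ε * (η / 2) / 2) (by linarith)
      ((hF.sub_const 1).diffContOnCl_ball hball) (by
        intro z hz
        have hz' := hball (Metric.sphere_subset_closedBall hz)
        rw [mem_sphere_iff_norm] at hz
        have h3 : R ≤ ‖z‖ := by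
          have h4 := norm_sub_norm_le (s : ℂ) z
          rw [norm_sub_rev, hz, Complex.norm_real, Real.norm_eq_abs] at h4
          linarith
        have h5 := hR ‖z‖ h3 z rfl hz'
        rw [dist_zero_right] at h5
        exact h5.le)
    rw [deriv_sub_const] at h2
    rw [dist_zero_right]
    refine h2.trans_lt ?_
    rw [div_lt_iff₀ (by positivity)]
    have : 0 < ε * (η / 2) := by positivity
    linarith

/-- A locally integrable function that is `1 + O(|s| ^ (-β))` with `β > 1/2`. -/
lemma NearOne.vanishingDensity {β : ℝ} {f : ℝ → ℂ} (hβ : 1 / 2 < β) (hf : NearOne β f)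
    (hm : Measurable f) (hloc : LocallyIntegrable f) : VanishingDensity fun s => f s - 1 := by
  have hmem : ∀ {P : ℝ → Prop}, (∀ᶠ s in Bornology.cobounded ℝ, P s) → ∃ R, ∀ s, R < |s| → P s := by
    intro P hP
    rw [← comap_norm_atTop, eventually_comap] at hP
    obtain ⟨R, hR⟩ := eventually_atTop.1 hP
    exact ⟨R, fun s hs => hR |s| hs.le s rfl⟩
  refine ⟨hm.sub_const 1, fun R => ?_, ?_, fun ε hε => ?_⟩
  · exact (hloc.integrableOn_isCompact isCompact_Icc).sub
      (integrableOn_const (by exact isCompact_Icc.measure_lt_top.ne))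
  · obtain ⟨C, hC⟩ := hf.isBigO.bound
    obtain ⟨R, hR⟩ := hmem hC
    refine ⟨max R 1, ?_⟩
    have hint : Integrable fun s : ℝ => C ^ 2 * 2 ^ (2 * β) * (1 + ‖s‖) ^ (-(2 * β)) :=
      (integrable_one_add_norm (by simp; linarith)).const_mul _
    refine hint.integrableOn.mono' ((hm.sub_const 1).norm.pow_const 2).aestronglyMeasurable ?_
    rw [ae_restrict_iff' (VanishingDensity.measurableSet_lt_abs _)]
    refine Eventually.of_forall fun s hs => ?_
    have hs1 : R < |s| := (le_max_left _ _).trans_lt hs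
    have hs2 : 1 < |s| := (le_max_right _ _).trans_lt hs
    have h1 := hR s hs1
    have hs0 : 0 < |s| := by linarith
    rw [Real.norm_of_nonneg (by positivity : 0 ≤ |s| ^ (-β))] at h1
    rw [Real.norm_of_nonneg (by positivity), Real.norm_eq_abs]
    calc ‖f s - 1‖ ^ 2 ≤ (C * |s| ^ (-β)) ^ 2 := by gcongr
      _ = C ^ 2 * |s| ^ (-(2 * β)) := by
        rw [mul_pow, ← Real.rpow_natCast (|s| ^ (-β)) 2, ← Real.rpow_mul hs0.le]
        push_cast
        ring_nf
      _ ≤ C ^ 2 * ((1 + |s|) / 2) ^ (-(2 * β)) := by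
        gcongr ?_ * ?_
        exact Real.rpow_le_rpow_of_nonpos (by linarith) (by linarith) (by linarith)
      _ = C ^ 2 * 2 ^ (2 * β) * (1 + |s|) ^ (-(2 * β)) := by
        rw [Real.div_rpow (by positivity) (by norm_num), Real.rpow_neg (by norm_num : (0:ℝ) ≤ 2),
          div_inv_eq_mul]
        ring
  · have h1 := Metric.tendsto_nhds.1 (hf.tendsto (by linarith)) ε hε
    have h2 := Metric.tendsto_nhds.1 hf.tendsto_deriv ε hε
    obtain ⟨R, hR⟩ := hmem (h1.and (h2.and hf.differentiableAt))
    refine ⟨R + 1, fun c hc => ⟨?_, fun s hs => ?_⟩⟩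
    · have := (hR c (by linarith)).1
      rw [dist_eq_norm] at this
      exact this.le
    · have hI : ∀ x ∈ Set.Icc (c - 1) (c + 1), R < |x| := by
        intro x hx
        have e1 : |x - c| ≤ 1 := abs_le.2 ⟨by linarith [hx.1], by linarith [hx.2]⟩
        have e2 := abs_sub_abs_le_abs_sub c x
        rw [abs_sub_comm] at e2
        linarith
      have hmv := (convex_Icc (c - 1) (c + 1)).norm_image_sub_le_of_norm_deriv_le
        (f := f) (C := ε) (fun x h => (hR x (hI x h)).2.2) (fun x h => by
          have := (hR x (hI x h)).2.1
          rw [dist_zero_right] at this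
          exact this.le)
        (⟨by linarith, by linarith⟩ : c ∈ Set.Icc (c - 1) (c + 1)) hs
      rwa [sub_sub_sub_cancel_right]

/-! ### The full symbol -/

section Symbol

variable {n : ℕ} {a : Fin n → ℝ} {ν νbar : Fin n → ℂ} {F : ℂ → ℂ} {U : Set ℂ} {η : ℝ}

lemma measurable_symbol (hη : 0 < η) (hstrip : ∀ z : ℂ, |z.im| < η → z ∈ U)
    (hF : DifferentiableOn ℂ F U) : Measurable (symbol a ν νbar F) := by
  have h1 : Continuous fun s : ℝ => F s :=
    hF.continuousOn.comp_continuous Complex.continuous_ofReal fun s => hstrip _ (by simpa using hη)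
  refine h1.measurable.mul (Finset.measurable_fun_prod _ fun k _ => ?_)
  exact (measurable_pureSymbol _ _).comp (measurable_id.sub_const _)

/-- The symbol without its factors for `k ∉ S`, away from the singularities `a k`, `k ∈ S`. -/
lemma lipschitzNear_partial (hU : IsOpen U) (hη : 0 < η) (hstrip : ∀ z : ℂ, |z.im| < η → z ∈ U)
    (hF : DifferentiableOn ℂ F U) (S : Finset (Fin n)) {t : ℝ} (ht : ∀ k ∈ S, t ≠ a k) :
    LipschitzNear (fun s => F s * ∏ k ∈ S, pureSymbol (ν k) (νbar k) (s - a k)) t := by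
  have h1 : AnalyticAt ℂ (fun z => F z * ∏ k ∈ S, pureSymbolExt (ν k) (νbar k) (z - a k)) t := by
    refine (hF.analyticAt (hU.mem_nhds (hstrip _ (by simpa using hη)))).mul
      (Finset.analyticAt_fun_prod _ fun k hk => ?_)
    have h2 : AnalyticAt ℂ (fun z : ℂ => z - a k) t := analyticAt_id.sub analyticAt_const
    refine AnalyticAt.fun_comp ?_ h2
    rw [← Complex.ofReal_sub]
    exact analyticAt_pureSymbolExt _ _ (sub_ne_zero.2 (ht k hk))
  have h3 := h1.lipschitzNear_ofReal
  simpa only [pureSymbol_eq_ext, Complex.ofReal_sub] using h3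

lemma lipschitzNear_symbol (hU : IsOpen U) (hη : 0 < η) (hstrip : ∀ z : ℂ, |z.im| < η → z ∈ U)
    (hF : DifferentiableOn ℂ F U) {t : ℝ} (ht : ∀ k, t ≠ a k) :
    LipschitzNear (symbol a ν νbar F) t :=
  lipschitzNear_partial hU hη hstrip hF Finset.univ fun k _ => ht k

lemma symbol_eq_mul (k : Fin n) : symbol a ν νbar F = fun s => pureSymbol (ν k) (νbar k) (s - a k) *
    (F s * ∏ j ∈ Finset.univ.erase k, pureSymbol (ν j) (νbar j) (s - a j)) := by
  ext s
  rw [symbol, ← Finset.mul_prod_erase _ _ (Finset.mem_univ k)]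
  ring

lemma mildSingularity_symbol (ha : StrictMono a) (hU : IsOpen U) (hη : 0 < η)
    (hstrip : ∀ z : ℂ, |z.im| < η → z ∈ U) (hF : DifferentiableOn ℂ F U)
    (hγ : ∀ k, ((ν k + νbar k) / 2).re < 1 / 2) (k : Fin n) :
    MildSingularity (fun s => symbol a ν νbar F s - 1) (a k) := by
  rw [symbol_eq_mul k]
  refine MildSingularity.sub_one (((mildSingularity_pureSymbol (hγ k)).comp_sub (a k)
    ).mul_lipschitzNear (lipschitzNear_partial hU hη hstrip hF _ fun j hj => ?_))
  exact fun h => (Finset.ne_of_mem_erase hj) (ha.injective h.symm)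

lemma vanishingDensity_symbol {κ : ℝ} (ha : StrictMono a) (hU : IsOpen U) (hη : 0 < η)
    (hstrip : ∀ z : ℂ, |z.im| < η → z ∈ U) (hF : DifferentiableOn ℂ F U) (hκ : 0 < κ)
    (hFinf : (fun z => F z - 1) =O[Bornology.cobounded ℂ ⊓ 𝓟 U]
      fun z => ‖z‖ ^ (-((1 + κ) / 2)))
    (hγ : ∀ k, ((ν k + νbar k) / 2).re < 1 / 2) :
    VanishingDensity fun s => symbol a ν νbar F s - 1 := by
  have hβ : 1 / 2 < min ((1 + κ) / 2) 1 := lt_min (by linarith) (by norm_num)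
  have hβ0 : 0 < min ((1 + κ) / 2) 1 := by linarith
  refine NearOne.vanishingDensity hβ ?_ (measurable_symbol hη hstrip hF) ?_
  · exact (nearOne_ofReal hU hη hstrip hF hβ0 (min_le_left _ _) hFinf).mul hβ0
      (NearOne.prod hβ0 _ fun k => nearOne_pureSymbol _ _ _ hβ0 (min_le_right _ _))
  · intro t
    by_cases ht : ∃ k, t = a k
    · obtain ⟨k, rfl⟩ := ht
      rw [symbol_eq_mul k]
      refine integrableAtFilter_pureSymbol_mul (hγ k)
        (lipschitzNear_partial hU hη hstrip hF _ fun j hj => ?_) ?_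
      · exact fun h => (Finset.ne_of_mem_erase hj) (ha.injective h.symm)
      · have h1 : Continuous fun s : ℝ => F s :=
          hF.continuousOn.comp_continuous Complex.continuous_ofReal
            fun s => hstrip _ (by simpa using hη)
        refine h1.measurable.mul (Finset.measurable_fun_prod _ fun k _ => ?_)
        exact (measurable_pureSymbol _ _).comp (measurable_id.sub_const _)
    · exact (lipschitzNear_symbol hU hη hstrip hF fun k h => ht ⟨k, h⟩).integrableAtFilter
        (measurable_symbol hη hstrip hF)

end Symbol

/-! ### Parseval's identity for the kernel -/

/-- The pairing of an element of `L²` with a square integrable function as an inner product. -/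
lemma integral_mul_eq_inner {α : Type*} [MeasurableSpace α] {μ : Measure α} {g : α → ℂ}
    (hg : MemLp g 2 μ) (f : Lp ℂ 2 μ) :
    ∫ v, f v * g v ∂μ = inner ℂ (hg.star.toLp (star g)) f := by
  rw [L2.inner_def]
  refine integral_congr_ae ?_
  filter_upwards [hg.star.coeFn_toLp] with v hv
  rw [RCLike.inner_apply, hv]
  simp

/-- The multiplication formula `∫ 𝓕f g = ∫ f 𝓕g` with the Plancherel transform of `f ∈ L²`. -/
lemma integral_fourier_mul_eq {g : ℝ → ℂ} (hg : Integrable g) (hg2 : MemLp g 2)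
    (hFg : MemLp (𝓕 g) 2) (f : Lp ℂ 2 (volume : Measure ℝ)) :
    ∫ v, (𝓕 f : Lp ℂ 2 (volume : Measure ℝ)) v * g v = ∫ v, f v * 𝓕 g v := by
  have hdense := SchwartzMap.denseRange_toLpCLM (E := ℝ) (F := ℂ) (p := 2)
    (μ := (volume : Measure ℝ)) (by norm_num)
  refine DenseRange.induction_on (p := fun f : Lp ℂ 2 (volume : Measure ℝ) =>
    ∫ v, (𝓕 f : Lp ℂ 2 (volume : Measure ℝ)) v * g v = ∫ v, f v * 𝓕 g v) hdense f ?_ ?_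
  · simp_rw [integral_mul_eq_inner hg2, integral_mul_eq_inner hFg]
    refine isClosed_eq (continuous_const.inner ?_) (continuous_const.inner continuous_id)
    exact (Lp.fourierTransformₗᵢ ℝ ℂ).continuous
  · intro φ
    rw [SchwartzMap.toLpCLM_apply, SchwartzMap.toLp_fourier_eq]
    have h1 : ∫ v, ((𝓕 φ).toLp 2 : Lp ℂ 2 (volume : Measure ℝ)) v * g v =
        ∫ v, 𝓕 (φ : ℝ → ℂ) v * g v := by
      refine integral_congr_ae ?_
      filter_upwards [(𝓕 φ).coeFn_toLp 2 (volume : Measure ℝ)] with v hv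
      rw [hv, SchwartzMap.fourier_coe]
    have h2 : ∫ v, (φ.toLp 2 : Lp ℂ 2 (volume : Measure ℝ)) v * 𝓕 g v = ∫ v, φ v * 𝓕 g v := by
      refine integral_congr_ae ?_
      filter_upwards [φ.coeFn_toLp 2 (volume : Measure ℝ)] with v hv
      rw [hv]
    rw [h1, h2]
    have h3 := VectorFourier.integral_fourierIntegral_smul_eq_flip (μ := volume) (ν := volume)
      (L := innerₗ ℝ) (e := Real.fourierChar) (f := (φ : ℝ → ℂ)) (g := g)
      Real.continuous_fourierChar continuous_inner φ.integrable hg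
    rw [flip_innerₗ] at h3
    simp only [smul_eq_mul] at h3
    exact h3

/-- The Fourier integral `∫ f(ξ) e^{-itξ} dξ`. -/
noncomputable def expTransform (f : ℝ → ℂ) (t : ℝ) : ℂ :=
  ∫ ξ : ℝ, f ξ * Complex.exp (-(Complex.I * t * ξ))

lemma norm_exp_neg_I_mul_mul (t ξ : ℝ) : ‖Complex.exp (-(Complex.I * t * ξ))‖ = 1 := by
  rw [Complex.norm_exp]
  simp

lemma fourier_eq_expTransform (f : ℝ → ℂ) (v : ℝ) : 𝓕 f v = expTransform f (2 * Real.pi * v) := by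
  rw [Real.fourier_real_eq_integral_exp_smul, expTransform]
  refine integral_congr_ae (Eventually.of_forall fun ξ => ?_)
  simp only [smul_eq_mul]
  rw [mul_comm]
  congr 2
  push_cast
  ring

section expTransform

variable {f : ℝ → ℂ}

lemma Integrable.mul_exp (hf : Integrable f) (t : ℝ) :
    Integrable fun ξ : ℝ => f ξ * Complex.exp (-(Complex.I * t * ξ)) :=
  hf.mul_bdd (c := 1) (by fun_prop)
    (Eventually.of_forall fun ξ => (norm_exp_neg_I_mul_mul t ξ).le)

lemma norm_expTransform_le (hf : Integrable f) (t : ℝ) :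
    ‖expTransform f t‖ ≤ ∫ ξ, ‖f ξ‖ := by
  refine norm_integral_le_of_norm_le hf.norm (Eventually.of_forall fun ξ => ?_)
  rw [norm_mul, norm_exp_neg_I_mul_mul, mul_one]

lemma continuous_expTransform (hf : Integrable f) : Continuous (expTransform f) := by
  refine continuous_of_dominated (bound := fun ξ => ‖f ξ‖) (fun t => ?_) (fun t => ?_) hf.norm ?_
  · exact (Integrable.mul_exp hf t).aestronglyMeasurable
  · refine Eventually.of_forall fun ξ => ?_
    rw [norm_mul, norm_exp_neg_I_mul_mul, mul_one]
  · exact Eventually.of_forall fun ξ => by fun_prop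

lemma integral_expTransform_mul {w : ℝ → ℂ} (hf : Integrable f) (hw : Integrable w) :
    ∫ t, expTransform f t * w t = ∫ ξ, f ξ * expTransform w ξ := by
  have h1 : Integrable (fun p : ℝ × ℝ => w p.1 * f p.2 * Complex.exp (-(Complex.I * p.1 * p.2)))
      (volume.prod volume) :=
    (hw.mul_prod hf).mul_bdd (c := 1) (by fun_prop)
      (Eventually.of_forall fun p => (norm_exp_neg_I_mul_mul p.1 p.2).le)
  calc ∫ t, expTransform f t * w t
      = ∫ t, ∫ ξ, w t * f ξ * Complex.exp (-(Complex.I * t * ξ)) := by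
        refine integral_congr_ae (Eventually.of_forall fun t => ?_)
        simp only [expTransform]
        rw [← integral_mul_const]
        refine integral_congr_ae (Eventually.of_forall fun ξ => ?_)
        ring
    _ = ∫ ξ, ∫ t, w t * f ξ * Complex.exp (-(Complex.I * t * ξ)) := integral_integral_swap h1
    _ = _ := by
        refine integral_congr_ae (Eventually.of_forall fun ξ => ?_)
        simp only [expTransform]
        rw [← integral_const_mul]
        refine integral_congr_ae (Eventually.of_forall fun t => ?_)
        simp only
        rw [mul_right_comm (Complex.I)]
        ring

end expTransform

namespace VanishingDensity

variable {h : ℝ → ℂ}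

lemma measurableSet_large (hh : VanishingDensity h) : MeasurableSet {ξ : ℝ | 1 < ‖h ξ‖} :=
  measurableSet_lt measurable_const hh.measurable.norm

lemma measurableSet_small (hh : VanishingDensity h) : MeasurableSet {ξ : ℝ | ‖h ξ‖ ≤ 1} :=
  measurableSet_le hh.measurable.norm measurable_const

lemma integrable_large (hh : VanishingDensity h) :
    Integrable (Set.indicator {ξ : ℝ | 1 < ‖h ξ‖} h) := by
  obtain ⟨R, hR⟩ := hh.small 1 one_pos
  rw [integrable_indicator_iff hh.measurableSet_large]
  refine (hh.integrableOn R).mono_set fun s hs => abs_le.1 ?_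
  by_contra h1
  exact absurd (hR s (not_le.1 h1)).1 (not_le.2 hs)

lemma memLp_small (hh : VanishingDensity h) :
    MemLp (Set.indicator {ξ : ℝ | ‖h ξ‖ ≤ 1} h) 2 (volume : Measure ℝ) := by
  have hm := hh.measurable.indicator hh.measurableSet_small
  rw [memLp_two_iff_integrable_sq_norm hm.aestronglyMeasurable]
  obtain ⟨R, hR⟩ := hh.sq_integrableOn
  have hle1 : ∀ s, ‖Set.indicator {ξ : ℝ | ‖h ξ‖ ≤ 1} h s‖ ≤ 1 := by
    intro s
    by_cases hs : ‖h s‖ ≤ 1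
    · rwa [Set.indicator_of_mem (s := {ξ : ℝ | ‖h ξ‖ ≤ 1}) hs]
    · rw [Set.indicator_of_notMem (s := {ξ : ℝ | ‖h ξ‖ ≤ 1}) hs]
      simp
  have h1 : IntegrableOn (fun s => ‖Set.indicator {ξ : ℝ | ‖h ξ‖ ≤ 1} h s‖ ^ 2)
      (Set.Icc (-R) R) := by
    refine Measure.integrableOn_of_bounded (M := 1) isCompact_Icc.measure_lt_top.ne
      (hm.norm.pow_const 2).aestronglyMeasurable (Eventually.of_forall fun s => ?_)
    rw [Real.norm_of_nonneg (by positivity)]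
    exact pow_le_one₀ (norm_nonneg _) (hle1 s)
  have h2 : IntegrableOn (fun s => ‖Set.indicator {ξ : ℝ | ‖h ξ‖ ≤ 1} h s‖ ^ 2)
      {s : ℝ | R < |s|} := by
    refine hR.mono' (hm.norm.pow_const 2).aestronglyMeasurable (Eventually.of_forall fun s => ?_)
    rw [Real.norm_of_nonneg (by positivity)]
    gcongr
    exact norm_indicator_le_norm_self h s
  rw [← integrableOn_univ]
  refine (h1.union h2).mono_set fun s _ => ?_
  by_cases hs : R < |s|
  · exact Or.inr hs
  · exact Or.inl (abs_le.1 (not_lt.1 hs))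

/-- The Plancherel transform of the part of the density of modulus at most `1`. -/
noncomputable def smallTransform (hh : VanishingDensity h) : Lp ℂ 2 (volume : Measure ℝ) :=
  𝓕 (hh.memLp_small.toLp _)

lemma invFourier_eq (hh : VanishingDensity h) (t : ℝ) :
    invFourier h t = (1 / (2 * (Real.pi : ℂ))) *
      (expTransform (Set.indicator {ξ : ℝ | 1 < ‖h ξ‖} h) t
        + hh.smallTransform (t / (2 * Real.pi))) := by
  rw [invFourier, dif_pos hh.memLp_small]
  rfl

lemma measurable_invFourier (hh : VanishingDensity h) : Measurable (invFourier h) := by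
  rw [funext hh.invFourier_eq]
  refine measurable_const.mul ((continuous_expTransform hh.integrable_large).measurable.add ?_)
  exact (Lp.stronglyMeasurable hh.smallTransform).measurable.comp (measurable_id.div_const _)

lemma memLp_smallTransform_comp (hh : VanishingDensity h) :
    MemLp (fun t : ℝ => hh.smallTransform (t / (2 * Real.pi))) 2 (volume : Measure ℝ) := by
  have hm : Measurable fun t : ℝ => hh.smallTransform (t / (2 * Real.pi)) :=
    (Lp.stronglyMeasurable hh.smallTransform).measurable.comp (measurable_id.div_const _)
  rw [memLp_two_iff_integrable_sq_norm hm.aestronglyMeasurable]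
  have h1 := (memLp_two_iff_integrable_sq_norm
    (Lp.aestronglyMeasurable hh.smallTransform)).1 (Lp.memLp hh.smallTransform)
  have h2 := h1.comp_mul_left' (R := (2 * Real.pi)⁻¹) (by positivity)
  refine h2.congr (Eventually.of_forall fun t => ?_)
  simp only
  rw [inv_mul_eq_div]

lemma memLp_invFourier (hh : VanishingDensity h) {S : Set ℝ} (hS : volume S ≠ ⊤) :
    MemLp (invFourier h) 2 (volume.restrict S) := by
  rw [funext hh.invFourier_eq]
  have : IsFiniteMeasure (volume.restrict S) := ⟨by simpa using lt_top_iff_ne_top.2 hS⟩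
  have h1 : MemLp (expTransform (Set.indicator {ξ : ℝ | 1 < ‖h ξ‖} h)) 2 (volume.restrict S) :=
    MemLp.of_bound (continuous_expTransform hh.integrable_large).aestronglyMeasurable _
      (Eventually.of_forall fun t => norm_expTransform_le hh.integrable_large t)
  have h2 : MemLp (fun t : ℝ => hh.smallTransform (t / (2 * Real.pi))) 2 (volume.restrict S) :=
    hh.memLp_smallTransform_comp.restrict S
  exact (h1.add h2).const_mul _

/-- Parseval's identity for the inverse Fourier transform on `L¹ + L²`. -/
lemma integral_invFourier_mul (hh : VanishingDensity h) {w : ℝ → ℂ} (hw : Integrable w)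
    (hw2 : MemLp w 2) (hwt : MemLp (expTransform w) 2) :
    ∫ t, invFourier h t * w t = (1 / (2 * (Real.pi : ℂ))) * ∫ ξ, h ξ * expTransform w ξ := by
  have hπ : (0 : ℝ) < 2 * Real.pi := by positivity
  set h₁ := Set.indicator {ξ : ℝ | 1 < ‖h ξ‖} h with hh₁
  set h₂ := Set.indicator {ξ : ℝ | ‖h ξ‖ ≤ 1} h with hh₂
  have hsum : ∀ ξ, h₁ ξ + h₂ ξ = h ξ := by
    intro ξ
    by_cases hξ : ‖h ξ‖ ≤ 1
    · rw [hh₁, hh₂, Set.indicator_of_notMem (s := {ξ : ℝ | 1 < ‖h ξ‖}) (not_lt.2 hξ),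
        Set.indicator_of_mem (s := {ξ : ℝ | ‖h ξ‖ ≤ 1}) hξ, zero_add]
    · rw [hh₁, hh₂, Set.indicator_of_mem (s := {ξ : ℝ | 1 < ‖h ξ‖}) (not_le.1 hξ),
        Set.indicator_of_notMem (s := {ξ : ℝ | ‖h ξ‖ ≤ 1}) hξ, add_zero]
  have i1 : Integrable fun t => expTransform h₁ t * w t :=
    hw.bdd_mul (continuous_expTransform hh.integrable_large).aestronglyMeasurable
      (Eventually.of_forall fun t => norm_expTransform_le hh.integrable_large t)
  have i2 : Integrable fun t : ℝ => hh.smallTransform (t / (2 * Real.pi)) * w t :=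
    hh.memLp_smallTransform_comp.integrable_mul hw2
  have i3 : Integrable fun ξ => h₁ ξ * expTransform w ξ :=
    hh.integrable_large.mul_bdd (continuous_expTransform hw).aestronglyMeasurable
      (Eventually.of_forall fun t => norm_expTransform_le hw t)
  have i4 : Integrable fun ξ => h₂ ξ * expTransform w ξ := hh.memLp_small.integrable_mul hwt
  -- Rescaling to the normalization of the Plancherel transform.
  set g : ℝ → ℂ := fun v => w (2 * Real.pi * v) with hg
  have hgi : Integrable g := hw.comp_mul_left' hπ.ne'
  have hscale : ∀ ξ : ℝ, expTransform w ξ = (2 * Real.pi : ℂ) * 𝓕 g ξ := by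
    intro ξ
    rw [fourier_eq_expTransform, expTransform, expTransform]
    have := Measure.integral_comp_mul_left (fun t : ℝ => w t * Complex.exp (-(Complex.I * ξ * t)))
      (2 * Real.pi)
    rw [abs_of_pos (by positivity)] at this
    have h1 : ∫ v : ℝ, g v * Complex.exp (-(Complex.I * ((2 * Real.pi * ξ : ℝ) : ℂ) * v))
        = ∫ v : ℝ, w (2 * Real.pi * v) *
          Complex.exp (-(Complex.I * ξ * ((2 * Real.pi * v : ℝ) : ℂ))) := by
      refine integral_congr_ae (Eventually.of_forall fun v => ?_)
      simp only [hg]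
      congr 2
      push_cast
      ring
    rw [h1, this, Complex.real_smul]
    push_cast
    have : (Real.pi : ℂ) ≠ 0 := by exact_mod_cast Real.pi_ne_zero
    field_simp
  have hFg : 𝓕 g = fun ξ => (2 * Real.pi : ℂ)⁻¹ * expTransform w ξ := by
    ext ξ
    have : (2 * Real.pi : ℂ) ≠ 0 := by exact_mod_cast hπ.ne'
    rw [hscale ξ, inv_mul_cancel_left₀ this]
  have hg2 : MemLp g 2 := by
    have hm : AEStronglyMeasurable g volume := hgi.aestronglyMeasurable
    rw [memLp_two_iff_integrable_sq_norm hm]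
    exact ((memLp_two_iff_integrable_sq_norm hw.aestronglyMeasurable).1 hw2).comp_mul_left' hπ.ne'
  have e2 : ∫ t : ℝ, hh.smallTransform (t / (2 * Real.pi)) * w t
      = ∫ ξ, h₂ ξ * expTransform w ξ := by
    have h1 := Measure.integral_comp_mul_left
      (fun t : ℝ => hh.smallTransform (t / (2 * Real.pi)) * w t) (2 * Real.pi)
    rw [abs_of_pos (by positivity)] at h1
    have h2 : ∫ v, hh.smallTransform v * g v = (2 * Real.pi)⁻¹ •
        ∫ t : ℝ, hh.smallTransform (t / (2 * Real.pi)) * w t := by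
      rw [← h1]
      refine integral_congr_ae (Eventually.of_forall fun v => ?_)
      simp only [hg]
      rw [mul_div_cancel_left₀ v hπ.ne']
    have h3 := integral_fourier_mul_eq hgi hg2 (by rw [hFg]; exact hwt.const_mul _)
      (hh.memLp_small.toLp _)
    have h4 : ∫ v, (hh.memLp_small.toLp _ : Lp ℂ 2 (volume : Measure ℝ)) v * 𝓕 g v
        = (2 * Real.pi : ℂ)⁻¹ * ∫ ξ, h₂ ξ * expTransform w ξ := by
      rw [← integral_const_mul]
      refine integral_congr_ae ?_
      filter_upwards [hh.memLp_small.coeFn_toLp] with v hv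
      rw [hv, hFg]
      ring
    have h5 : ∫ v, hh.smallTransform v * g v = (2 * Real.pi : ℂ)⁻¹ * ∫ ξ, h₂ ξ * expTransform w ξ :=
      h3.trans h4
    rw [h2, Complex.real_smul] at h5
    have : (2 * Real.pi : ℂ)⁻¹ ≠ 0 := inv_ne_zero (by exact_mod_cast hπ.ne')
    push_cast at h5
    exact mul_left_cancel₀ this h5
  calc ∫ t, invFourier h t * w t
      = (1 / (2 * (Real.pi : ℂ))) * ∫ t, (expTransform h₁ t * w t
          + hh.smallTransform (t / (2 * Real.pi)) * w t) := by
        rw [← integral_const_mul]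
        refine integral_congr_ae (Eventually.of_forall fun t => ?_)
        simp only
        rw [hh.invFourier_eq]
        ring
    _ = (1 / (2 * (Real.pi : ℂ))) * ∫ ξ, (h₁ ξ * expTransform w ξ + h₂ ξ * expTransform w ξ) := by
        rw [integral_add i1 i2, integral_add i3 i4, e2,
          integral_expTransform_mul hh.integrable_large hw]
    _ = _ := by
        congr 1
        refine integral_congr_ae (Eventually.of_forall fun ξ => ?_)
        simp only
        rw [← add_mul, hsum]

end VanishingDensity

/-! ### Convolution operators on an interval -/

/-- The bounded operator `A` on `L²([0, x])` is the convolution with `k`, restricted to `[0, x]`. -/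
def IsConvolution (x : ℝ) (k : ℝ → ℂ) (A : Lp ℂ 2 (volume.restrict (Set.Icc (0 : ℝ) x)) →L[ℂ]
    Lp ℂ 2 (volume.restrict (Set.Icc (0 : ℝ) x))) : Prop :=
  ∀ g, (A g : ℝ → ℂ) =ᵐ[volume.restrict (Set.Icc (0 : ℝ) x)]
    fun t => ∫ s in Set.Icc (0 : ℝ) x, k (t - s) * g s

section Convolution

variable {x : ℝ} {k p : ℝ → ℂ}

/-- The translates `s ↦ k (t - s)`, `t ∈ [0, x]`, on `[0, x]` only see `k` on `[-x, x]`. -/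
lemma eLpNorm_comp_sub_left_le (hk : Measurable k) {t : ℝ} (ht : t ∈ Set.Icc 0 x) :
    eLpNorm (fun s => k (t - s)) 2 (volume.restrict (Set.Icc 0 x)) ≤
      eLpNorm k 2 (volume.restrict (Set.Icc (-x) x)) := by
  have hmp := (Measure.measurePreserving_sub_left (volume : Measure ℝ) t).restrict_preimage
    (measurableSet_Icc (a := t - x) (b := t))
  have hpre : (fun s : ℝ => t - s) ⁻¹' Set.Icc (t - x) t = Set.Icc 0 x := by
    ext s
    simp only [Set.mem_preimage, Set.mem_Icc]
    constructor <;> rintro ⟨h1, h2⟩ <;> constructor <;> linarith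
  rw [hpre] at hmp
  have := eLpNorm_comp_measurePreserving (p := 2) hk.aestronglyMeasurable hmp
  change eLpNorm (k ∘ fun s => t - s) 2 _ ≤ _
  rw [this]
  refine eLpNorm_mono_measure _ (Measure.restrict_mono (Set.Icc_subset_Icc ?_ ?_) le_rfl)
  · linarith [ht.1]
  · exact ht.2

lemma memLp_comp_sub_left (hk : Measurable k) (hk2 : MemLp k 2 (volume.restrict (Set.Icc (-x) x)))
    {t : ℝ} (ht : t ∈ Set.Icc 0 x) :
    MemLp (fun s => k (t - s)) 2 (volume.restrict (Set.Icc 0 x)) :=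
  ⟨(hk.comp (measurable_const.sub measurable_id)).aestronglyMeasurable,
    (eLpNorm_comp_sub_left_le hk ht).trans_lt hk2.2⟩

lemma integrable_convolution (hk : Measurable k)
    (hk2 : MemLp k 2 (volume.restrict (Set.Icc (-x) x))) {t : ℝ} (ht : t ∈ Set.Icc 0 x)
    (g : Lp ℂ 2 (volume.restrict (Set.Icc (0 : ℝ) x))) :
    IntegrableOn (fun s => k (t - s) * g s) (Set.Icc 0 x) :=
  (memLp_comp_sub_left hk hk2 ht).integrable_mul (Lp.memLp g)

lemma norm_convolution_le (hk : Measurable k)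
    (hk2 : MemLp k 2 (volume.restrict (Set.Icc (-x) x))) {t : ℝ} (ht : t ∈ Set.Icc 0 x)
    (g : Lp ℂ 2 (volume.restrict (Set.Icc (0 : ℝ) x))) :
    ‖∫ s in Set.Icc (0 : ℝ) x, k (t - s) * g s‖ ≤
      (eLpNorm k 2 (volume.restrict (Set.Icc (-x) x))).toReal * ‖g‖ := by
  have hm := memLp_comp_sub_left hk hk2 ht
  have h1 : ∫ s in Set.Icc (0 : ℝ) x, k (t - s) * g s
      = inner ℂ (hm.star.toLp (star fun s => k (t - s))) g := by
    rw [← integral_mul_eq_inner hm]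
    simp_rw [mul_comm]
  rw [h1]
  refine (norm_inner_le_norm _ _).trans ?_
  gcongr
  rw [Lp.norm_toLp, eLpNorm_star]
  exact ENNReal.toReal_mono hk2.2.ne (eLpNorm_comp_sub_left_le hk ht)

lemma stronglyMeasurable_convolution (hk : Measurable k)
    (g : Lp ℂ 2 (volume.restrict (Set.Icc (0 : ℝ) x))) :
    StronglyMeasurable fun t => ∫ s in Set.Icc (0 : ℝ) x, k (t - s) * g s := by
  refine StronglyMeasurable.integral_prod_right (f := fun t s => k (t - s) * g s) ?_
  refine Measurable.stronglyMeasurable ?_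
  exact (hk.comp (measurable_fst.sub measurable_snd)).mul
    ((Lp.stronglyMeasurable g).measurable.comp measurable_snd)

lemma exists_isConvolution (hk : Measurable k)
    (hk2 : MemLp k 2 (volume.restrict (Set.Icc (-x) x))) : ∃ A, IsConvolution x k A := by
  set μ : Measure ℝ := volume.restrict (Set.Icc (0 : ℝ) x) with hμ
  set C : ℝ := (eLpNorm k 2 (volume.restrict (Set.Icc (-x) x))).toReal with hC
  have hbound : ∀ g : Lp ℂ 2 μ, ∀ᵐ t ∂μ, ‖∫ s, k (t - s) * g s ∂μ‖ ≤ C * ‖g‖ := fun g =>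
    (ae_restrict_iff' measurableSet_Icc).2
      (Eventually.of_forall fun t ht => norm_convolution_le hk hk2 ht g)
  have hmem : ∀ g : Lp ℂ 2 μ, MemLp (fun t => ∫ s, k (t - s) * g s ∂μ) 2 μ := fun g =>
    MemLp.of_bound (stronglyMeasurable_convolution hk g).aestronglyMeasurable _ (hbound g)
  let T : Lp ℂ 2 μ →ₗ[ℂ] Lp ℂ 2 μ :=
    { toFun := fun g => (hmem g).toLp _
      map_add' := fun g g' => by
        refine Lp.ext ?_
        filter_upwards [(hmem (g + g')).coeFn_toLp, (hmem g).coeFn_toLp, (hmem g').coeFn_toLp,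
          Lp.coeFn_add ((hmem g).toLp _) ((hmem g').toLp _),
          ae_restrict_mem measurableSet_Icc] with t h1 h2 h3 h4 ht
        rw [h1, h4, Pi.add_apply, h2, h3, ← integral_add (integrable_convolution hk hk2 ht g)
          (integrable_convolution hk hk2 ht g')]
        refine integral_congr_ae ?_
        filter_upwards [Lp.coeFn_add g g'] with s hs
        rw [hs, Pi.add_apply, mul_add]
      map_smul' := fun c g => by
        refine Lp.ext ?_
        filter_upwards [(hmem (c • g)).coeFn_toLp, (hmem g).coeFn_toLp,
          Lp.coeFn_smul c ((hmem g).toLp _)] with t h1 h2 h3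
        rw [RingHom.id_apply, h1, h3, Pi.smul_apply, h2, smul_eq_mul, ← integral_const_mul]
        refine integral_congr_ae ?_
        filter_upwards [Lp.coeFn_smul c g] with s hs
        rw [hs, Pi.smul_apply, smul_eq_mul]
        ring }
  refine ⟨T.mkContinuous ((measureUnivNNReal μ : ℝ) ^ (2 : ENNReal).toReal⁻¹ * C) fun g => ?_,
    fun g => (hmem g).coeFn_toLp⟩
  rw [mul_assoc]
  refine Lp.norm_le_of_ae_bound (by positivity) ?_
  filter_upwards [(hmem g).coeFn_toLp, hbound g] with t h1 h2
  change ‖((hmem g).toLp _ : Lp ℂ 2 μ) t‖ ≤ _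
  rw [h1]
  exact h2

lemma IsConvolution.norm_le {A} (hA : IsConvolution x k A) (hk : Measurable k)
    (hk2 : MemLp k 2 (volume.restrict (Set.Icc (-x) x))) :
    ‖A‖ ≤ (measureUnivNNReal (volume.restrict (Set.Icc (0 : ℝ) x)) : ℝ) ^ (2 : ENNReal).toReal⁻¹ *
      (eLpNorm k 2 (volume.restrict (Set.Icc (-x) x))).toReal := by
  refine A.opNorm_le_bound (by positivity) fun g => ?_
  rw [mul_assoc]
  refine Lp.norm_le_of_ae_bound (by positivity) ?_
  filter_upwards [hA g, ae_restrict_mem measurableSet_Icc] with t h1 ht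
  rw [h1]
  exact norm_convolution_le hk hk2 ht g

lemma IsConvolution.sub {A B} (hA : IsConvolution x k A) (hB : IsConvolution x p B)
    (hk : Measurable k) (hk2 : MemLp k 2 (volume.restrict (Set.Icc (-x) x)))
    (hp : Measurable p) (hp2 : MemLp p 2 (volume.restrict (Set.Icc (-x) x))) :
    IsConvolution x (k - p) (A - B) := by
  intro g
  rw [sub_apply]
  filter_upwards [hA g, hB g, Lp.coeFn_sub (A g) (B g), ae_restrict_mem measurableSet_Icc]
    with t h1 h2 h3 ht
  rw [h3, Pi.sub_apply, h1, h2, ← integral_sub (integrable_convolution hk hk2 ht g)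
    (integrable_convolution hp hp2 ht g)]
  refine integral_congr_ae (Eventually.of_forall fun s => ?_)
  simp only [Pi.sub_apply]
  ring

lemma memLp_of_continuous {f : ℝ → ℂ} (hf : Continuous f) (a b : ℝ) :
    MemLp f 2 (volume.restrict (Set.Icc a b)) := by
  obtain ⟨C, hC⟩ := isCompact_Icc.exists_bound_of_continuousOn (s := Set.Icc a b) hf.continuousOn
  exact MemLp.of_bound hf.aestronglyMeasurable C
    ((ae_restrict_iff' measurableSet_Icc).2 (Eventually.of_forall hC))

/-- A separable kernel gives an operator of finite rank. -/
lemma exists_compact_isConvolution_of_separable {ι : Type*} (S : Finset ι) {e ψ : ι → ℝ → ℂ}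
    (he : ∀ i, Continuous (e i)) (hψ : ∀ i, Continuous (ψ i))
    (hp : ∀ t s, p (t - s) = ∑ i ∈ S, e i t * ψ i s) :
    ∃ A, IsConvolution x p A ∧ IsCompactOperator A := by
  have hem := fun i => memLp_of_continuous (he i) 0 x
  have hψm := fun i => memLp_of_continuous (hψ i) 0 x
  let R : ι → Lp ℂ 2 (volume.restrict (Set.Icc (0 : ℝ) x)) →L[ℂ]
      Lp ℂ 2 (volume.restrict (Set.Icc (0 : ℝ) x)) := fun i =>
    (ContinuousLinearMap.toSpanSingleton ℂ ((hem i).toLp (e i))).comp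
      (innerSL ℂ ((hψm i).star.toLp (star (ψ i))))
  refine ⟨∑ i ∈ S, R i, fun g => ?_, ?_⟩
  · have h1 : ∀ᵐ t ∂(volume.restrict (Set.Icc (0 : ℝ) x)), ∀ i ∈ S, (R i g : ℝ → ℂ) t
        = e i t * ∫ s in Set.Icc (0 : ℝ) x, ψ i s * g s := by
      refine (ae_ball_iff (S.countable_toSet)).2 fun i _ => ?_
      have h2 : R i g = (∫ s in Set.Icc (0 : ℝ) x, ψ i s * g s) • (hem i).toLp (e i) := by
        change inner ℂ ((hψm i).star.toLp (star (ψ i))) g • (hem i).toLp (e i) = _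
        rw [← integral_mul_eq_inner (hψm i)]
        simp_rw [mul_comm]
      rw [h2]
      filter_upwards [Lp.coeFn_smul (∫ s in Set.Icc (0 : ℝ) x, ψ i s * g s) ((hem i).toLp (e i)),
        (hem i).coeFn_toLp] with t h3 h4
      rw [h3, Pi.smul_apply, h4, smul_eq_mul, mul_comm]
    rw [sum_apply]
    filter_upwards [h1, Lp.coeFn_fun_finsetSum S (fun i => R i g)] with t h2 h3
    rw [h3, Finset.sum_congr rfl h2]
    simp_rw [← integral_const_mul]
    rw [← integral_finsetSum]
    · refine integral_congr_ae (Eventually.of_forall fun s => ?_)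
      simp only
      rw [hp, Finset.sum_mul]
      exact Finset.sum_congr rfl fun i _ => by ring
    · intro i _
      exact ((hψm i).integrable_mul (Lp.memLp g)).const_mul _
  · have h1 : (∑ i ∈ S, R i) ∈ compactOperator (RingHom.id ℂ)
        (Lp ℂ 2 (volume.restrict (Set.Icc (0 : ℝ) x)))
        (Lp ℂ 2 (volume.restrict (Set.Icc (0 : ℝ) x))) := by
      refine Submodule.sum_mem _ fun i _ => ?_
      have h2 := isCompactOperator_of_locallyCompactSpace_dom
        (innerSL ℂ ((hψm i).star.toLp (star (ψ i))))
      change IsCompactOperator (R i)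
      exact h2.clm_comp (ContinuousLinearMap.toSpanSingleton ℂ ((hem i).toLp (e i)))
    exact h1

lemma exists_compact_isConvolution_polynomial (x : ℝ) (Q : Polynomial ℂ) :
    ∃ A, IsConvolution x (fun u => Q.eval (u : ℂ)) A ∧ IsCompactOperator A := by
  refine exists_compact_isConvolution_of_separable
    ((Finset.range (Q.natDegree + 1)).sigma fun m => Finset.range (m + 1))
    (e := fun i t => (t : ℂ) ^ i.2)
    (ψ := fun i s => Q.coeff i.1 * (-(s : ℂ)) ^ (i.1 - i.2) * (i.1.choose i.2 : ℂ))
    (fun i => by fun_prop) (fun i => by fun_prop) fun t s => ?_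
  rw [Polynomial.eval_eq_sum_range, Finset.sum_sigma]
  refine Finset.sum_congr rfl fun m _ => ?_
  rw [Complex.ofReal_sub, sub_eq_add_neg, add_pow, Finset.mul_sum]
  exact Finset.sum_congr rfl fun j _ => by ring

/-- Square integrable functions on an interval are limits of polynomials. -/
lemma exists_polynomial_eLpNorm_sub_le {a b : ℝ} (hk2 : MemLp k 2 (volume.restrict (Set.Icc a b)))
    {ε : ℝ} (hε : 0 < ε) :
    ∃ Q : Polynomial ℂ, eLpNorm (k - fun u : ℝ => Q.eval (u : ℂ)) 2
      (volume.restrict (Set.Icc a b)) ≤ ENNReal.ofReal ε := by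
  set μ : Measure ℝ := volume.restrict (Set.Icc a b) with hμ
  obtain ⟨g, hg, -⟩ := hk2.exists_boundedContinuous_eLpNorm_sub_le (p := 2) (by norm_num)
    (ε := ENNReal.ofReal (ε / 2)) (by simpa using hε)
  set M : ℝ := (measureUnivNNReal μ : ℝ) ^ (2 : ENNReal).toReal⁻¹ with hM
  have hM0 : 0 ≤ M := by positivity
  set δ : ℝ := ε / (4 * (M + 1)) with hδ
  have hδ0 : 0 < δ := by positivity
  obtain ⟨P₁, h1⟩ := exists_polynomial_near_of_continuousOn a b (fun s => (g s).re)
    (by fun_prop) δ hδ0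
  obtain ⟨P₂, h2⟩ := exists_polynomial_near_of_continuousOn a b (fun s => (g s).im)
    (by fun_prop) δ hδ0
  set Q : Polynomial ℂ := P₁.map (algebraMap ℝ ℂ) + Polynomial.C Complex.I * P₂.map (algebraMap ℝ ℂ)
    with hQ
  have hQe : ∀ u : ℝ, Q.eval (u : ℂ) = (P₁.eval u : ℝ) + Complex.I * (P₂.eval u : ℝ) := by
    intro u
    have h3 : ∀ P : Polynomial ℝ, (P.map (algebraMap ℝ ℂ)).eval (u : ℂ) = ((P.eval u : ℝ) : ℂ) :=
      fun P => by
        rw [Polynomial.eval_map_algebraMap]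
        exact Polynomial.aeval_algebraMap_apply_eq_algebraMap_eval u P
    rw [hQ, Polynomial.eval_add, Polynomial.eval_mul, Polynomial.eval_C, h3, h3]
  have hclose : ∀ᵐ u ∂μ, ‖(fun u => g u - Q.eval (u : ℂ)) u‖ ≤ 2 * δ := by
    refine (ae_restrict_iff' measurableSet_Icc).2 (Eventually.of_forall fun u hu => ?_)
    refine (Complex.norm_le_abs_re_add_abs_im _).trans ?_
    have e1 := h1 u hu
    have e2 := h2 u hu
    rw [abs_sub_comm] at e1 e2
    simp only [hQe]
    simp
    linarith
  refine ⟨Q, ?_⟩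
  have hsum : k - (fun u : ℝ => Q.eval (u : ℂ)) = (k - g) + fun u => g u - Q.eval (u : ℂ) := by
    ext u
    simp
  have hm : AEStronglyMeasurable (fun u : ℝ => g u - Q.eval (u : ℂ)) μ := by
    refine Continuous.aestronglyMeasurable ?_
    exact g.continuous.sub (Q.continuous.comp Complex.continuous_ofReal)
  rw [hsum]
  refine (eLpNorm_add_le (hk2.1.sub g.continuous.aestronglyMeasurable) hm (by norm_num)).trans ?_
  have h5 : eLpNorm (fun u : ℝ => g u - Q.eval (u : ℂ)) 2 μ ≤ ENNReal.ofReal (ε / 2) := by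
    refine (eLpNorm_le_of_ae_bound hclose).trans ?_
    have h6 : μ Set.univ ^ (2 : ENNReal).toReal⁻¹ = ENNReal.ofReal M := by
      rw [hM, ← ENNReal.ofReal_rpow_of_nonneg (by positivity) (by positivity)]
      congr 1
      rw [ENNReal.ofReal_coe_nnreal, coe_measureUnivNNReal]
    rw [h6, ← ENNReal.ofReal_mul hM0]
    refine ENNReal.ofReal_le_ofReal ?_
    have h7 : M * (2 * δ) = ε / 2 * (M / (M + 1)) := by
      rw [hδ]
      field_simp
      ring
    rw [h7]
    have h8 : M / (M + 1) ≤ 1 := div_le_one_of_le₀ (by linarith) (by linarith)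
    nlinarith
  calc _ ≤ ENNReal.ofReal (ε / 2) + ENNReal.ofReal (ε / 2) := add_le_add hg h5
    _ = ENNReal.ofReal ε := by rw [← ENNReal.ofReal_add (by linarith) (by linarith)]; congr 1; ring

/-- A convolution operator with square integrable kernel is compact, as the limit in norm of the
finite rank operators with polynomial kernels. -/
lemma IsConvolution.isCompactOperator {A} (hA : IsConvolution x k A) (hk : Measurable k)
    (hk2 : MemLp k 2 (volume.restrict (Set.Icc (-x) x))) : IsCompactOperator A := by
  choose Q hQ using fun n : ℕ => exists_polynomial_eLpNorm_sub_le hk2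
    (ε := 1 / ((n : ℝ) + 1)) (by positivity)
  choose B hB hBc using fun n : ℕ => exists_compact_isConvolution_polynomial x (Q n)
  have hQc : ∀ n, Continuous fun u : ℝ => (Q n).eval (u : ℂ) := fun n =>
    (Q n).continuous.comp Complex.continuous_ofReal
  refine isCompactOperator_of_tendsto (F := B) (l := atTop) ?_ (Eventually.of_forall hBc)
  rw [tendsto_iff_norm_sub_tendsto_zero]
  set M : ℝ := (measureUnivNNReal (volume.restrict (Set.Icc (0 : ℝ) x)) : ℝ) ^
    (2 : ENNReal).toReal⁻¹ with hM
  have hlim : Tendsto (fun n : ℕ => M * (1 / ((n : ℝ) + 1))) atTop (𝓝 0) := by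
    simpa using tendsto_one_div_add_atTop_nhds_zero_nat.const_mul M
  refine squeeze_zero (fun _ => norm_nonneg _) (fun n => ?_) hlim
  have hpm := memLp_of_continuous (hQc n) (-x) x
  rw [norm_sub_rev]
  refine ((hA.sub (hB n) hk hk2 (hQc n).measurable hpm).norm_le (hk.sub (hQc n).measurable)
    (hk2.sub hpm)).trans ?_
  gcongr
  exact ENNReal.toReal_le_of_le_ofReal (by positivity) (hQ n)

lemma isConvolution_wienerHopf {σ : ℝ → ℂ} (hk : Measurable (invFourier fun ξ => σ ξ - 1))
    (hk2 : MemLp (invFourier fun ξ => σ ξ - 1) 2 (volume.restrict (Set.Icc (-x) x))) :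
    IsConvolution x (invFourier fun ξ => σ ξ - 1) (wienerHopf σ x) := by
  have h : ∃ A : Lp ℂ 2 (volume.restrict (Set.Icc (0 : ℝ) x)) →L[ℂ]
      Lp ℂ 2 (volume.restrict (Set.Icc (0 : ℝ) x)), ∀ g : Lp ℂ 2 (volume.restrict (Set.Icc 0 x)),
      (A g : ℝ → ℂ) =ᵐ[volume.restrict (Set.Icc (0 : ℝ) x)] fun t =>
        ∫ s in Set.Icc (0 : ℝ) x, invFourier (fun ξ => σ ξ - 1) (t - s) * g s :=
    exists_isConvolution hk hk2
  rw [wienerHopf, integralOperator, dif_pos h]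
  exact h.choose_spec

end Convolution

/-! ### Invertibility from the determinant -/

/-- If `I + K` has a kernel, then all compressions of `(I + K) e^{-K}` to subspaces containing a
fixed kernel vector are singular. -/
lemma det₂_eq_zero {H : Type*} [NormedAddCommGroup H] [InnerProductSpace ℂ H] [CompleteSpace H]
    {K : H →L[ℂ] H} {f : H} (hf : f ≠ 0) (hK : (1 + K) f = 0) : det₂ K = 0 := by
  have hA : ((1 + K) * NormedSpace.exp (-K)) f = 0 := by
    have hc : Commute (1 + K) (NormedSpace.exp (-K)) :=
      Commute.exp_right (((Commute.one_left K).add_left (Commute.refl K)).neg_right)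
    rw [hc.eq, mul_apply_eq_comp, hK, map_zero]
  have hdir : IsDirected {E : Submodule ℂ H // FiniteDimensional ℂ E} (· ≤ ·) :=
    ⟨fun E E' => by
      have h1 := E.2
      have h2 := E'.2
      exact ⟨⟨E.1 ⊔ E'.1, inferInstance⟩, le_sup_left (a := E.1), le_sup_right (a := E.1)⟩⟩
  have hne : Nonempty {E : Submodule ℂ H // FiniteDimensional ℂ E} := ⟨⟨⊥, inferInstance⟩⟩
  have hspan : FiniteDimensional ℂ (Submodule.span ℂ {f}) := inferInstance
  rw [det₂, fredholmDet]
  refine Tendsto.limUnder_eq (tendsto_const_nhds.congr' ?_)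
  filter_upwards [eventually_ge_atTop (⟨Submodule.span ℂ {f}, hspan⟩ :
    {E : Submodule ℂ H // FiniteDimensional ℂ E})] with E hE
  have hfE : f ∈ E.1 := hE (Submodule.mem_span_singleton_self f)
  have := E.2
  symm
  rw [LinearMap.det_eq_zero_iff_ker_ne_bot, Submodule.ne_bot_iff]
  refine ⟨⟨f, hfE⟩, ?_, fun h => hf (congrArg Subtype.val h)⟩
  rw [LinearMap.mem_ker]
  change E.1.orthogonalProjectionOnto (((1 + K) * NormedSpace.exp (-K)) f) = 0
  rw [hA, map_zero]

/-- The Fredholm alternative, with the determinant as the criterion for injectivity. -/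
lemma surjective_one_add_of_det₂_ne_zero {H : Type*} [NormedAddCommGroup H]
    [InnerProductSpace ℂ H] [CompleteSpace H] {K : H →L[ℂ] H} (hK : IsCompactOperator K)
    (hdet : det₂ K ≠ 0) (b : H) : ∃ f, f + K f = b := by
  rcases hK.hasEigenvalue_or_mem_resolventSet (μ := -1) (by norm_num) with h | h
  · obtain ⟨f, hf⟩ := h.exists_hasEigenvector
    refine absurd (det₂_eq_zero hf.2 ?_) hdet
    have := hf.apply_eq_smul
    simp only [ContinuousLinearMap.coe_coe] at this
    rw [add_apply, this]
    simp
  · obtain ⟨u, hu⟩ := h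
    refine ⟨(↑u⁻¹ : H →L[ℂ] H) (-b), ?_⟩
    have h1 : (u : H →L[ℂ] H) ((↑u⁻¹ : H →L[ℂ] H) (-b)) = -b := by
      rw [← mul_apply_eq_comp, Units.mul_inv, one_apply_eq_self]
    rw [hu] at h1
    simp only [map_neg, map_one, sub_apply, neg_apply, one_apply_eq_self] at h1 ⊢
    rw [← neg_inj, ← h1]
    abel

/-! ### The equation on the interval and its Fourier transform -/

/-- The exponential `e^{iτz}`, cut off to `[0, x]`. -/
noncomputable def cutExp (x : ℝ) (z : ℂ) (τ : ℝ) : ℂ :=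
  (Set.Icc (0 : ℝ) x).indicator (fun τ : ℝ => Complex.exp (Complex.I * z * τ)) τ

section CutExp

variable {x : ℝ} {z : ℂ}

lemma norm_exp_I_mul_mul_le {τ : ℝ} (hτ : τ ∈ Set.Icc 0 x) (z : ℂ) :
    ‖Complex.exp (Complex.I * z * τ)‖ ≤ Real.exp (x * |z.im|) := by
  rw [Complex.norm_exp]
  refine Real.exp_le_exp.2 ?_
  have h1 : (Complex.I * z * τ).re = τ * (-z.im) := by
    simp
    ring
  rw [h1]
  calc τ * (-z.im) ≤ τ * |z.im| := mul_le_mul_of_nonneg_left (neg_le_abs _) hτ.1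
    _ ≤ x * |z.im| := mul_le_mul_of_nonneg_right hτ.2 (abs_nonneg _)

lemma norm_cutExp_le (x : ℝ) (z : ℂ) (τ : ℝ) : ‖cutExp x z τ‖ ≤ Real.exp (x * |z.im|) := by
  by_cases hτ : τ ∈ Set.Icc 0 x
  · rw [cutExp, Set.indicator_of_mem hτ]
    exact norm_exp_I_mul_mul_le hτ z
  · rw [cutExp, Set.indicator_of_notMem hτ, norm_zero]
    positivity

lemma measurable_cutExp (x : ℝ) (z : ℂ) : Measurable (cutExp x z) :=
  Measurable.indicator (by fun_prop) measurableSet_Icc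

lemma integrable_cutExp (x : ℝ) (z : ℂ) : Integrable (cutExp x z) := by
  refine IntegrableOn.integrable_indicator ?_ measurableSet_Icc
  exact Continuous.integrableOn_Icc (by fun_prop)

lemma memLp_cutExp (x : ℝ) (z : ℂ) : MemLp (cutExp x z) 2 := by
  refine (memLp_indicator_iff_restrict measurableSet_Icc).2 ?_
  exact memLp_of_continuous (by fun_prop) 0 x

lemma expTransform_cutExp (hx : 0 < x) (hz : z.im ≠ 0) (s : ℝ) :
    expTransform (cutExp x z) s =
      (Complex.exp (Complex.I * x * (z - s)) - 1) / (Complex.I * (z - s)) := by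
  have hc : Complex.I * (z - s) ≠ 0 := by
    refine mul_ne_zero Complex.I_ne_zero fun h => hz ?_
    simpa using congrArg Complex.im h
  have h1 := integral_exp_mul_complex (a := 0) (b := x) hc
  rw [intervalIntegral.integral_of_le hx.le, ← integral_Icc_eq_integral_Ioc,
    ← integral_indicator measurableSet_Icc] at h1
  rw [expTransform]
  have h2 : (fun τ : ℝ => cutExp x z τ * Complex.exp (-(Complex.I * s * τ)))
      = (Set.Icc (0 : ℝ) x).indicator fun τ : ℝ => Complex.exp (Complex.I * (z - s) * τ) := by
    ext τ
    by_cases hτ : τ ∈ Set.Icc 0 x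
    · rw [cutExp, Set.indicator_of_mem hτ, Set.indicator_of_mem hτ, ← Complex.exp_add]
      congr 1
      ring
    · rw [cutExp, Set.indicator_of_notMem hτ, Set.indicator_of_notMem hτ, zero_mul]
  rw [h2, h1]
  congr 2
  · congr 1
    ring
  · simp

lemma norm_exp_sub_one_le (x : ℝ) (z : ℂ) (s : ℝ) :
    ‖Complex.exp (Complex.I * x * (z - s)) - 1‖ ≤ Real.exp (-(x * z.im)) + 1 := by
  refine (norm_sub_le _ _).trans ?_
  rw [norm_one, Complex.norm_exp]
  gcongr
  simp

lemma memLp_expTransform_cutExp (hx : 0 < x) (hz : z.im ≠ 0) :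
    MemLp (expTransform (cutExp x z)) 2 := by
  have hc := continuous_expTransform (integrable_cutExp x z)
  rw [memLp_two_iff_integrable_sq_norm hc.aestronglyMeasurable]
  set C : ℝ := (Real.exp (-(x * z.im)) + 1) * ((1 + ‖z‖) / |z.im| + 1) with hC
  refine (integrable_inv_one_add_sq.const_mul (C ^ 2)).mono'
    (hc.norm.pow 2).aestronglyMeasurable (Eventually.of_forall fun s => ?_)
  have hzs : 0 < ‖z - s‖ := (abs_pos.2 hz).trans_le (abs_im_le_norm_sub_ofReal z s)
  have hs : 0 < 1 + |s| := by positivity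
  have h1 : ‖expTransform (cutExp x z) s‖ ≤ C / (1 + |s|) := by
    rw [expTransform_cutExp hx hz, norm_div, norm_mul, Complex.norm_I, one_mul,
      div_le_div_iff₀ hzs hs]
    refine (mul_le_mul (norm_exp_sub_one_le x z s) (one_add_abs_le_mul_norm (abs_pos.2 hz)
      (abs_im_le_norm_sub_ofReal z s)) hs.le (by positivity)).trans_eq ?_
    rw [hC]
    ring
  rw [Real.norm_of_nonneg (by positivity)]
  calc ‖expTransform (cutExp x z) s‖ ^ 2 ≤ (C / (1 + |s|)) ^ 2 := by gcongr
    _ = C ^ 2 * ((1 + |s|) ^ 2)⁻¹ := by rw [div_pow, div_eq_mul_inv]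
    _ ≤ C ^ 2 * (1 + s ^ 2)⁻¹ := by
      gcongr
      nlinarith [abs_nonneg s, sq_abs s]

lemma expTransform_comp_add_right {w : ℝ → ℂ} (ρ s : ℝ) :
    expTransform (fun t => w (t + ρ)) s = Complex.exp (Complex.I * s * ρ) * expTransform w s := by
  rw [expTransform, expTransform, ← integral_const_mul,
    ← integral_add_right_eq_self (fun t : ℝ => Complex.exp (Complex.I * s * ρ) *
      (w t * Complex.exp (-(Complex.I * s * t)))) ρ]
  refine integral_congr_ae (Eventually.of_forall fun t => ?_)
  simp only
  rw [mul_left_comm, ← Complex.exp_add]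
  congr 2
  push_cast
  ring

end CutExp

section Equation

variable {h : ℝ → ℂ} {x : ℝ} {z : ℂ}

/-- Parseval's identity for a translate of the kernel against an exponential on `[0, x]`. -/
lemma VanishingDensity.integral_invFourier_sub_mul_cutExp (hh : VanishingDensity h) (hx : 0 < x)
    (hz : z.im ≠ 0) (ρ : ℝ) :
    ∫ τ, invFourier h (τ - ρ) * cutExp x z τ = (1 / (2 * (Real.pi : ℂ))) *
      ∫ s : ℝ, h s * expTransform (cutExp x z) s * Complex.exp (Complex.I * s * ρ) := by
  have h1 : ∫ τ, invFourier h (τ - ρ) * cutExp x z τ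
      = ∫ t, invFourier h t * cutExp x z (t + ρ) := by
    rw [← integral_sub_right_eq_self (fun t => invFourier h t * cutExp x z (t + ρ)) ρ]
    simp_rw [sub_add_cancel]
  have hexp : expTransform (fun t => cutExp x z (t + ρ)) =
      fun s : ℝ => Complex.exp (Complex.I * s * ρ) * expTransform (cutExp x z) s :=
    funext fun s => expTransform_comp_add_right ρ s
  have hnorm : ∀ s : ℝ, ‖Complex.exp (Complex.I * s * ρ)‖ = 1 := fun s => by
    rw [Complex.norm_exp]
    simp
  rw [h1, hh.integral_invFourier_mul ((integrable_cutExp x z).comp_add_right ρ)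
    ((memLp_cutExp x z).comp_measurePreserving (measurePreserving_add_right volume ρ)), hexp]
  · congr 2
    ext s
    ring
  · rw [hexp]
    refine (memLp_expTransform_cutExp hx hz).of_le ?_ (Eventually.of_forall fun s => ?_)
    · refine Continuous.aestronglyMeasurable ?_
      exact Continuous.mul (by fun_prop) (continuous_expTransform (integrable_cutExp x z))
    · rw [norm_mul, hnorm, one_mul]

lemma VanishingDensity.integrable_mul_expTransform_cutExp (hh : VanishingDensity h) (hx : 0 < x)
    (hz : z.im ≠ 0) : Integrable fun s => h s * expTransform (cutExp x z) s := by
  have h1 := (hh.cauchyAdmissible.mul_bounded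
    (f := fun s : ℝ => (Complex.exp (Complex.I * x * (z - s)) - 1) / Complex.I) (by fun_prop)
    (C := Real.exp (-(x * z.im)) + 1) (fun s => by
      rw [norm_div, Complex.norm_I, div_one]
      exact norm_exp_sub_one_le x z s)).integrable_div_of_im_ne_zero hz
  refine h1.congr (Eventually.of_forall fun s => ?_)
  simp only
  rw [expTransform_cutExp hx hz, mul_div_assoc, div_div]

/-- The Fourier transform `∫ e^{iτz} Φ(τ) dτ`. -/
noncomputable def fourierLaplace (Φ : ℝ → ℂ) (z : ℂ) : ℂ :=
  ∫ τ : ℝ, Complex.exp (Complex.I * z * τ) * Φ τ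

/-- If `Φ + K ∗ Φ = K(· - ρ)` on `[0, x]`, then `e^{iρz} - Φ^(z)`, where `Φ^` is the Fourier
transform, satisfies an integral equation on the real line. -/
lemma VanishingDensity.fourierLaplace_eq (hh : VanishingDensity h) (hx : 0 < x) (hz : z.im ≠ 0)
    {ρ : ℝ} (hρ : ρ ∈ Set.Icc 0 x) {Φ : ℝ → ℂ} (hΦ : Integrable Φ)
    (hsupp : ∀ τ, τ ∉ Set.Icc 0 x → Φ τ = 0)
    (heq : ∀ᵐ τ : ℝ, τ ∈ Set.Icc 0 x →
      Φ τ + ∫ τ', invFourier h (τ - τ') * Φ τ' = invFourier h (τ - ρ)) :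
    fourierLaplace Φ z = (1 / (2 * (Real.pi : ℂ))) * ∫ s : ℝ, h s * expTransform (cutExp x z) s *
      (Complex.exp (Complex.I * s * ρ) - fourierLaplace Φ s) := by
  set K := invFourier h with hK
  set e := cutExp x z with he
  -- Only the values of the kernel on `[-x, x]` matter.
  set K' : ℝ → ℂ := (Set.Icc (-x) x).indicator K with hK'
  have hK'i : Integrable K' := by
    refine IntegrableOn.integrable_indicator ?_ measurableSet_Icc
    exact (hh.memLp_invFourier isCompact_Icc.measure_lt_top.ne).integrable (by norm_num)
  have hK'eq : ∀ τ ∈ Set.Icc 0 x, ∀ τ' ∈ Set.Icc 0 x, K' (τ - τ') = K (τ - τ') := by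
    intro τ hτ τ' hτ'
    rw [hK', Set.indicator_of_mem]
    exact ⟨by linarith [hτ.1, hτ'.2], by linarith [hτ.2, hτ'.1]⟩
  have he0 : ∀ τ : ℝ, τ ∉ Set.Icc (0 : ℝ) x → e τ = 0 := fun τ hτ => by
    rw [he, cutExp, Set.indicator_of_notMem hτ]
  have hem : ∀ᵐ τ, ‖e τ‖ ≤ Real.exp (x * |z.im|) := Eventually.of_forall (norm_cutExp_le x z)
  have heKi : Integrable fun τ => K (τ - ρ) * e τ := by
    have := (hK'i.comp_sub_right ρ).mul_bdd (measurable_cutExp x z).aestronglyMeasurable hem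
    refine this.congr (Eventually.of_forall fun τ => ?_)
    by_cases hτ : τ ∈ Set.Icc 0 x
    · simp only [hK'eq τ hτ ρ hρ, he]
    · have h1 := he0 τ hτ
      rw [he] at h1
      simp only [he, h1, mul_zero]
  have hprod : Integrable (fun p : ℝ × ℝ => K (p.1 - p.2) * Φ p.2 * e p.1)
      (volume.prod volume) := by
    have h1 := (hΦ.convolution_integrand (ContinuousLinearMap.mul ℂ ℂ) hK'i).mul_bdd
      (g := fun p : ℝ × ℝ => e p.1) (c := Real.exp (x * |z.im|))
      ((measurable_cutExp x z).comp measurable_fst).aestronglyMeasurable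
      (Eventually.of_forall fun p => norm_cutExp_le x z p.1)
    refine h1.congr (Eventually.of_forall fun p => ?_)
    simp only [ContinuousLinearMap.mul_apply']
    by_cases hp1 : p.1 ∈ Set.Icc 0 x
    · by_cases hp2 : p.2 ∈ Set.Icc 0 x
      · rw [hK'eq _ hp1 _ hp2, mul_comm (Φ p.2)]
      · rw [hsupp _ hp2]
        simp
    · rw [he0 _ hp1]
      simp
  have hL : fourierLaplace Φ z = ∫ τ, (K (τ - ρ) * e τ - ∫ τ', K (τ - τ') * Φ τ' * e τ) := by
    refine integral_congr_ae ?_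
    filter_upwards [heq] with τ hτ
    by_cases hτx : τ ∈ Set.Icc 0 x
    · rw [integral_mul_const, ← hτ hτx, he, cutExp, Set.indicator_of_mem hτx]
      ring
    · rw [hsupp τ hτx, he0 τ hτx]
      simp
  rw [hL, integral_sub heKi hprod.integral_prod_left, integral_integral_swap hprod]
  have hinner : ∀ τ', ∫ τ, K (τ - τ') * Φ τ' * e τ = Φ τ' * ((1 / (2 * (Real.pi : ℂ))) *
      ∫ s : ℝ, h s * expTransform e s * Complex.exp (Complex.I * s * τ')) := by
    intro τ'
    rw [← hh.integral_invFourier_sub_mul_cutExp hx hz τ', ← integral_const_mul]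
    refine integral_congr_ae (Eventually.of_forall fun τ => ?_)
    simp only [hK, he]
    ring
  simp_rw [hinner]
  rw [hh.integral_invFourier_sub_mul_cutExp hx hz ρ]
  have hi := hh.integrable_mul_expTransform_cutExp hx hz
  have hnorm : ∀ s ρ : ℝ, ‖Complex.exp (Complex.I * s * ρ)‖ = 1 := fun s ρ => by
    rw [Complex.norm_exp]
    simp
  have hprod2 : Integrable (fun p : ℝ × ℝ => Φ p.1 * (h p.2 * expTransform e p.2) *
      Complex.exp (Complex.I * p.2 * p.1)) (volume.prod volume) :=
    (hΦ.mul_prod hi).mul_bdd (c := 1) (by fun_prop)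
      (Eventually.of_forall fun p => (hnorm p.2 p.1).le)
  have h2 : ∫ τ', Φ τ' * ((1 / (2 * (Real.pi : ℂ))) *
      ∫ s : ℝ, h s * expTransform e s * Complex.exp (Complex.I * s * τ'))
      = (1 / (2 * (Real.pi : ℂ))) * ∫ s : ℝ, h s * expTransform e s * fourierLaplace Φ s := by
    calc _ = (1 / (2 * (Real.pi : ℂ))) * ∫ τ' : ℝ, ∫ s : ℝ, Φ τ' * (h s * expTransform e s) *
          Complex.exp (Complex.I * s * τ') := by
          rw [← integral_const_mul]
          refine integral_congr_ae (Eventually.of_forall fun τ' => ?_)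
          simp only
          rw [mul_left_comm, ← integral_const_mul]
          congr 2
          ext s
          ring
      _ = (1 / (2 * (Real.pi : ℂ))) * ∫ s : ℝ, ∫ τ' : ℝ, Φ τ' * (h s * expTransform e s) *
          Complex.exp (Complex.I * s * τ') := by rw [integral_integral_swap hprod2]
      _ = _ := by
          congr 2
          ext s
          rw [fourierLaplace, ← integral_const_mul]
          congr 1
          ext τ'
          ring
  rw [h2, ← mul_sub, ← integral_sub]
  · congr 2
    ext s
    ring
  · exact hi.mul_bdd (c := 1) (by fun_prop) (Eventually.of_forall fun s => (hnorm s ρ).le)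
  · refine (hprod2.integral_prod_right).congr (Eventually.of_forall fun s => ?_)
    simp only
    rw [fourierLaplace, ← integral_const_mul]
    congr 1
    ext τ'
    ring

lemma differentiable_fourierLaplace (hx : 0 < x) {Φ : ℝ → ℂ} (hΦ : Integrable Φ)
    (hsupp : ∀ τ, τ ∉ Set.Icc 0 x → Φ τ = 0) : Differentiable ℂ (fourierLaplace Φ) := by
  intro z
  refine differentiableAt_integral_of_dominated (r := 1) one_pos
    (b := fun τ => Real.exp (x * (‖z‖ + 1)) * ‖Φ τ‖) ?_ ?_ (hΦ.norm.const_mul _) ?_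
  · exact fun w _ => AEStronglyMeasurable.mul (by fun_prop) hΦ.aestronglyMeasurable
  · intro τ
    fun_prop
  · intro τ w hw
    by_cases hτ : τ ∈ Set.Icc 0 x
    · rw [norm_mul]
      gcongr
      refine (norm_exp_I_mul_mul_le hτ w).trans (Real.exp_le_exp.2 ?_)
      gcongr
      rw [Metric.mem_ball, dist_eq_norm] at hw
      have h1 := Complex.abs_im_le_norm w
      have h2 := norm_le_norm_add_norm_sub' w z
      linarith
    · simp [hsupp τ hτ]

lemma norm_fourierLaplace_le (hx : 0 < x) {Φ : ℝ → ℂ} (hΦ : Integrable Φ)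
    (hsupp : ∀ τ, τ ∉ Set.Icc 0 x → Φ τ = 0) (hz : |z.im| ≤ 1) :
    ‖fourierLaplace Φ z‖ ≤ Real.exp x * ∫ τ, ‖Φ τ‖ := by
  rw [← integral_const_mul]
  refine norm_integral_le_of_norm_le (hΦ.norm.const_mul _) (Eventually.of_forall fun τ => ?_)
  by_cases hτ : τ ∈ Set.Icc 0 x
  · rw [norm_mul]
    gcongr
    refine (norm_exp_I_mul_mul_le hτ z).trans (Real.exp_le_exp.2 ?_)
    nlinarith
  · simp [hsupp τ hτ]

/-- Solving the equation on the interval gives an entire function, bounded on horizontal strips,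
that solves the integral equation on the line. -/
lemma exists_entire_solution {σ : ℝ → ℂ} (hh : VanishingDensity fun s => σ s - 1) (hx : 0 < x)
    (hdet : det₂ (wienerHopf σ x) ≠ 0) {ρ : ℝ} (hρ : ρ ∈ Set.Icc 0 x) :
    ∃ f : ℂ → ℂ, Differentiable ℂ f ∧ (∃ C : ℝ, ∀ z : ℂ, |z.im| ≤ 1 → ‖f z‖ ≤ C) ∧
      ∀ z : ℂ, z.im ≠ 0 → f z = Complex.exp (Complex.I * z * ρ) +
        (1 / (2 * (Real.pi : ℂ) * Complex.I)) * ∫ s : ℝ, (σ s - 1) * f s *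
          (1 - Complex.exp (Complex.I * x * (z - s))) / (z - s) := by
  set h : ℝ → ℂ := fun s => σ s - 1 with hdef
  have hKm := hh.measurable_invFourier
  have hK2 : MemLp (invFourier h) 2 (volume.restrict (Set.Icc (-x) x)) :=
    hh.memLp_invFourier isCompact_Icc.measure_lt_top.ne
  have hT := isConvolution_wienerHopf hKm hK2
  have hb : MemLp (fun t => invFourier h (t - ρ)) 2 (volume.restrict (Set.Icc 0 x)) := by
    have hmp := (measurePreserving_sub_right (volume : Measure ℝ) ρ).restrict_preimage
      (measurableSet_Icc (a := -ρ) (b := x - ρ))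
    have hpre : (fun t : ℝ => t - ρ) ⁻¹' Set.Icc (-ρ) (x - ρ) = Set.Icc 0 x := by
      ext t
      simp only [Set.mem_preimage, Set.mem_Icc]
      constructor <;> rintro ⟨h1, h2⟩ <;> constructor <;> linarith
    rw [hpre] at hmp
    exact (hh.memLp_invFourier isCompact_Icc.measure_lt_top.ne).comp_measurePreserving hmp
  obtain ⟨φ, hφ⟩ := surjective_one_add_of_det₂_ne_zero (hT.isCompactOperator hKm hK2) hdet
    (hb.toLp _)
  set Φ : ℝ → ℂ := (Set.Icc (0 : ℝ) x).indicator φ with hΦdef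
  have hΦ : Integrable Φ := by
    refine IntegrableOn.integrable_indicator ?_ measurableSet_Icc
    have : IsFiniteMeasure (volume.restrict (Set.Icc (0 : ℝ) x)) := inferInstance
    exact (Lp.memLp φ).integrable (by norm_num)
  have hsupp : ∀ τ, τ ∉ Set.Icc 0 x → Φ τ = 0 := fun τ hτ => Set.indicator_of_notMem hτ _
  have heq : ∀ᵐ τ : ℝ, τ ∈ Set.Icc 0 x →
      Φ τ + ∫ τ', invFourier h (τ - τ') * Φ τ' = invFourier h (τ - ρ) := by
    rw [← ae_restrict_iff' measurableSet_Icc]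
    filter_upwards [hT φ, hb.coeFn_toLp, Lp.coeFn_add φ (wienerHopf σ x φ),
      ae_restrict_mem measurableSet_Icc] with τ h1 h2 h3 hτ
    rw [hφ, h2, Pi.add_apply, h1] at h3
    rw [h3, hΦdef, Set.indicator_of_mem hτ, ← integral_indicator measurableSet_Icc]
    congr 2
    ext τ'
    by_cases hτ' : τ' ∈ Set.Icc 0 x
    · rw [Set.indicator_of_mem hτ', Set.indicator_of_mem hτ']
    · rw [Set.indicator_of_notMem hτ', Set.indicator_of_notMem hτ', mul_zero]
  refine ⟨fun z => Complex.exp (Complex.I * z * ρ) - fourierLaplace Φ z, ?_, ?_, ?_⟩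
  · exact Differentiable.sub (by fun_prop) (differentiable_fourierLaplace hx hΦ hsupp)
  · refine ⟨Real.exp x + Real.exp x * ∫ τ, ‖Φ τ‖, fun z hz => ?_⟩
    refine (norm_sub_le _ _).trans (add_le_add ?_ (norm_fourierLaplace_le hx hΦ hsupp hz))
    refine (norm_exp_I_mul_mul_le hρ z).trans (Real.exp_le_exp.2 ?_)
    nlinarith
  · intro z hz
    have h1 := hh.fourierLaplace_eq hx hz hρ hΦ hsupp heq
    simp only
    rw [h1, sub_eq_add_neg, ← mul_neg, ← integral_neg]
    congr 1
    rw [one_div, one_div, mul_inv _ Complex.I, mul_assoc, ← integral_const_mul Complex.I⁻¹]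
    congr 1
    refine integral_congr_ae (Eventually.of_forall fun s => ?_)
    simp only
    rw [expTransform_cutExp hx hz]
    have hzs : z - s ≠ 0 := fun h0 => hz (by simpa using congrArg Complex.im h0)
    field_simp
    ring

end Equation

/-! ### Cauchy integrals of a density times an entire function -/

section EntireFactor

variable {h : ℝ → ℂ} {H : ℂ → ℂ} {C : ℝ}

/-- By Cauchy's estimate, an entire function that is bounded on a strip is Lipschitz on the real
line. -/
lemma norm_sub_le_of_bounded_strip (hH : Differentiable ℂ H) (hC : ∀ z : ℂ, |z.im| ≤ 1 → ‖H z‖ ≤ C)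
    (s t : ℝ) : ‖H s - H t‖ ≤ C * |s - t| := by
  have hconv : Convex ℝ {z : ℂ | z.im = 0} := by
    intro z hz w hw p q _ _ _
    have hz' : z.im = 0 := hz
    have hw' : w.im = 0 := hw
    simp [hz', hw']
  have hderiv : ∀ z ∈ {z : ℂ | z.im = 0}, ‖deriv H z‖ ≤ C := by
    intro z hz
    have hz' : z.im = 0 := hz
    have h1 := Complex.norm_deriv_le_of_forall_mem_sphere_norm_le (c := z) (C := C) one_pos
      hH.diffContOnCl (fun w hw => hC w ?_)
    · simpa using h1
    · rw [mem_sphere_iff_norm] at hw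
      have h2 := Complex.abs_im_le_norm (w - z)
      rw [Complex.sub_im, hz', sub_zero] at h2
      exact h2.trans hw.le
  have h1 := hconv.norm_image_sub_le_of_norm_deriv_le (fun z _ => hH z) hderiv
    (Complex.ofReal_im t) (Complex.ofReal_im s)
  rwa [← Complex.ofReal_sub, Complex.norm_real] at h1

lemma VanishingDensity.mul_entire (hh : VanishingDensity h) (hH : Differentiable ℂ H)
    (hC : ∀ z : ℂ, |z.im| ≤ 1 → ‖H z‖ ≤ C) : VanishingDensity fun s => h s * H s :=
  hh.mul (fun s => hC s (by simp)) (norm_sub_le_of_bounded_strip hH hC)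

lemma dslope_comm' (H : ℂ → ℂ) (w z : ℂ) : dslope H w z = dslope H z w := by
  rcases eq_or_ne z w with rfl | hne
  · rfl
  · rw [dslope_of_ne _ hne, dslope_of_ne _ hne.symm, slope_comm]

lemma dslope_eq_div (H : ℂ → ℂ) {w z : ℂ} (hne : z ≠ w) :
    dslope H w z = (H z - H w) / (z - w) := by
  rw [dslope_of_ne _ hne, slope_def_field]

/-- The difference quotients of an entire function that is bounded on the line decay like
`1 / (1 + |s|)`, locally uniformly in `z`. -/
lemma exists_norm_dslope_le (hH : Differentiable ℂ H) (hC : ∀ s : ℝ, ‖H s‖ ≤ C) (z₀ : ℂ) :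
    ∃ D : ℝ, ∀ s : ℝ, ∀ z ∈ Metric.ball z₀ 1, ‖dslope H s z‖ ≤ D / (1 + |s|) := by
  have hH' : Continuous (deriv H) := (hH.contDiff (n := 1)).continuous_deriv le_rfl
  obtain ⟨M, hM⟩ := (isCompact_closedBall z₀ 2).exists_bound_of_continuousOn hH'.continuousOn
  obtain ⟨M', hM'⟩ := (isCompact_closedBall z₀ 2).exists_bound_of_continuousOn
    hH.continuous.continuousOn
  have hz₀ : z₀ ∈ Metric.closedBall z₀ 2 := Metric.mem_closedBall_self (by norm_num)
  have hM0 : 0 ≤ M := (norm_nonneg _).trans (hM z₀ hz₀)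
  have hM'0 : 0 ≤ M' := (norm_nonneg _).trans (hM' z₀ hz₀)
  have hC0 : 0 ≤ C := (norm_nonneg _).trans (hC 0)
  refine ⟨(M + (M' + C)) * (3 + ‖z₀‖), fun s z hz => ?_⟩
  have hs : 0 < 1 + |s| := by positivity
  rw [le_div_iff₀ hs]
  have hz1 : ‖z - z₀‖ < 1 := by rwa [mem_ball_iff_norm] at hz
  have hzc : z ∈ Metric.closedBall z₀ 2 := by
    rw [mem_closedBall_iff_norm]
    linarith
  by_cases hsz : ‖(s : ℂ) - z₀‖ ≤ 2
  -- Near the diagonal, the difference quotient is bounded by the derivative.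
  · have h1 : ‖dslope H s z‖ ≤ M := by
      rcases eq_or_ne z s with rfl | hne
      · rw [dslope_same]
        exact hM _ hzc
      · rw [dslope_eq_div H hne, norm_div, div_le_iff₀ (norm_pos_iff.2 (sub_ne_zero.2 hne))]
        exact (convex_closedBall z₀ 2).norm_image_sub_le_of_norm_deriv_le (fun w _ => hH w) hM
          (mem_closedBall_iff_norm.2 hsz) hzc
    have h2 : |s| ≤ 2 + ‖z₀‖ := by
      have h3 := norm_le_norm_add_norm_sub' (s : ℂ) z₀
      rw [Complex.norm_real, Real.norm_eq_abs] at h3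
      linarith
    refine mul_le_mul (by linarith) (by linarith) hs.le (by positivity)
  -- Away from it, the denominator is comparable to `1 + |s|`.
  · have hzs : 1 ≤ ‖z - s‖ := by
      have h1 := norm_sub_le_norm_sub_add_norm_sub (s : ℂ) z z₀
      rw [norm_sub_rev (s : ℂ) z] at h1
      linarith
    have hne : z ≠ s := by
      rintro rfl
      simp at hzs
      linarith
    have hzn : ‖z‖ ≤ ‖z₀‖ + 1 := by
      have h1 := norm_le_norm_add_norm_sub' z z₀
      linarith
    have h1 : 1 + |s| ≤ (3 + ‖z₀‖) * ‖z - s‖ := by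
      refine (one_add_abs_le_mul_norm one_pos hzs).trans ?_
      exact mul_le_mul_of_nonneg_right (by linarith) (norm_nonneg _)
    have h2 : ‖H z - H s‖ ≤ M' + C :=
      (norm_sub_le _ _).trans (add_le_add (hM' z hzc) (hC s))
    rw [dslope_eq_div H hne, norm_div, div_mul_eq_mul_div, div_le_iff₀ (by linarith)]
    calc ‖H z - H s‖ * (1 + |s|) ≤ (M + (M' + C)) * ((3 + ‖z₀‖) * ‖z - s‖) :=
          mul_le_mul (by linarith) h1 hs.le (by positivity)
      _ = (M + (M' + C)) * (3 + ‖z₀‖) * ‖z - s‖ := by ring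

/-- The Cauchy integral of `h H`, with `H` entire, minus `H` times the Cauchy integral of `h`: an
absolutely convergent integral of difference quotients. -/
noncomputable def cauchyDefect (h : ℝ → ℂ) (H : ℂ → ℂ) (z : ℂ) : ℂ :=
  ∫ s : ℝ, h s * dslope H s z

lemma CauchyAdmissible.integrable_mul_dslope (hh : CauchyAdmissible h) (hH : Differentiable ℂ H)
    (hC : ∀ s : ℝ, ‖H s‖ ≤ C) (z : ℂ) : Integrable fun s : ℝ => h s * dslope H s z := by
  obtain ⟨D, hD⟩ := exists_norm_dslope_le hH hC z
  have hm : AEStronglyMeasurable (fun s : ℝ => h s * dslope H s z) volume := by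
    have hc : Continuous (dslope H z) := by
      rw [← continuousOn_univ, continuousOn_dslope univ_mem]
      exact ⟨hH.continuous.continuousOn, hH z⟩
    simp_rw [dslope_comm' H _ z]
    exact hh.measurable.aestronglyMeasurable.mul
      (hc.comp Complex.continuous_ofReal).aestronglyMeasurable
  refine (hh.integrable.const_mul D).mono' hm (Eventually.of_forall fun s => ?_)
  rw [norm_mul]
  calc ‖h s‖ * ‖dslope H s z‖ ≤ ‖h s‖ * (D / (1 + |s|)) := by
        gcongr
        exact hD s z (Metric.mem_ball_self one_pos)
    _ = D * (‖h s‖ / (1 + |s|)) := by ring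

lemma CauchyAdmissible.differentiable_cauchyDefect (hh : CauchyAdmissible h)
    (hH : Differentiable ℂ H) (hC : ∀ s : ℝ, ‖H s‖ ≤ C) : Differentiable ℂ (cauchyDefect h H) := by
  intro z
  obtain ⟨D, hD⟩ := exists_norm_dslope_le hH hC z
  refine differentiableAt_integral_of_dominated (r := 1) one_pos
    (b := fun s => D * (‖h s‖ / (1 + |s|)))
    (fun w _ => (hh.integrable_mul_dslope hH hC w).aestronglyMeasurable) (fun s => ?_)
    (hh.integrable.const_mul D) (fun s w hw => ?_)
  · refine DifferentiableOn.const_mul ?_ _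
    exact ((Complex.differentiableOn_dslope univ_mem).2 hH.differentiableOn).mono
      (Set.subset_univ _)
  · rw [norm_mul]
    calc ‖h s‖ * ‖dslope H s w‖ ≤ ‖h s‖ * (D / (1 + |s|)) := by
          gcongr
          exact hD s w hw
      _ = D * (‖h s‖ / (1 + |s|)) := by ring

lemma CauchyAdmissible.cauchyIntegral_mul_entire (hh : CauchyAdmissible h)
    (hH : Differentiable ℂ H) (hC : ∀ s : ℝ, ‖H s‖ ≤ C) {z : ℂ} (hz : z.im ≠ 0) :
    cauchyIntegral (fun s => h s * H s) z = H z * cauchyIntegral h z - cauchyDefect h H z := by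
  rw [cauchyIntegral, cauchyIntegral, cauchyDefect, ← integral_const_mul,
    ← integral_sub ((hh.integrable_div_of_im_ne_zero hz).const_mul _)
      (hh.integrable_mul_dslope hH hC z)]
  refine integral_congr_ae (Eventually.of_forall fun s => ?_)
  have hne : z ≠ s := by
    rintro rfl
    simp at hz
  have hzs : z - s ≠ 0 := sub_ne_zero.2 hne
  simp only
  rw [dslope_eq_div H hne]
  field_simp
  ring

end EntireFactor

/-! ### The factorization of the solution -/

section Factorization

lemma cauchyTransform_eq (σ : ℝ → ℂ) (z : ℂ) : cauchyTransform σ z =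
    (1 / (2 * (Real.pi : ℂ) * Complex.I)) * cauchyIntegral (fun s => σ s - 1) z :=
  integral_const_mul _ _

/-- `B(z) = u(z) v(z)ᵀ` with `u = (e^{ixz}, 1)`; this is `u`. -/
noncomputable def expColumn (x : ℝ) (z : ℂ) : Fin 2 → ℂ := ![Complex.exp (Complex.I * x * z), 1]

/-- `B(z) = u(z) v(z)ᵀ` with `v = (-e^{-ixz}, 1)`; this is `v`. -/
noncomputable def expRow (x : ℝ) (z : ℂ) : Fin 2 → ℂ := ![-Complex.exp (-(Complex.I * x * z)), 1]

lemma exp_mul_exp_neg_self (w : ℂ) : Complex.exp w * Complex.exp (-w) = 1 := by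
  rw [← Complex.exp_add, add_neg_cancel, Complex.exp_zero]

lemma rankOneMatrix_eq (x : ℝ) (z : ℂ) :
    rankOneMatrix x z = Matrix.vecMulVec (expColumn x z) (expRow x z) := by
  ext i j
  fin_cases i <;> fin_cases j <;>
    simp [rankOneMatrix, Matrix.vecMulVec_apply, expColumn, expRow, exp_mul_exp_neg_self]

lemma expRow_dotProduct_expColumn (x : ℝ) (z : ℂ) : expRow x z ⬝ᵥ expColumn x z = 0 := by
  simp [dotProduct, Fin.sum_univ_two, expRow, expColumn, mul_comm (Complex.exp (-_)),
    exp_mul_exp_neg_self]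

lemma rankOneMatrix_mul_self (x : ℝ) (z : ℂ) : rankOneMatrix x z * rankOneMatrix x z = 0 := by
  rw [rankOneMatrix_eq, Matrix.vecMulVec_mul_vecMulVec, expRow_dotProduct_expColumn, zero_smul,
    Matrix.vecMulVec_zero]

lemma det_one_add_smul_rankOneMatrix (x : ℝ) (c z : ℂ) : (1 + c • rankOneMatrix x z).det = 1 := by
  rw [Matrix.det_fin_two]
  simp only [rankOneMatrix, Matrix.add_apply, Matrix.smul_apply, Matrix.one_apply, Matrix.of_apply,
    Matrix.cons_val', Matrix.cons_val_zero, Matrix.cons_val_one, Matrix.cons_val_fin_one,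
    smul_eq_mul, if_pos, Fin.zero_eq_one_iff, Fin.one_eq_zero_iff]
  have h1 := exp_mul_exp_neg_self (Complex.I * x * z)
  norm_num
  linear_combination (c ^ 2) * h1

/-- The solution factors as an entire matrix function `N` of determinant `1` times `1 + g B`: the
equation on the interval yields `f` with `f = u + (1 / 2πi) ∫ (σ - 1) f (v · u(z)) / (z - s) ds`,
and `χ = 1 + (1 / 2πi) ∫ (σ - 1) f vᵀ / (z - s) ds` has the form `N + g f vᵀ` with `N u = f`. -/
lemma exists_entire_factor {σ : ℝ → ℂ} {x : ℝ} (hh : VanishingDensity fun s => σ s - 1)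
    (hx : 0 < x) (hdet : det₂ (wienerHopf σ x) ≠ 0) :
    ∃ N : ℂ → Matrix (Fin 2) (Fin 2) ℂ, (∀ i j, Differentiable ℂ fun z => N z i j) ∧
      (∀ z, (N z).det = 1) ∧
      Tendsto (fun z => N z * (1 + cauchyTransform σ z • rankOneMatrix x z))
        (Bornology.cobounded ℂ ⊓ 𝓟 {z : ℂ | z.im ≠ 0}) (𝓝 1) := by
  have hsol : ∀ i : Fin 2, ∃ f : ℂ → ℂ, Differentiable ℂ f ∧
      (∃ C : ℝ, ∀ z : ℂ, |z.im| ≤ 1 → ‖f z‖ ≤ C) ∧ ∀ z : ℂ, z.im ≠ 0 → f z = expColumn x z i +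
        (1 / (2 * (Real.pi : ℂ) * Complex.I)) * ∫ s : ℝ, (σ s - 1) * f s *
          (1 - Complex.exp (Complex.I * x * (z - s))) / (z - s) := by
    intro i
    fin_cases i
    · obtain ⟨f, h1, h2, h3⟩ := exists_entire_solution hh hx hdet ⟨hx.le, le_rfl⟩
      refine ⟨f, h1, h2, fun z hz => ?_⟩
      rw [h3 z hz, mul_right_comm]
      rfl
    · obtain ⟨f, h1, h2, h3⟩ := exists_entire_solution hh hx hdet ⟨le_rfl, hx.le⟩
      refine ⟨f, h1, h2, fun z hz => ?_⟩
      rw [h3 z hz]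
      simp [expColumn]
  choose f hfd hfC hf using hsol
  set c : ℂ := 1 / (2 * (Real.pi : ℂ) * Complex.I) with hc
  set h : ℝ → ℂ := fun s => σ s - 1 with hhdef
  have hvd : ∀ j, Differentiable ℂ fun z => expRow x z j := by
    intro j
    fin_cases j
    · simp only [expRow]
      simp
      fun_prop
    · simp [expRow]
  have hvC : ∀ j, ∀ z : ℂ, |z.im| ≤ 1 → ‖expRow x z j‖ ≤ Real.exp x := by
    intro j z hz
    fin_cases j
    · simp only [expRow, Fin.zero_eta, Matrix.cons_val_zero, norm_neg, Complex.norm_exp]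
      refine Real.exp_le_exp.2 ?_
      have := abs_le.1 hz
      simp
      nlinarith
    · simpa [expRow] using hx.le
  have hHd : ∀ i j, Differentiable ℂ fun z => f i z * expRow x z j := fun i j =>
    (hfd i).mul (hvd j)
  have hHC : ∀ i j, ∃ C : ℝ, ∀ z : ℂ, |z.im| ≤ 1 → ‖f i z * expRow x z j‖ ≤ C := by
    intro i j
    obtain ⟨C, hC⟩ := hfC i
    refine ⟨C * Real.exp x, fun z hz => ?_⟩
    rw [norm_mul]
    exact mul_le_mul (hC z hz) (hvC j z hz) (norm_nonneg _) ((norm_nonneg _).trans (hC z hz))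
  choose C hC using hHC
  have hCr : ∀ i j, ∀ s : ℝ, ‖f i s * expRow x s j‖ ≤ C i j := fun i j s => hC i j s (by simp)
  have hV : ∀ i j, VanishingDensity fun s => h s * (f i s * expRow x s j) := fun i j =>
    hh.mul_entire (hHd i j) (hC i j)
  set χ : ℂ → Matrix (Fin 2) (Fin 2) ℂ := fun z => Matrix.of fun i j =>
    (1 : Matrix (Fin 2) (Fin 2) ℂ) i j +
      c * cauchyIntegral (fun s => h s * (f i s * expRow x s j)) z with hχ
  set N : ℂ → Matrix (Fin 2) (Fin 2) ℂ := fun z => Matrix.of fun i j =>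
    (1 : Matrix (Fin 2) (Fin 2) ℂ) i j -
      c * cauchyDefect h (fun z => f i z * expRow x z j) z with hN
  have hNd : ∀ i j, Differentiable ℂ fun z => N z i j := fun i j =>
    ((hh.cauchyAdmissible.differentiable_cauchyDefect (hHd i j) (hCr i j)).const_mul c).const_sub _
  have hχN : ∀ z : ℂ, z.im ≠ 0 →
      χ z = N z + cauchyTransform σ z • Matrix.vecMulVec (fun i => f i z) (expRow x z) := by
    intro z hz
    ext i j
    simp only [hχ, hN, Matrix.of_apply, Matrix.add_apply, Matrix.smul_apply,
      Matrix.vecMulVec_apply, smul_eq_mul, cauchyTransform_eq]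
    rw [hh.cauchyAdmissible.cauchyIntegral_mul_entire (hHd i j) (hCr i j) hz]
    ring
  have hχu : ∀ z : ℂ, z.im ≠ 0 → (χ z).mulVec (expColumn x z) = fun i => f i z := by
    intro z hz
    ext i
    rw [hf i z hz, Matrix.mulVec, dotProduct, Fin.sum_univ_two]
    have hint : ∀ j, Integrable fun s : ℝ => h s * (f i s * expRow x s j) / (z - s) := fun j =>
      (hV i j).cauchyAdmissible.integrable_div_of_im_ne_zero hz
    have h1 : ∫ s : ℝ, (σ s - 1) * f i s * (1 - Complex.exp (Complex.I * x * (z - s))) / (z - s)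
        = cauchyIntegral (fun s => h s * (f i s * expRow x s 0)) z * expColumn x z 0 +
          cauchyIntegral (fun s => h s * (f i s * expRow x s 1)) z * expColumn x z 1 := by
      rw [cauchyIntegral, cauchyIntegral, ← integral_mul_const, ← integral_mul_const,
        ← integral_add ((hint 0).mul_const _) ((hint 1).mul_const _)]
      refine integral_congr_ae (Eventually.of_forall fun s => ?_)
      have h2 : Complex.exp (Complex.I * x * (z - s)) =
          Complex.exp (-(Complex.I * x * s)) * Complex.exp (Complex.I * x * z) := by
        rw [← Complex.exp_add]
        congr 1
        ring
      simp only [hhdef, h2, expRow, expColumn, Matrix.cons_val_zero, Matrix.cons_val_one]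
      ring
    rw [h1]
    fin_cases i <;> simp [hχ] <;> ring
  have hNu : ∀ z, (N z).mulVec (expColumn x z) = fun i => f i z := by
    have hoff : ∀ z : ℂ, z.im ≠ 0 → (N z).mulVec (expColumn x z) = fun i => f i z := by
      intro z hz
      rw [← hχu z hz, hχN z hz, Matrix.add_mulVec, Matrix.smul_mulVec, Matrix.vecMulVec_mulVec,
        expRow_dotProduct_expColumn]
      simp
    have hNc : Continuous N := continuous_matrix fun i j => (hNd i j).continuous
    have huc : Continuous (expColumn x) := by
      refine continuous_pi fun i => ?_
      fin_cases i
      · simp only [expColumn]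
        simp
        fun_prop
      · simp only [expColumn]
        simp
        fun_prop
    exact congrFun (Continuous.ext_on dense_im_ne_zero (hNc.matrix_mulVec huc)
      (continuous_pi fun i => (hfd i).continuous) hoff)
  have hfact : ∀ z : ℂ, z.im ≠ 0 →
      χ z = N z * (1 + cauchyTransform σ z • rankOneMatrix x z) := by
    intro z hz
    rw [hχN z hz, mul_add, mul_one, Matrix.mul_smul, rankOneMatrix_eq, Matrix.mul_vecMulVec, hNu]
  have hlim : Tendsto (fun z => N z * (1 + cauchyTransform σ z • rankOneMatrix x z))
      (Bornology.cobounded ℂ ⊓ 𝓟 {z : ℂ | z.im ≠ 0}) (𝓝 1) := by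
    have h1 : Tendsto χ (Bornology.cobounded ℂ ⊓ 𝓟 {z : ℂ | z.im ≠ 0}) (𝓝 1) := by
      refine tendsto_pi_nhds.2 fun i => tendsto_pi_nhds.2 fun j => ?_
      simpa [hχ] using ((hV i j).tendsto_cauchyIntegral.const_mul c).const_add
        ((1 : Matrix (Fin 2) (Fin 2) ℂ) i j)
    refine h1.congr' ?_
    filter_upwards [mem_inf_of_right (mem_principal_self _)] with z hz
    exact hfact z hz
  refine ⟨N, hNd, fun z => ?_, hlim⟩
  have hdd : Differentiable ℂ fun z => (N z).det := by
    simp_rw [Matrix.det_fin_two]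
    exact ((hNd 0 0).mul (hNd 1 1)).sub ((hNd 0 1).mul (hNd 1 0))
  refine eq_of_tendsto_off_real hdd ?_ z
  have h2 := (Continuous.matrix_det continuous_id).tendsto (1 : Matrix (Fin 2) (Fin 2) ℂ)
  simp only [id, Matrix.det_one] at h2
  refine (h2.comp hlim).congr fun w => ?_
  simp [Matrix.det_mul, det_one_add_smul_rankOneMatrix]

end Factorization

/-! ### Existence -/

lemma one_add_smul_rankOneMatrix_mul (x : ℝ) (p q z : ℂ) :
    (1 + p • rankOneMatrix x z) * (1 + q • rankOneMatrix x z) =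
      1 + (p + q) • rankOneMatrix x z := by
  rw [mul_add, mul_one, add_mul, one_mul, Matrix.smul_mul, Matrix.mul_smul, rankOneMatrix_mul_self,
    smul_zero, smul_zero, add_zero, add_smul, add_assoc]

lemma jumpMatrix_eq (σ : ℝ → ℂ) (x t : ℝ) :
    jumpMatrix σ x t = 1 + (σ t - 1) • rankOneMatrix x t := by
  ext i j
  fin_cases i <;> fin_cases j <;> simp [jumpMatrix, rankOneMatrix] <;> ring

lemma differentiable_rankOneMatrix_apply (x : ℝ) (i j : Fin 2) :
    Differentiable ℂ fun z => rankOneMatrix x z i j := by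
  fin_cases i <;> fin_cases j <;> simp [rankOneMatrix] <;> fun_prop

lemma continuous_rankOneMatrix (x : ℝ) : Continuous (rankOneMatrix x) :=
  continuous_matrix fun i j => (differentiable_rankOneMatrix_apply x i j).continuous

lemma differentiableOn_matrix_mul_apply {s : Set ℂ} {A B : ℂ → Matrix (Fin 2) (Fin 2) ℂ}
    (hA : ∀ i j, DifferentiableOn ℂ (fun z => A z i j) s)
    (hB : ∀ i j, DifferentiableOn ℂ (fun z => B z i j) s) (i j : Fin 2) :
    DifferentiableOn ℂ (fun z => (A z * B z) i j) s := by
  simp_rw [Matrix.mul_apply, Fin.sum_univ_two]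
  exact ((hA i 0).mul (hB 0 j)).add ((hA i 1).mul (hB 1 j))

/-- The two boundary values of `g` differ by `σ - 1`. -/
lemma exists_tendsto_cauchyTransform {σ : ℝ → ℂ} (hh : CauchyAdmissible fun s => σ s - 1) {t : ℝ}
    (hL : LipschitzNear σ t) : ∃ l : ℂ,
      Tendsto (cauchyTransform σ) (𝓝[{z : ℂ | 0 < z.im}] (t : ℂ)) (𝓝 l) ∧
      Tendsto (cauchyTransform σ) (𝓝[{z : ℂ | z.im < 0}] (t : ℂ)) (𝓝 (l + (σ t - 1))) := by
  obtain ⟨r, hr, L, hL⟩ := hL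
  obtain ⟨l, h1, h2⟩ := exists_tendsto_cauchyIntegral hh hr (L := L) (t := t)
    (fun s hs s' hs' => by simpa using hL s hs s' hs')
  have hc : cauchyTransform σ = fun z =>
      (1 / (2 * (Real.pi : ℂ) * Complex.I)) * cauchyIntegral (fun s => σ s - 1) z :=
    funext (cauchyTransform_eq σ)
  have hpi : (Real.pi : ℂ) ≠ 0 := Complex.ofReal_ne_zero.2 Real.pi_ne_zero
  rw [hc]
  refine ⟨_, h1.const_mul _, ?_⟩
  convert h2.const_mul (1 / (2 * (Real.pi : ℂ) * Complex.I)) using 2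
  field_simp
  ring

/-- Near `a k` the remainder in `N (1 + g B) = N(a k) (1 + g B(a k) + R)` is smooth plus `g` times
smooth, both vanishing at `a k`; the jump of `N (1 + g B)` is that of `g`, since `B² = 0`. -/
lemma isRHPSolution_of_entire_factor {n : ℕ} {a : Fin n → ℝ} {σ : ℝ → ℂ} {x : ℝ}
    {N : ℂ → Matrix (Fin 2) (Fin 2) ℂ} (hh : CauchyAdmissible fun s => σ s - 1)
    (hL : ∀ t, (∀ k, t ≠ a k) → LipschitzNear σ t) (hN : ∀ i j, Differentiable ℂ fun z => N z i j)
    (hdet : ∀ z, (N z).det = 1)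
    (hlim : Tendsto (fun z => N z * (1 + cauchyTransform σ z • rankOneMatrix x z))
      (Bornology.cobounded ℂ ⊓ 𝓟 {z : ℂ | z.im ≠ 0}) (𝓝 1)) :
    IsRHPSolution a σ x fun z => N z * (1 + cauchyTransform σ z • rankOneMatrix x z) where
  analytic := by
    refine differentiableOn_matrix_mul_apply (fun i j => (hN i j).differentiableOn) fun i j => ?_
    simp only [Matrix.add_apply, Matrix.smul_apply, smul_eq_mul, cauchyTransform_eq]
    exact (((hh.differentiableOn_cauchyIntegral).const_mul _).mul
      (differentiable_rankOneMatrix_apply x i j).differentiableOn).const_add _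
  singular := by
    intro k
    set b : ℂ := (a k : ℂ) with hb
    have hb1 : (N b).det ≠ 0 := by simp [hdet]
    have hadj : N b * (N b).adjugate = 1 := by rw [Matrix.mul_adjugate, hdet, one_smul]
    have hadj' : (N b).adjugate * N b = 1 := by rw [Matrix.adjugate_mul, hdet, one_smul]
    -- The remainder is `P + g Q`, where `P` and `Q` are entire and vanish at the point.
    set P : ℂ → Matrix (Fin 2) (Fin 2) ℂ := fun z => (N b).adjugate * N z with hP
    set Q : ℂ → Matrix (Fin 2) (Fin 2) ℂ := fun z => P z * rankOneMatrix x z with hQ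
    refine ⟨Matrix.GeneralLinearGroup.mkOfDetNeZero (N b) hb1,
      fun z => (P z - P b) + cauchyTransform σ z • (Q z - Q b), Eventually.of_forall fun z => ?_,
      fun i j => ?_⟩
    · have h1 : P b = 1 := hadj'
      have h2 : Q b = rankOneMatrix x b := by simp only [hQ, h1, one_mul]
      change _ = N b * _
      have h3 : (1 + cauchyTransform σ z • rankOneMatrix x b +
          (P z - P b + cauchyTransform σ z • (Q z - Q b))) =
          P z * (1 + cauchyTransform σ z • rankOneMatrix x z) := by
        rw [mul_add, mul_one, Matrix.mul_smul, h1, h2, smul_sub]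
        abel
      rw [h3, hP, ← mul_assoc, ← mul_assoc, hadj, one_mul]
    · have hPd : ∀ i j, DifferentiableOn ℂ (fun z => P z i j) Set.univ :=
        differentiableOn_matrix_mul_apply (fun _ _ => differentiableOn_const _)
          fun i j => (hN i j).differentiableOn
      have hQd : ∀ i j, DifferentiableOn ℂ (fun z => Q z i j) Set.univ :=
        differentiableOn_matrix_mul_apply hPd fun i j =>
          (differentiable_rankOneMatrix_apply x i j).differentiableOn
      have hPO := (((hPd i j).differentiableAt univ_mem).isBigO_sub (x₀ := b)).mono
        (nhdsWithin_le_nhds (s := {z : ℂ | z.im ≠ 0}))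
      have hQO := (((hQd i j).differentiableAt univ_mem).isBigO_sub (x₀ := b)).mono
        (nhdsWithin_le_nhds (s := {z : ℂ | z.im ≠ 0}))
      have hz1 : (fun z : ℂ => z - b) =O[𝓝[{z : ℂ | z.im ≠ 0}] b]
          fun z => ‖z - b‖ * (‖cauchyTransform σ z‖ + 1) := by
        refine Asymptotics.IsBigO.of_norm_le fun z => ?_
        nlinarith [norm_nonneg (z - b), norm_nonneg (cauchyTransform σ z),
          mul_nonneg (norm_nonneg (z - b)) (norm_nonneg (cauchyTransform σ z))]
      have hz2 : (fun z : ℂ => cauchyTransform σ z * (z - b)) =O[𝓝[{z : ℂ | z.im ≠ 0}] b]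
          fun z => ‖z - b‖ * (‖cauchyTransform σ z‖ + 1) := by
        refine Asymptotics.IsBigO.of_norm_le fun z => ?_
        rw [norm_mul]
        nlinarith [norm_nonneg (z - b)]
      exact (hPO.trans hz1).add
        (((Asymptotics.isBigO_refl (cauchyTransform σ) _).mul hQO).trans hz2)
  infinity := hlim
  jump := by
    intro t ht
    obtain ⟨l, h1, h2⟩ := exists_tendsto_cauchyTransform hh (hL t ht)
    have hNc : Continuous N := continuous_matrix fun i j => (hN i j).continuous
    have hlim : ∀ {s : Set ℂ} {c : ℂ}, Tendsto (cauchyTransform σ) (𝓝[s] (t : ℂ)) (𝓝 c) →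
        Tendsto (fun z => N z * (1 + cauchyTransform σ z • rankOneMatrix x z)) (𝓝[s] (t : ℂ))
          (𝓝 (N t * (1 + c • rankOneMatrix x t))) := fun h =>
      (hNc.continuousAt.tendsto.mono_left nhdsWithin_le_nhds).mul
        ((h.smul ((continuous_rankOneMatrix x).continuousAt.tendsto.mono_left
          nhdsWithin_le_nhds)).const_add 1)
    refine ⟨_, _, hlim h1, hlim h2, ?_⟩
    rw [jumpMatrix_eq, mul_assoc, one_add_smul_rankOneMatrix_mul]

/-! ### Uniqueness -/

lemma adjugate_one_add_smul_rankOneMatrix (x : ℝ) (c z : ℂ) :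
    (1 + c • rankOneMatrix x z).adjugate = 1 - c • rankOneMatrix x z := by
  ext i j
  rw [Matrix.adjugate_fin_two]
  fin_cases i <;> fin_cases j <;> simp [rankOneMatrix]
  ring

/-- Liouville's theorem for the quotient of an arbitrary solution by one that factors as
`N (1 + g B)`: the jumps cancel, and each singularity is weaker than a pole. -/
lemma eqOn_of_entire_factor {n : ℕ} {a : Fin n → ℝ} {σ : ℝ → ℂ} {x : ℝ}
    {N χ : ℂ → Matrix (Fin 2) (Fin 2) ℂ} (hh : CauchyAdmissible fun s => σ s - 1)
    (hL : ∀ t, (∀ k, t ≠ a k) → LipschitzNear σ t)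
    (hS : ∀ k, MildSingularity (fun s => σ s - 1) (a k))
    (hN : ∀ i j, Differentiable ℂ fun z => N z i j) (hdet : ∀ z, (N z).det = 1)
    (hlim : Tendsto (fun z => N z * (1 + cauchyTransform σ z • rankOneMatrix x z))
      (Bornology.cobounded ℂ ⊓ 𝓟 {z : ℂ | z.im ≠ 0}) (𝓝 1)) (hχ : IsRHPSolution a σ x χ) :
    Set.EqOn χ (fun z => N z * (1 + cauchyTransform σ z • rankOneMatrix x z))
      {z : ℂ | z.im ≠ 0} := by
  set χ₀ : ℂ → Matrix (Fin 2) (Fin 2) ℂ :=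
    fun z => N z * (1 + cauchyTransform σ z • rankOneMatrix x z) with hχ₀
  have hadj : ∀ z, (χ₀ z).adjugate =
      (1 - cauchyTransform σ z • rankOneMatrix x z) * (N z).adjugate := fun z => by
    rw [hχ₀, Matrix.adjugate_mul_distrib, adjugate_one_add_smul_rankOneMatrix]
  have hχ₀det : ∀ z, (χ₀ z).det = 1 := fun z => by
    rw [hχ₀, Matrix.det_mul, hdet, det_one_add_smul_rankOneMatrix, one_mul]
  have hNc : Continuous N := continuous_matrix fun i j => (hN i j).continuous
  have hNadj : Continuous fun z => (N z).adjugate := hNc.matrix_adjugate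
  have hχ₀sol := isRHPSolution_of_entire_factor hh hL hN hdet hlim
  set W : ℂ → Matrix (Fin 2) (Fin 2) ℂ := fun z => χ z * (χ₀ z).adjugate with hW
  have hWd : ∀ i j, DifferentiableOn ℂ (fun z => W z i j) {z : ℂ | z.im ≠ 0} := by
    refine differentiableOn_matrix_mul_apply hχ.analytic fun i j => ?_
    have h := hχ₀sol.analytic
    simp_rw [Matrix.adjugate_fin_two]
    fin_cases i <;> fin_cases j
    · exact h 1 1
    · exact (h 0 1).neg
    · exact (h 1 0).neg
    · exact h 0 0
  have hWjump : ∀ t : ℝ, (∀ k, t ≠ a k) →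
      ∃ l, Tendsto W (𝓝[{z : ℂ | z.im ≠ 0}] (t : ℂ)) (𝓝 l) := by
    intro t ht
    obtain ⟨χp, χm, hp, hm, hj⟩ := hχ.jump t ht
    obtain ⟨l, h1, h2⟩ := exists_tendsto_cauchyTransform hh (hL t ht)
    have hl : ∀ {s : Set ℂ} {c : ℂ}, Tendsto (cauchyTransform σ) (𝓝[s] (t : ℂ)) (𝓝 c) →
        Tendsto (fun z => (χ₀ z).adjugate) (𝓝[s] (t : ℂ))
          (𝓝 ((1 + (-c) • rankOneMatrix x t) * (N t).adjugate)) := fun h => by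
      simp_rw [hadj, neg_smul, ← sub_eq_add_neg]
      exact ((h.smul ((continuous_rankOneMatrix x).continuousAt.tendsto.mono_left
        nhdsWithin_le_nhds)).const_sub 1).mul
          (hNadj.continuousAt.tendsto.mono_left nhdsWithin_le_nhds)
    have hset : {z : ℂ | z.im ≠ 0} = {z : ℂ | 0 < z.im} ∪ {z : ℂ | z.im < 0} := by
      ext z
      simp only [Set.mem_ofPred_eq, Set.mem_union]
      exact ne_iff_lt_or_gt.trans or_comm
    have hp' := hp.mul (hl h1)
    have hm' := hm.mul (hl h2)
    rw [← hj, jumpMatrix_eq, mul_assoc χp, ← mul_assoc (1 + (σ t - 1) • _),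
      one_add_smul_rankOneMatrix_mul, show σ t - 1 + -(l + (σ t - 1)) = -l by ring] at hm'
    refine ⟨χp * ((1 + (-l) • rankOneMatrix x t) * (N t).adjugate), ?_⟩
    rw [hset, nhdsWithin_union]
    exact hp'.sup hm'
  have hWsing : ∀ k, Tendsto (fun z : ℂ => (z - (a k : ℂ)) • W z) (𝓝[{z : ℂ | z.im ≠ 0}] (a k : ℂ))
      (𝓝 0) := by
    intro k
    set b : ℂ := (a k : ℂ) with hb
    set ℓ := 𝓝[{z : ℂ | z.im ≠ 0}] b with hℓ
    set g := cauchyTransform σ with hg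
    set B := rankOneMatrix x with hB
    obtain ⟨M, R, hMR, hR⟩ := hχ.singular k
    have hz : Tendsto (fun z : ℂ => z - b) ℓ (𝓝 0) := by
      have h1 : Tendsto (fun z : ℂ => z - b) (𝓝 b) (𝓝 (b - b)) :=
        (continuous_id.sub continuous_const).tendsto b
      rw [sub_self] at h1
      exact h1.mono_left nhdsWithin_le_nhds
    have hzg : Tendsto (fun z => (z - b) * g z) ℓ (𝓝 0) := by
      have h1 := ((hS k).tendsto_mul_cauchyIntegral hh).const_mul
        (1 / (2 * (Real.pi : ℂ) * Complex.I))
      rw [mul_zero] at h1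
      refine h1.congr fun z => ?_
      rw [hg, cauchyTransform_eq]
      ring
    have hsmall : Tendsto (fun z => ‖z - b‖ * (‖g z‖ + 1)) ℓ (𝓝 0) := by
      have h1 := hzg.norm.add hz.norm
      rw [norm_zero, add_zero] at h1
      refine h1.congr fun z => ?_
      rw [norm_mul]
      ring
    have hR0 : Tendsto R ℓ (𝓝 0) :=
      tendsto_pi_nhds.2 fun i => tendsto_pi_nhds.2 fun j => (hR i j).trans_tendsto hsmall
    have hZ : Tendsto (fun z => g z • (B b - B z)) ℓ (𝓝 0) := by
      refine tendsto_pi_nhds.2 fun i => tendsto_pi_nhds.2 fun j => ?_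
      have h1 := ((differentiable_rankOneMatrix_apply x i j b).isBigO_sub).mono
        (nhdsWithin_le_nhds (s := {z : ℂ | z.im ≠ 0}))
      have h2 := ((Asymptotics.isBigO_refl g ℓ).mul h1).trans_tendsto
        (by simpa only [mul_comm] using hzg)
      rw [← neg_zero]
      refine h2.neg.congr fun z => ?_
      simp only [hB, Matrix.smul_apply, Matrix.sub_apply, smul_eq_mul]
      ring
    have hlin : ∀ c : ℂ, Tendsto (fun z => (z - b) • (1 + (c * g z) • B b)) ℓ (𝓝 0) := by
      intro c
      have h1 := (hz.smul_const (1 : Matrix (Fin 2) (Fin 2) ℂ)).add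
        ((hzg.const_mul c).smul_const (B b))
      rw [mul_zero, zero_smul, zero_smul, add_zero] at h1
      refine h1.congr fun z => ?_
      rw [smul_add, smul_smul]
      congr 2
      ring
    have hY : Tendsto (fun z => (z - b) • (1 + g z • B b + R z)) ℓ (𝓝 0) := by
      have h1 := (hlin 1).add (hz.smul hR0)
      rw [smul_zero, add_zero] at h1
      refine h1.congr fun z => ?_
      rw [one_mul, smul_add _ _ (R z)]
    -- `(1 + g B(b) + R) (1 - g B(z)) = 1 + (1 + g B(b) + R) g (B(b) - B(z)) + R (1 - g B(b))`
    have hmain : Tendsto (fun z => (z - b) • ((1 + g z • B b + R z) * (1 - g z • B z))) ℓ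
        (𝓝 0) := by
      have h1 := ((hz.smul_const (1 : Matrix (Fin 2) (Fin 2) ℂ)).add (hY.mul hZ)).add
        (hR0.mul (hlin (-1)))
      rw [zero_smul, mul_zero, add_zero, add_zero] at h1
      refine h1.congr fun z => ?_
      have h2 : (g z • B b) * (g z • B b) = 0 := by
        rw [Matrix.smul_mul, Matrix.mul_smul, hB, rankOneMatrix_mul_self, smul_zero, smul_zero]
      have h3 : ∀ (c : ℂ) (E D S : Matrix (Fin 2) (Fin 2) ℂ), E * E = 0 →
          c • 1 + c • (1 + E + S) * (E - D) + S * c • (1 + -E) = c • ((1 + E + S) * (1 - D)) := by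
        intro c E D S hE
        rw [Matrix.smul_mul, Matrix.mul_smul, ← smul_add, ← smul_add]
        congr 1
        have h4 : 1 + (1 + E + S) * (E - D) + S * (1 + -E) - (1 + E + S) * (1 - D) = E * E := by
          noncomm_ring
        rw [← sub_eq_zero, h4, hE]
      rw [neg_one_mul, neg_smul, smul_sub]
      exact h3 _ _ _ _ h2
    have h5 := (hmain.const_mul (M : Matrix (Fin 2) (Fin 2) ℂ)).mul
      ((hNadj.tendsto b).mono_left (nhdsWithin_le_nhds (s := {z : ℂ | z.im ≠ 0})))
    rw [mul_zero, zero_mul] at h5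
    refine h5.congr' ?_
    filter_upwards [hMR] with z hz
    simp only [hW]
    rw [hadj, hz, Matrix.mul_smul, Matrix.smul_mul]
    simp only [mul_assoc]
    rfl
  have hWinf : Tendsto W (Bornology.cobounded ℂ ⊓ 𝓟 {z : ℂ | z.im ≠ 0}) (𝓝 1) := by
    have h1 := (Continuous.matrix_adjugate continuous_id).tendsto (1 : Matrix (Fin 2) (Fin 2) ℂ)
    simp only [id, Matrix.adjugate_one] at h1
    simpa using hχ.infinity.mul (h1.comp hlim)
  have hW1 : ∀ z : ℂ, z.im ≠ 0 → W z = 1 := by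
    intro z hz
    ext i j
    refine eq_limit_of_off_real (A := Finset.univ.image a) (hWd i j) (fun t ht => ?_)
      (fun b hb => ?_) (tendsto_pi_nhds.1 (tendsto_pi_nhds.1 hWinf i) j) z hz
    · obtain ⟨l, hl⟩ := hWjump t fun k hk =>
        ht (Finset.mem_image.2 ⟨k, Finset.mem_univ k, hk.symm⟩)
      exact ⟨_, tendsto_pi_nhds.1 (tendsto_pi_nhds.1 hl i) j⟩
    · obtain ⟨k, -, rfl⟩ := Finset.mem_image.1 hb
      exact tendsto_pi_nhds.1 (tendsto_pi_nhds.1 (hWsing k) i) j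
  intro z hz
  calc χ z = χ z * ((χ₀ z).adjugate * χ₀ z) := by
        rw [Matrix.adjugate_mul, hχ₀det, one_smul, mul_one]
    _ = W z * χ₀ z := by rw [← mul_assoc]
    _ = χ₀ z := by rw [hW1 z hz, one_mul]

end WienerHopfRHP

theorem mainTheorem5 (n : ℕ) (a : Fin n → ℝ) (ha : StrictMono a) (ν νbar : Fin n → ℂ)
    (F : ℂ → ℂ) (U : Set ℂ) (η κ x : ℝ)
    (hU : IsOpen U) (hη : 0 < η) (hstrip : ∀ z : ℂ, |z.im| < η → z ∈ U)
    (hF : DifferentiableOn ℂ F U) (hF0 : ∀ z ∈ U, F z ≠ 0)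
    (hκ : 0 < κ)
    (hFinf : (fun z => F z - 1) =O[Bornology.cobounded ℂ ⊓ 𝓟 U]
      fun z => ‖z‖ ^ (-((1 + κ) / 2)))
    (hx : 0 < x)
    (hγ : ∀ k, ((ν k + νbar k) / 2).re < 1 / 2)
    (hdet : WienerHopfRHP.det₂
      (WienerHopfRHP.wienerHopf (WienerHopfRHP.symbol a ν νbar F) x) ≠ 0) :
    (∃ χ : ℂ → Matrix (Fin 2) (Fin 2) ℂ,
      WienerHopfRHP.IsRHPSolution a (WienerHopfRHP.symbol a ν νbar F) x χ ∧
      ∀ χ' : ℂ → Matrix (Fin 2) (Fin 2) ℂ,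
        WienerHopfRHP.IsRHPSolution a (WienerHopfRHP.symbol a ν νbar F) x χ' →
        Set.EqOn χ' χ {z : ℂ | z.im ≠ 0}) ∧
    ∀ χ : ℂ → Matrix (Fin 2) (Fin 2) ℂ,
      WienerHopfRHP.IsRHPSolution a (WienerHopfRHP.symbol a ν νbar F) x χ →
      ∀ z : ℂ, z.im ≠ 0 → (χ z).det = 1 := by
  have hh := WienerHopfRHP.vanishingDensity_symbol ha hU hη hstrip hF hκ hFinf hγ
  have hL : ∀ t, (∀ k, t ≠ a k) →
      WienerHopfRHP.LipschitzNear (WienerHopfRHP.symbol a ν νbar F) t := fun t ht =>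
    WienerHopfRHP.lipschitzNear_symbol hU hη hstrip hF ht
  obtain ⟨N, hN, hNdet, hlim⟩ := WienerHopfRHP.exists_entire_factor hh hx hdet
  have huniq := fun χ => WienerHopfRHP.eqOn_of_entire_factor (χ := χ) hh.cauchyAdmissible hL
    (WienerHopfRHP.mildSingularity_symbol ha hU hη hstrip hF hγ) hN hNdet hlim
  refine ⟨⟨_, WienerHopfRHP.isRHPSolution_of_entire_factor hh.cauchyAdmissible hL hN hNdet hlim,
    huniq⟩, fun χ hχ z hz => ?_⟩
  rw [huniq χ hχ hz, Matrix.det_mul, hNdet, WienerHopfRHP.det_one_add_smul_rankOneMatrix, one_mul]
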